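/- Let $G$ be a (finite-dimensional, real) Lie group acting smoothly and properly on a finite-dimensional smooth manifold $M$ without boundary (Hausdorff and second countable). For $\xi\in\mathfrak g$ let $\xi_M(m)=\frac{d}{dt}\big|_{t=0}\exp(t\xi)\cdot m$, and let $\mathbf J:T^*M\to\mathfrak g^*$, $\langle \mathbf J(p_m),\xi\rangle=\langle p_m,\xi_M(m)\rangle$, be the momentum map of the cotangent-lifted action. Let $I_M$ be the set of conjugacy classes $(H)$ of isotropy groups $G_m$, $m\in M$, and for $(H)\in I_M$ put $M_{(H)}=\{m\in M: G_m\in(H)\}$. A $\Sigma$-submanifold of $M$ is a locally closed subset which, in the induced topology, is the topological sum of its connected components, countably many in number, each of which is an embedded submanifold of $M$ (of a dimension that may depend on the component). A $\Sigma$-vector bundle over it is a family of vector spaces that forms a smooth vector bundle over each connected component, of a rank that may depend on the component. Then: 1. For every $(H)\in I_M$ the orbit type $M_{(H)}$ is a $\Sigma$-submanifold of $M$. The infinitesimal generators are tangent to $M_{(H)}$; let $\mathbf J_{(H)}:T^*M_{(H)}\to\mathfrak g^*$, $\langle \mathbf J_{(H)}(\alpha_m),\xi\rangle=\langle\alpha_m,\xi_{M_{(H)}}(m)\rangle$,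 be the momentum map of the cotangent lift of the restricted action of $G$ on $M_{(H)}$. Then $\mathbf J_{(H)}^{-1}(0)$ is a $\Sigma$-vector subbundle of $T^*M_{(H)}$, and the conormal bundle $N^*M_{(H)}=\{p_m\in T^*_mM : m\in M_{(H)},\ p_m|_{T_mM_{(H)}}=0\}$ is a $\Sigma$-vector subbundle of $T^*M|_{M_{(H)}}$. 2. Let $\mathbf g$ be any smooth Riemannian metric on $M$ (for instance a $G$-invariant one), let $N_mM_{(H)}$ be the $\mathbf g$-orthogonal complement of $T_mM_{(H)}$ in $T_mM$, and embed $T^*M_{(H)}$ in $T^*M$ by extending covectors by zero on $N_mM_{(H)}$. Then, for every $(H)\in I_M$, the image of $\mathbf J_{(H)}^{-1}(0)$ is a $\Sigma$-vector subbundle of $T^*M|_{M_{(H)}}$, the map $(\alpha,\nu)\mapsto\alpha+\nu$ embeds the Whitney sum $\mathbf J_{(H)}^{-1}(0)\oplus N^*M_{(H)}$ injectively into $T^*M$, its image is a $\Sigma$-vector subbundle of $T^*M|_{M_{(H)}}$ over $M_{(H)}$, and, as a disjoint union, $$\mathbf J^{-1}(0)=\bigsqcup_{(H)\in I_M}\mathbf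 J_{(H)}^{-1}(0)\oplus N^*M_{(H)} .$$ -/

import Mathlib

open Set Filter Topology Bundle Manifold
open scoped ContDiff

noncomputable section

namespace CotangentOrbitTypes

/-! ### Conjugacy classes of isotropy groups and orbit types -/

section OrbitTypes

variable (G : Type*) [Group G]

/-- Conjugacy of subgroups of `G`. -/
def conjSetoid : Setoid (Subgroup G) where
  r H K := ∃ g : G, H.map (MulAut.conj g).toMonoidHom = K
  iseqv :=
    { refl := fun H => ⟨1, by
        ext x
        simp [Subgroup.mem_map]⟩
      symm := by
        rintro H K ⟨g, rfl⟩
        refine ⟨g⁻¹, ?_⟩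
        ext x
        simp only [Subgroup.mem_map]
        constructor
        · rintro ⟨_, ⟨y, hy, rfl⟩, rfl⟩
          simpa [mul_assoc] using hy
        · intro hx
          exact ⟨_, ⟨x, hx, rfl⟩, by simp [mul_assoc]⟩
      trans := by
        rintro H K L ⟨g, rfl⟩ ⟨h, rfl⟩
        refine ⟨h * g, ?_⟩
        ext x
        simp only [Subgroup.mem_map]
        constructor
        · rintro ⟨y, hy, rfl⟩
          exact ⟨_, ⟨y, hy, rfl⟩, by simp [mul_assoc]⟩
        · rintro ⟨_, ⟨y, hy, rfl⟩, rfl⟩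
          exact ⟨y, hy, by simp [mul_assoc]⟩ }

/-- The type of conjugacy classes `(H)` of subgroups `H` of `G`. -/
def SubgroupClass : Type _ := Quotient (conjSetoid G)

/-- The conjugacy class `(H)`. -/
def subgroupClass (H : Subgroup G) : SubgroupClass G := Quotient.mk (conjSetoid G) H

variable (M : Type*) [MulAction G M]

/-- The isotropy lattice `I_M`: the conjugacy classes of isotropy groups of points of `M`. -/
def isotropyLattice : Set (SubgroupClass G) :=
  range fun m : M => subgroupClass G (MulAction.stabilizer G m)

variable {G}

/-- The orbit type `M_(H)`: the points of `M` whose isotropy group lies in the class `(H)`. -/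
def orbitType (c : SubgroupClass G) : Set M :=
  {m | subgroupClass G (MulAction.stabilizer G m) = c}

variable {M}

theorem smul_mem_orbitType {c : SubgroupClass G} {m : M} (hm : m ∈ orbitType M c) (g : G) :
    g • m ∈ orbitType M c := by
  have h : subgroupClass G (MulAction.stabilizer G m) = c := hm
  change subgroupClass G (MulAction.stabilizer G (g • m)) = c
  rw [← h]
  refine (Quotient.sound (s := conjSetoid G) ⟨g, ?_⟩).symm
  exact (MulAction.stabilizer_smul_eq_stabilizer_map_conj g m).symm

end OrbitTypes

/-! ### Submanifolds and `Σ`-submanifolds -/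

section Submanifolds

variable (E : Type*) [NormedAddCommGroup E] [NormedSpace ℝ E]
  {M : Type*} [TopologicalSpace M] [ChartedSpace E M]

/-- `S` is an embedded `k`-dimensional smooth submanifold of `M` (without boundary): around each
of its points there is a smooth chart of `M` in which `S` is a `k`-dimensional linear subspace. -/
def IsEmbeddedSubmanifold (k : ℕ) (S : Set M) : Prop :=
  ∀ x ∈ S, ∃ φ ∈ IsManifold.maximalAtlas 𝓘(ℝ, E) ∞ M, x ∈ φ.source ∧
    ∃ W : Submodule ℝ E, Module.finrank ℝ W = k ∧ ∀ y ∈ φ.source, y ∈ S ↔ φ y ∈ W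

/-- `S` is a (locally closed) `Σ`-submanifold of `M`: in the induced topology it is the
topological sum of its connected components, of which there are countably many, and each of them
is an embedded submanifold of `M`, of a dimension that may depend on the component. -/
structure IsSigmaSubmanifold (S : Set M) : Prop where
  isLocallyClosed : IsLocallyClosed S
  isOpen_component : ∀ x : S, IsOpen (connectedComponent x)
  countable_components : Countable (ConnectedComponents S)
  submanifold_component : ∀ x ∈ S, ∃ k, IsEmbeddedSubmanifold E k (connectedComponentIn S x)

/-- The tangent space `T_m S ⊆ T_m M` of a subset `S` of `M` at `m`, spanned by the
velocities at `m` of the smooth curves that run in `S`. -/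
def tangentSpaceOf (S : Set M) (m : M) : Submodule ℝ (TangentSpace 𝓘(ℝ, E) m) :=
  Submodule.span ℝ {v | ∃ γ : ℝ → M, γ 0 = m ∧ ContMDiffAt 𝓘(ℝ, ℝ) 𝓘(ℝ, E) ∞ γ 0 ∧
    (∀ᶠ t in 𝓝 (0 : ℝ), γ t ∈ S) ∧
    v = (mfderiv 𝓘(ℝ, ℝ) 𝓘(ℝ, E) γ 0 : ℝ →L[ℝ] E) 1}

/-- The cotangent space `T_m^* M`. -/
abbrev CotangentSpace (m : M) : Type _ := TangentSpace 𝓘(ℝ, E) m →L[ℝ] ℝ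

variable (M) in
/-- The cotangent bundle `T^* M`. -/
abbrev CotangentBundle : Type _ :=
  TotalSpace (E →L[ℝ] ℝ) (fun m : M => CotangentSpace E m)

/-- The cotangent space `T_m^* S`, the dual of `T_m S`. -/
abbrev CotangentSpaceOf (S : Set M) (m : M) : Type _ := tangentSpaceOf E S m →L[ℝ] ℝ

/-- The cotangent bundle `T^* S` of a `Σ`-submanifold `S` of `M`. -/
abbrev CotangentBundleOf (S : Set M) : Type _ := Σ m : S, CotangentSpaceOf E S (m : M)

/-- Restriction of covectors, `T_m^* M → T_m^* S`. -/
def restrictCovector (S : Set M) (m : M) : CotangentSpace E m →ₗ[ℝ] CotangentSpaceOf E S m where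
  toFun p := p.comp (tangentSpaceOf E S m).subtypeL
  map_add' _ _ := rfl
  map_smul' _ _ := rfl

/-- The fibre `N_m^* S` of the conormal bundle of `S`: the covectors of `M` at `m` that vanish on
`T_m S`. -/
def conormalSpace (S : Set M) (m : M) : Submodule ℝ (CotangentSpace E m) :=
  LinearMap.ker (restrictCovector E S m)

variable [IsManifold 𝓘(ℝ, E) ∞ M]

/-- The 1-form `σ` of `M` is smooth on `U`. -/
def IsSmoothOneFormOn (σ : ∀ m : M, CotangentSpace E m) (U : Set M) : Prop :=
  ContMDiffOn 𝓘(ℝ, E) (𝓘(ℝ, E).prod 𝓘(ℝ, E →L[ℝ] ℝ)) ∞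
    (fun m => TotalSpace.mk' (E →L[ℝ] ℝ) (E := fun m : M => TangentSpace 𝓘(ℝ, E) m →L[ℝ] ℝ)
      m (σ m)) U

/-- The subspaces `F m ⊆ T_m^* M`, `m ∈ S`, form a `Σ`-vector subbundle of `T^* M` over the
`Σ`-submanifold `S`: over each connected component of `S` they form a smooth vector subbundle of
`T^* M`, that is, they are locally spanned by a smooth frame, with a rank that
may depend on the component. -/
def IsSigmaSubbundle (S : Set M) (F : ∀ m : S, Submodule ℝ (CotangentSpace E (m : M))) : Prop :=
  ∀ x ∈ S, ∃ r : ℕ, ∀ y ∈ connectedComponentIn S x, ∃ U : Set M, IsOpen U ∧ y ∈ U ∧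
    ∃ σ : Fin r → ∀ m : M, CotangentSpace E m, (∀ i, IsSmoothOneFormOn E (σ i) U) ∧
      ∀ m : S, (m : M) ∈ U → (m : M) ∈ connectedComponentIn S x →
        LinearIndependent ℝ (fun i => σ i m) ∧
        Submodule.span ℝ (range fun i => σ i m) = F m

/-- The subspaces `F m ⊆ T_m^* S`, `m ∈ S`, form a `Σ`-vector subbundle of the cotangent bundle
`T^* S` of the `Σ`-submanifold `S`. The smooth 1-forms of an embedded submanifold are locally the
restrictions of smooth 1-forms of `M`. -/
def IsSigmaSubbundleOf (S : Set M) (F : ∀ m : S, Submodule ℝ (CotangentSpaceOf E S (m : M))) :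
    Prop :=
  ∀ x ∈ S, ∃ r : ℕ, ∀ y ∈ connectedComponentIn S x, ∃ U : Set M, IsOpen U ∧ y ∈ U ∧
    ∃ σ : Fin r → ∀ m : M, CotangentSpace E m, (∀ i, IsSmoothOneFormOn E (σ i) U) ∧
      ∀ m : S, (m : M) ∈ U → (m : M) ∈ connectedComponentIn S x →
        LinearIndependent ℝ (fun i => restrictCovector E S m (σ i m)) ∧
        Submodule.span ℝ (range fun i => restrictCovector E S m (σ i m)) = F m

end Submanifolds

/-! ### The splitting of `T_m^* M` given by a Riemannian metric -/

section Metric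

variable {E : Type*} [NormedAddCommGroup E] [NormedSpace ℝ E] [FiniteDimensional ℝ E]
  {M : Type*} [TopologicalSpace M] [ChartedSpace E M] [IsManifold 𝓘(ℝ, E) ∞ M]

/-- Smooth Riemannian metrics on `M`. -/
abbrev SmoothMetric (E : Type*) [NormedAddCommGroup E] [NormedSpace ℝ E]
    (M : Type*) [TopologicalSpace M] [ChartedSpace E M] [IsManifold 𝓘(ℝ, E) ∞ M] : Type _ :=
  ContMDiffRiemannianMetric 𝓘(ℝ, E) ∞ E (fun m : M => TangentSpace 𝓘(ℝ, E) m)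

/-- The normal space `N_m S`, the orthogonal complement of `T_m S` in `T_m M`. -/
def normalSpace (g : SmoothMetric E M) (S : Set M) (m : M) :
    Submodule ℝ (TangentSpace 𝓘(ℝ, E) m) where
  carrier := {v | ∀ w ∈ tangentSpaceOf E S m, g.inner m w v = 0}
  zero_mem' := fun w _ => map_zero _
  add_mem' := fun {a b} ha hb w hw => by rw [map_add, ha w hw, hb w hw, add_zero]
  smul_mem' := fun c v hv w hw => by rw [map_smul, hv w hw, smul_zero]

theorem isCompl_normalSpace (g : SmoothMetric E M) (S : Set M) (m : M) :
    IsCompl (tangentSpaceOf E S m) (normalSpace g S m) := by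
  have : FiniteDimensional ℝ (TangentSpace 𝓘(ℝ, E) m) := inferInstanceAs (FiniteDimensional ℝ E)
  let B : LinearMap.BilinForm ℝ (TangentSpace 𝓘(ℝ, E) m) :=
    LinearMap.mk₂ ℝ (fun v w => g.inner m v w) (by simp) (by simp) (by simp) (by simp)
  have hB : B.IsRefl := fun v w h => by
    change g.inner m w v = 0
    rw [g.symm]; exact h
  have key : IsCompl (tangentSpaceOf E S m) (B.orthogonal (tangentSpaceOf E S m)) := by
    rw [LinearMap.BilinForm.isCompl_orthogonal_iff_disjoint hB, Submodule.disjoint_def]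
    intro v hv hv'
    by_contra h0
    have h1 : g.inner m v v = 0 := hv' v hv
    exact (g.pos m v h0).ne' h1
  exact key

/-- The embedding `T_m^* S → T_m^* M` given by the splitting `T_m M = T_m S ⊕ N_m S`: a covector
of `S` is extended by zero on `N_m S`. -/
def extendCovector (g : SmoothMetric E M) (S : Set M) (m : M) :
    CotangentSpaceOf E S m →ₗ[ℝ] CotangentSpace E m :=
  haveI : FiniteDimensional ℝ (TangentSpace 𝓘(ℝ, E) m) := inferInstanceAs (FiniteDimensional ℝ E)
  haveI : T2Space (TangentSpace 𝓘(ℝ, E) m) := inferInstanceAs (T2Space E)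
  { toFun := fun α => α.comp
      (Submodule.projectionOnto _ _ (isCompl_normalSpace g S m)).toContinuousLinearMap
    map_add' := fun _ _ => rfl
    map_smul' := fun _ _ => rfl }

end Metric

/-! ### Momentum maps -/

section Momentum

variable {EG : Type*} [NormedAddCommGroup EG] [NormedSpace ℝ EG]
  {E : Type*} [NormedAddCommGroup E] [NormedSpace ℝ E]
  {G : Type*} [TopologicalSpace G] [ChartedSpace EG G] [Group G] [LieGroup 𝓘(ℝ, EG) ∞ G]
  {M : Type*} [TopologicalSpace M] [ChartedSpace E M]
  [MulAction G M]

variable (EG E G) in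
/-- The infinitesimal generator at `m`, `ξ ↦ ξ_M(m)`: the derivative at the identity of the orbit
map `g ↦ g • m`. -/
def generator (m : M) : GroupLieAlgebra 𝓘(ℝ, EG) G →L[ℝ] TangentSpace 𝓘(ℝ, E) m :=
  (mfderiv 𝓘(ℝ, EG) 𝓘(ℝ, E) (fun g : G => g • m) 1 : EG →L[ℝ] E)

variable (EG E G M) in
/-- The momentum map `J : T^* M → 𝔤^*` of the cotangent lifted action,
`⟨J(p_m), ξ⟩ = ⟨p_m, ξ_M(m)⟩`. -/
def momentumMap (p : CotangentBundle E M) : GroupLieAlgebra 𝓘(ℝ, EG) G →L[ℝ] ℝ :=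
  p.2.comp (generator EG E G p.1)

variable [IsManifold 𝓘(ℝ, E) ∞ M] [ContMDiffSMul 𝓘(ℝ, EG) 𝓘(ℝ, E) ∞ G M]

/-- Tangency of the infinitesimal generators to the orbit types. -/
theorem generator_mem (c : SubgroupClass G) {m : M} (hm : m ∈ orbitType M c)
    (ξ : GroupLieAlgebra 𝓘(ℝ, EG) G) :
    generator EG E G m ξ ∈ tangentSpaceOf E (orbitType M c) m := by
  set φ := extChartAt 𝓘(ℝ, EG) (1 : G) with hφ
  let ζ : EG := ξ
  let l : ℝ → EG := fun t => φ 1 + t • ζ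
  let δ : ℝ → G := fun t => φ.symm (l t)
  have hl0 : l 0 = φ 1 := by simp [l]
  have hδ0 : δ 0 = 1 := by
    simp only [δ, hl0]
    exact extChartAt_to_inv 1
  have hl : ContMDiff 𝓘(ℝ, ℝ) 𝓘(ℝ, EG) ∞ l := by
    rw [contMDiff_iff_contDiff]
    fun_prop
  have hsymm : ContMDiffAt 𝓘(ℝ, EG) 𝓘(ℝ, EG) ∞ φ.symm (l 0) := by
    rw [hl0]
    exact (contMDiffOn_extChartAt_symm (I := 𝓘(ℝ, EG)) (n := ∞) (1 : G)).contMDiffAt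
      (extChartAt_target_mem_nhds 1)
  have hδ : ContMDiffAt 𝓘(ℝ, ℝ) 𝓘(ℝ, EG) ∞ δ 0 := hsymm.comp 0 hl.contMDiffAt
  have hδ' : (mfderiv 𝓘(ℝ, ℝ) 𝓘(ℝ, EG) δ 0 : ℝ →L[ℝ] EG) 1 = ξ := by
    have hd := hδ.mdifferentiableAt (by simp)
    rw [hd.mfderiv]
    have h1 : ∀ᶠ t in 𝓝 (0 : ℝ), l t ∈ φ.target := by
      apply hl.continuous.continuousAt
      rw [hl0]
      exact extChartAt_target_mem_nhds 1
    have h2 : writtenInExtChartAt 𝓘(ℝ, ℝ) 𝓘(ℝ, EG) 0 δ =ᶠ[𝓝 0] l := by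
      filter_upwards [h1] with t ht
      simp only [writtenInExtChartAt, Function.comp_apply, hδ0, extChartAt_model_space_eq_id,
        PartialEquiv.refl_symm, PartialEquiv.refl_coe, id_eq]
      exact φ.right_inv ht
    have h3 : HasFDerivAt l ((1 : ℝ →L[ℝ] ℝ).smulRight ζ) 0 :=
      ((1 : ℝ →L[ℝ] ℝ).smulRight ζ).hasFDerivAt.const_add (φ 1)
    have h4 : fderivWithin ℝ (writtenInExtChartAt 𝓘(ℝ, ℝ) 𝓘(ℝ, EG) 0 δ)
        (range 𝓘(ℝ, ℝ)) (extChartAt 𝓘(ℝ, ℝ) (0 : ℝ) 0) = (1 : ℝ →L[ℝ] ℝ).smulRight ζ := by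
      simp only [modelWithCornersSelf_coe, range_id, fderivWithin_univ,
        extChartAt_model_space_eq_id, PartialEquiv.refl_coe, id_eq]
      rw [h2.fderiv_eq, h3.fderiv]
    refine (congrArg (fun A : ℝ →L[ℝ] EG => A 1) h4).trans ?_
    change (1 : ℝ) • ζ = ζ
    exact one_smul ℝ ζ
  have horb : ContMDiff 𝓘(ℝ, EG) 𝓘(ℝ, E) ∞ (fun g : G => g • m) :=
    contMDiff_id.smul contMDiff_const
  refine Submodule.subset_span ⟨fun t => δ t • m, by simp [hδ0], ?_, ?_, ?_⟩
  · exact horb.contMDiffAt.comp 0 hδ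
  · exact Eventually.of_forall fun t => smul_mem_orbitType hm (δ t)
  · have hd := hδ.mdifferentiableAt (by simp)
    have ho : MDifferentiableAt 𝓘(ℝ, EG) 𝓘(ℝ, E) (fun g : G => g • m) (δ 0) :=
      horb.contMDiffAt.mdifferentiableAt (by simp)
    have hc := mfderiv_comp (0 : ℝ) ho hd
    have aux : ∀ x : G, x = 1 →
        (mfderiv 𝓘(ℝ, EG) 𝓘(ℝ, E) (fun g : G => g • m) x : EG →L[ℝ] E) =
          (mfderiv 𝓘(ℝ, EG) 𝓘(ℝ, E) (fun g : G => g • m) 1 : EG →L[ℝ] E) := by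
      rintro _ rfl
      rfl
    have h5 : (mfderiv 𝓘(ℝ, ℝ) 𝓘(ℝ, E) (fun t => δ t • m) 0 : ℝ →L[ℝ] E) 1 =
        (mfderiv 𝓘(ℝ, EG) 𝓘(ℝ, E) (fun g : G => g • m) (δ 0) : EG →L[ℝ] E)
          ((mfderiv 𝓘(ℝ, ℝ) 𝓘(ℝ, EG) δ 0 : ℝ →L[ℝ] EG) 1) :=
      congrArg (fun A : ℝ →L[ℝ] E => A 1) hc
    refine Eq.trans ?_ h5.symm
    rw [aux _ hδ0]
    exact congrArg _ hδ'.symm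

variable (EG E) in
/-- The infinitesimal generator `ξ ↦ ξ_{M_(H)}(m)` of the restricted action of `G` on `M_(H)`. -/
def orbitTypeGenerator (c : SubgroupClass G) (m : orbitType M c) :
    GroupLieAlgebra 𝓘(ℝ, EG) G →L[ℝ] tangentSpaceOf E (orbitType M c) (m : M) :=
  (generator EG E G (m : M)).codRestrict _ (generator_mem c m.2)

variable (EG E M) in
/-- The momentum map `J_(H) : T^* M_(H) → 𝔤^*` of the cotangent lift of the restricted action
of `G` on `M_(H)`. -/
def orbitTypeMomentumMap (c : SubgroupClass G) (α : CotangentBundleOf E (orbitType M c)) :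
    GroupLieAlgebra 𝓘(ℝ, EG) G →L[ℝ] ℝ :=
  α.2.comp (orbitTypeGenerator EG E c α.1)

variable (EG E) in
/-- The fibre of `J_(H)⁻¹(0)` over `m ∈ M_(H)`. -/
def orbitTypeZeroFibre (c : SubgroupClass G) (m : orbitType M c) :
    Submodule ℝ (CotangentSpaceOf E (orbitType M c) (m : M)) where
  carrier := {α | orbitTypeMomentumMap EG E M c ⟨m, α⟩ = 0}
  zero_mem' := ContinuousLinearMap.zero_comp _
  add_mem' := fun {a b} ha hb => by
    have h : (a + b).comp (orbitTypeGenerator EG E c m) = 0 := by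
      rw [ContinuousLinearMap.add_comp]
      exact (congrArg₂ (· + ·) ha hb).trans (add_zero _)
    exact h
  smul_mem' := fun r a ha => by
    have h : (r • a).comp (orbitTypeGenerator EG E c m) = 0 := by
      rw [ContinuousLinearMap.smul_comp]
      exact (congrArg (r • ·) ha).trans (smul_zero _)
    exact h

/-! ### The Whitney sums `J_(H)⁻¹(0) ⊕ N^* M_(H)` -/

variable (EG E M) in
/-- The total space of the Whitney sum `J_(H)⁻¹(0) ⊕ N^* M_(H)` over `M_(H)`. -/
abbrev WhitneySum (c : SubgroupClass G) : Type _ :=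
  Σ m : orbitType M c,
    (orbitTypeZeroFibre EG E c m × conormalSpace E (orbitType M c) (m : M))

variable [FiniteDimensional ℝ E]

variable (EG) in
/-- The fibre over `m` of the image of `J_(H)⁻¹(0)` in `T^* M`. -/
def zeroFibreInCotangent (g : SmoothMetric E M) (c : SubgroupClass G) (m : orbitType M c) :
    Submodule ℝ (CotangentSpace E (m : M)) :=
  (orbitTypeZeroFibre EG E c m).map (extendCovector g (orbitType M c) m)

variable (EG) in
/-- The map `(α, ν) ↦ α + ν` from the fibre over `m` of `J_(H)⁻¹(0) ⊕ N^* M_(H)` to `T_m^* M`. -/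
def whitneySumFibreMap (g : SmoothMetric E M) (c : SubgroupClass G) (m : orbitType M c) :
    (orbitTypeZeroFibre EG E c m × conormalSpace E (orbitType M c) (m : M)) →ₗ[ℝ]
      CotangentSpace E (m : M) :=
  LinearMap.coprod
    ((extendCovector g (orbitType M c) m).comp (orbitTypeZeroFibre EG E c m).subtype)
    (conormalSpace E (orbitType M c) (m : M)).subtype

variable (EG) in
/-- The map `J_(H)⁻¹(0) ⊕ N^* M_(H) → T^* M` over the inclusion `M_(H) → M`. -/
def whitneySumMap (g : SmoothMetric E M) (c : SubgroupClass G) (x : WhitneySum EG E M c) :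
    CotangentBundle E M :=
  ⟨(x.1 : M), whitneySumFibreMap EG g c x.1 x.2⟩

end Momentum

end CotangentOrbitTypes

end

/-!
The fibre of `J⁻¹(0)` over `m` is the annihilator of the tangent space of the orbit of `m`. The
orbits of points of one orbit type `S` are tangent to `S`, so the splitting `T_m M = T_m S ⊕ N_m S`
identifies this annihilator with the direct sum of the covectors of `S` that vanish on the orbit
directions and the conormal space of `S` (`mem_range_whitneySumFibreMap`). As the orbit types
partition `M`, the set-theoretic assertions follow. What needs work is smoothness, and it all comes
from `exists_orbitType_chart`: around each point of an orbit type there is a chart of `M` in which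
the orbit type is a linear subspace `W` and in which, along it, the tangent spaces of the orbits are
one fixed subspace `A ≤ W`. In such a chart the conormal spaces, the annihilators of the orbits and
the zero fibres of the momentum map of the orbit type become fixed spaces of linear forms, so that a
basis gives a smooth frame (`exists_rank_frame`); for the image of the last ones in `T^* M` the
constant forms are corrected by the orthogonal extension, which depends smoothly on the metric
(`contDiffOn_orthogonalExtension`). Ranks are locally constant, hence constant on components.

The chart is found by a version of the slice theorem that uses neither the exponential map nor the
theorem on closed subgroups. The isotropy group `H` of `m` is compact because the action is proper,
and averaging a chart over `H` makes `H` act linearly in it (`exists_equivariant_chart`, Bochner's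
linearization); another average gives an `H`-equivariant projection `p` onto the tangent space of
the orbit. The inverse function theorem then yields a tube chart, in which points are moved from the
slice `ker p` by group elements near `1` (`exists_isTubeChart`). Orbit maps have constant rank, so
in a tube chart the orbit of `m` is the range of `p` (`IsTubeChart.exists_ball_orbit`), and with
properness this shows that the isotropy groups of points of the slice near `m` lie in `H`
(`IsTubeChart.exists_isOpen_slice`).

Finally, such an isotropy group is conjugate to `H` only if it equals `H` (`stabilizer_eq_of_le`):
it has the dimension of `H`, hence is open in `H`, and a compact group with open components has
finitely many of them, so it is not homeomorphic to a proper clopen subset. So the orbit type of `m` meets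
the slice exactly in the fixed space of `H`, which is linear, and along it the orbits have constant
dimension, which makes their tangent spaces constant in the tube chart
(`IsTubeChart.range_proj_eq`).
-/

set_option linter.unusedSectionVars false
set_option maxSynthPendingDepth 3

noncomputable section

namespace CotangentOrbitTypes

/-! ### Integrals that depend smoothly on a parameter -/

section ParametricIntegral

open MeasureTheory

-- The smoothness of an integral is shown by an induction that replaces the target space `F` by
-- `E →L[ℝ] F`, so `E` and `F` have to live in one universe.
universe u
variable {EG : Type*} [NormedAddCommGroup EG] [NormedSpace ℝ EG]
  {G : Type*} [TopologicalSpace G] [ChartedSpace EG G] [IsManifold 𝓘(ℝ, EG) ∞ G]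
  {E : Type u} [NormedAddCommGroup E] [NormedSpace ℝ E]

/-- The derivative in the second variable of a jointly smooth map is jointly smooth. -/
theorem contMDiffOn_fderiv_snd {F : Type*} [NormedAddCommGroup F] [NormedSpace ℝ F]
    {f : G → E → F} {Q : Set (G × E)} (hQ : IsOpen Q)
    (hf : ContMDiffOn (𝓘(ℝ, EG).prod 𝓘(ℝ, E)) 𝓘(ℝ, F) ∞ (Function.uncurry f) Q) :
    ContMDiffOn (𝓘(ℝ, EG).prod 𝓘(ℝ, E)) 𝓘(ℝ, E →L[ℝ] F) ∞
      (Function.uncurry fun g e => fderiv ℝ (f g) e) Q := by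
  intro p hp
  have hfp : ContMDiffAt (𝓘(ℝ, EG).prod 𝓘(ℝ, E)) 𝓘(ℝ, F) ∞ (Function.uncurry f) p :=
    (hf p hp).contMDiffAt (hQ.mem_nhds hp)
  have h1 : ContMDiffAt ((𝓘(ℝ, EG).prod 𝓘(ℝ, E)).prod 𝓘(ℝ, E)) 𝓘(ℝ, F) ∞
      (Function.uncurry fun (r : G × E) (e : E) => f r.1 e) (p, p.2) := by
    have h2 : ContMDiffAt ((𝓘(ℝ, EG).prod 𝓘(ℝ, E)).prod 𝓘(ℝ, E)) (𝓘(ℝ, EG).prod 𝓘(ℝ, E)) ∞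
        (fun r : (G × E) × E => (r.1.1, r.2)) (p, p.2) :=
      (contMDiffAt_fst.comp _ contMDiffAt_fst).prodMk contMDiffAt_snd
    exact ContMDiffAt.comp (g := Function.uncurry f) (p, p.2) hfp h2
  have h3 := ContMDiffAt.mfderiv (m := ∞) (fun (r : G × E) (e : E) => f r.1 e) (fun r => r.2) h1
    contMDiffAt_snd le_rfl
  refine ContMDiffAt.contMDiffWithinAt ?_
  simp only [inTangentCoordinates_model_space, mfderiv_eq_fderiv] at h3
  exact h3

variable [FiniteDimensional ℝ E]
  {X : Type*} [TopologicalSpace X] [CompactSpace X] [MeasurableSpace X] [OpensMeasurableSpace X]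
  (μ : Measure X) [IsFiniteMeasure μ] {i : X → G}

theorem hasFDerivAt_integral_of_contMDiffOn (hi : Continuous i)
    {F : Type*} [NormedAddCommGroup F] [NormedSpace ℝ F] [FiniteDimensional ℝ F]
    {f : G → E → F} {Q : Set (G × E)} (hQ : IsOpen Q)
    (hf : ContMDiffOn (𝓘(ℝ, EG).prod 𝓘(ℝ, E)) 𝓘(ℝ, F) ∞ (Function.uncurry f) Q)
    {O : Set E} (hO : IsOpen O) (hOQ : ∀ e ∈ O, ∀ x, (i x, e) ∈ Q) {e : E} (he : e ∈ O) :
    HasFDerivAt (fun e => ∫ x, f (i x) e ∂μ) (∫ x, fderiv ℝ (f (i x)) e ∂μ) e := by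
  have : ProperSpace F := FiniteDimensional.proper ℝ F
  have : ProperSpace (E →L[ℝ] F) := FiniteDimensional.proper ℝ (E →L[ℝ] F)
  have : ProperSpace E := FiniteDimensional.proper ℝ E
  have hcont : ∀ e ∈ O, Continuous fun x => f (i x) e := fun e he =>
    hf.continuousOn.comp_continuous (hi.prodMk continuous_const) (fun x => hOQ e he x)
  have hf' := contMDiffOn_fderiv_snd hQ hf
  have hcont' : ∀ e ∈ O, Continuous fun x => (fderiv ℝ (f (i x)) e : E →L[ℝ] F) := fun e he =>
    hf'.continuousOn.comp_continuous (hi.prodMk continuous_const) (fun x => hOQ e he x)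
  obtain ⟨ε, hε, hball⟩ := Metric.nhds_basis_closedBall.mem_iff.1 (hO.mem_nhds he)
  have hK : IsCompact ((univ : Set X) ×ˢ Metric.closedBall e ε) :=
    isCompact_univ.prod (isCompact_closedBall e ε)
  obtain ⟨C, hC⟩ := hK.exists_bound_of_continuousOn
    (f := fun p : X × E => (fderiv ℝ (f (i p.1)) p.2 : E →L[ℝ] F)) <| by
      refine hf'.continuousOn.comp (f := fun p : X × E => (i p.1, p.2)) (by fun_prop) ?_
      rintro ⟨x, e'⟩ ⟨-, h⟩
      exact hOQ e' (hball h) x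
  refine hasFDerivAt_integral_of_dominated_of_fderiv_le (𝕜 := ℝ) (x₀ := e)
    (F := fun e x => f (i x) e) (F' := fun e x => fderiv ℝ (f (i x)) e) (bound := fun _ => C)
    (Metric.closedBall_mem_nhds e hε) ?_ ?_ ?_ ?_ ?_ ?_
  · filter_upwards [hO.mem_nhds he] with e' he'
    exact (hcont e' he').aestronglyMeasurable
  · exact (hcont e he).integrable_of_hasCompactSupport (HasCompactSupport.of_compactSpace _)
  · exact (hcont' e he).aestronglyMeasurable
  · exact Eventually.of_forall fun x e' he' => hC (x, e') ⟨mem_univ _, he'⟩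
  · exact integrable_const C
  · refine Eventually.of_forall fun x e' he' => ?_
    have h1 : ContMDiffAt (𝓘(ℝ, EG).prod 𝓘(ℝ, E)) 𝓘(ℝ, F) ∞ (Function.uncurry f) (i x, e') :=
      (hf _ (hOQ e' (hball he') x)).contMDiffAt (hQ.mem_nhds (hOQ e' (hball he') x))
    have h2 : ContMDiffAt 𝓘(ℝ, E) 𝓘(ℝ, F) ∞ (f (i x)) e' :=
      ContMDiffAt.comp (g := Function.uncurry f) (f := fun y => (i x, y)) e' h1
        (contMDiffAt_const.prodMk contMDiffAt_id)
    exact (h2.contDiffAt.differentiableAt (by simp)).hasFDerivAt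

/-- The integral over a compact space of a family of maps that depends smoothly on a parameter
is smooth in that parameter. -/
theorem contDiffOn_integral (hi : Continuous i)
    {F : Type u} [NormedAddCommGroup F] [NormedSpace ℝ F] [FiniteDimensional ℝ F]
    {f : G → E → F} {Q : Set (G × E)} (hQ : IsOpen Q)
    (hf : ContMDiffOn (𝓘(ℝ, EG).prod 𝓘(ℝ, E)) 𝓘(ℝ, F) ∞ (Function.uncurry f) Q)
    {O : Set E} (hO : IsOpen O) (hOQ : ∀ e ∈ O, ∀ x, (i x, e) ∈ Q) :
    ContDiffOn ℝ ∞ (fun e => ∫ x, f (i x) e ∂μ) O := by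
  rw [contDiffOn_infty]
  intro n
  induction n generalizing F with
  | zero =>
    exact contDiffOn_zero.2 fun e he =>
      (hasFDerivAt_integral_of_contMDiffOn μ hi hQ hf hO hOQ he).continuousAt.continuousWithinAt
  | succ n ih =>
    have hd := fun e (he : e ∈ O) => hasFDerivAt_integral_of_contMDiffOn μ hi hQ hf hO hOQ he
    push_cast
    rw [contDiffOn_succ_iff_fderiv_of_isOpen hO]
    refine ⟨fun e he => (hd e he).differentiableAt.differentiableWithinAt, by simp, ?_⟩
    exact (ih (contMDiffOn_fderiv_snd hQ hf)).congr fun e he => (hd e he).fderiv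

end ParametricIntegral

/-! ### Charts and the inverse function theorem -/

section InverseFunction

variable {E : Type*} [NormedAddCommGroup E] [NormedSpace ℝ E]

theorem mem_contDiffGroupoid_of_contDiffOn {e : OpenPartialHomeomorph E E}
    (h : ContDiffOn ℝ ∞ e e.source) (h' : ContDiffOn ℝ ∞ e.symm e.target) :
    e ∈ contDiffGroupoid ∞ 𝓘(ℝ, E) := by
  rw [contDiffGroupoid, mem_groupoid_of_pregroupoid]
  simp only [contDiffPregroupoid, modelWithCornersSelf_coe, modelWithCornersSelf_coe_symm,
    range_id, inter_univ, preimage_id_eq, id_eq, Function.id_comp, Function.comp_id]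
  exact ⟨h, h'⟩

theorem trans_mem_maximalAtlas {M : Type*} [TopologicalSpace M] [ChartedSpace E M]
    {φ : OpenPartialHomeomorph M E} (hφ : φ ∈ IsManifold.maximalAtlas 𝓘(ℝ, E) ∞ M)
    {e : OpenPartialHomeomorph E E} (he : e ∈ contDiffGroupoid ∞ 𝓘(ℝ, E)) :
    φ.trans e ∈ IsManifold.maximalAtlas 𝓘(ℝ, E) ∞ M := by
  rw [IsManifold.mem_maximalAtlas_iff, mem_maximalAtlas_iff] at hφ ⊢
  intro e' he'
  obtain ⟨h1, h2⟩ := hφ e' he'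
  constructor
  · rw [OpenPartialHomeomorph.trans_symm_eq_symm_trans_symm, OpenPartialHomeomorph.trans_assoc]
    exact StructureGroupoid.trans _ (StructureGroupoid.symm _ he) h1
  · rw [← OpenPartialHomeomorph.trans_assoc]
    exact StructureGroupoid.trans _ h2 he

theorem restr_isOpen_mem_maximalAtlas {M : Type*} [TopologicalSpace M] [ChartedSpace E M]
    {φ : OpenPartialHomeomorph M E} (hφ : φ ∈ IsManifold.maximalAtlas 𝓘(ℝ, E) ∞ M)
    {s : Set M} (hs : IsOpen s) :
    φ.restr s ∈ IsManifold.maximalAtlas 𝓘(ℝ, E) ∞ M :=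
  restr_mem_maximalAtlas (contDiffGroupoid ∞ 𝓘(ℝ, E)) hφ hs

variable [CompleteSpace E]

/-- The inverse function theorem: a smooth map with invertible derivative at a point is, near that
point, a diffeomorphism between open sets. -/
theorem exists_mem_contDiffGroupoid_eq {f : E → E} {O : Set E} (hO : IsOpen O)
    (hf : ContDiffOn ℝ ∞ f O) {x : E} (hx : x ∈ O) {f' : E ≃L[ℝ] E}
    (hf' : HasFDerivAt f (f' : E →L[ℝ] E) x) :
    ∃ e ∈ contDiffGroupoid ∞ 𝓘(ℝ, E), x ∈ e.source ∧ e.source ⊆ O ∧ ⇑e = f := by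
  have hfx : ContDiffAt ℝ ∞ f x := hf.contDiffAt (hO.mem_nhds hx)
  let e₀ := hfx.toOpenPartialHomeomorph f hf' (by simp)
  let O' := O ∩ fderiv ℝ f ⁻¹' range ((↑) : (E ≃L[ℝ] E) → E →L[ℝ] E)
  have hO' : IsOpen O' :=
    (hf.continuousOn_fderiv_of_isOpen hO (by simp)).isOpen_inter_preimage hO
      ContinuousLinearEquiv.isOpen
  have hxO' : x ∈ O' := ⟨hx, f', hf'.fderiv.symm⟩
  have hsub : (e₀.restrOpen O' hO').source ⊆ O' := fun y hy => hy.2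
  refine ⟨e₀.restrOpen O' hO', mem_contDiffGroupoid_of_contDiffOn ?_ ?_,
    ⟨hfx.mem_toOpenPartialHomeomorph_source hf' (by simp), hxO'⟩, fun y hy => hy.2.1, rfl⟩
  · exact hf.mono fun y hy => hy.2.1
  · intro y hy
    set z := (e₀.restrOpen O' hO').symm y with hz
    have hzs : z ∈ (e₀.restrOpen O' hO').source := (e₀.restrOpen O' hO').map_target hy
    obtain ⟨hzO, g', hg'⟩ := hsub hzs
    have hcd : ContDiffAt ℝ ∞ f z := hf.contDiffAt (hO.mem_nhds hzO)
    refine (OpenPartialHomeomorph.contDiffAt_symm (e₀.restrOpen O' hO') hy (f₀' := g') ?_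
      hcd).contDiffWithinAt
    have := (hcd.differentiableAt (by simp)).hasFDerivAt
    rw [← hg'] at this
    exact this

end InverseFunction

/-! ### Derivatives without base points -/

section Derivative

variable (E : Type*) [NormedAddCommGroup E] [NormedSpace ℝ E]
  (E' : Type*) [NormedAddCommGroup E'] [NormedSpace ℝ E']
  (E'' : Type*) [NormedAddCommGroup E''] [NormedSpace ℝ E'']
  {M : Type*} [TopologicalSpace M] [ChartedSpace E M]
  {M' : Type*} [TopologicalSpace M'] [ChartedSpace E' M']
  {M'' : Type*} [TopologicalSpace M''] [ChartedSpace E'' M'']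

/-- The derivative of a map of manifolds at a point, read as a map of the model spaces. Every
tangent space is a copy of the model space, so this is `mfderiv` with its type forgetting the
base points. -/
def derivMap (f : M → M') (x : M) : E →L[ℝ] E' := mfderiv 𝓘(ℝ, E) 𝓘(ℝ, E') f x

variable {E E' E''}

theorem derivMap_comp {g : M' → M''} {f : M → M'} {x : M} {y : M'} (hy : f x = y)
    (hg : MDifferentiableAt 𝓘(ℝ, E') 𝓘(ℝ, E'') g y)
    (hf : MDifferentiableAt 𝓘(ℝ, E) 𝓘(ℝ, E') f x) :
    derivMap E E'' (fun x => g (f x)) x = (derivMap E' E'' g y).comp (derivMap E E' f x) := by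
  subst hy
  exact mfderiv_comp x hg hf

theorem derivMap_eq_fderiv {f : E → E'} {x : E} : derivMap E E' f x = fderiv ℝ f x :=
  mfderiv_eq_fderiv

theorem derivMap_congr {f g : M → M'} {x : M} (h : f =ᶠ[𝓝 x] g) :
    derivMap E E' f x = derivMap E E' g x :=
  congrArg (fun A : E →L[ℝ] E' => A) h.mfderiv_eq

theorem derivMap_const {c : M'} {x : M} : derivMap E E' (fun _ : M => c) x = 0 :=
  mfderiv_const

theorem derivMap_id {x : M} : derivMap E E (fun y : M => y) x = ContinuousLinearMap.id ℝ E :=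
  mfderiv_id

/-- A map with a differentiable local left inverse has a left invertible derivative. -/
theorem derivMap_comp_eq_id {g : M' → M} {f : M → M'} {x : M} {y : M'} (hy : f x = y)
    (hg : MDifferentiableAt 𝓘(ℝ, E') 𝓘(ℝ, E) g y)
    (hf : MDifferentiableAt 𝓘(ℝ, E) 𝓘(ℝ, E') f x) (h : ∀ᶠ z in 𝓝 x, g (f z) = z) :
    (derivMap E' E g y).comp (derivMap E E' f x) = ContinuousLinearMap.id ℝ E := by
  rw [← derivMap_comp hy hg hf, derivMap_congr h, derivMap_id]

section Chart

variable {χ : OpenPartialHomeomorph M E} (hχ : χ ∈ IsManifold.maximalAtlas 𝓘(ℝ, E) ∞ M)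
include hχ

theorem mdifferentiableAt_chart {x : M} (hx : x ∈ χ.source) :
    MDifferentiableAt 𝓘(ℝ, E) 𝓘(ℝ, E) χ x :=
  (contMDiffAt_of_mem_maximalAtlas hχ hx).mdifferentiableAt (by simp)

theorem mdifferentiableAt_chart_symm {e : E} (he : e ∈ χ.target) :
    MDifferentiableAt 𝓘(ℝ, E) 𝓘(ℝ, E) χ.symm e :=
  (contMDiffAt_symm_of_mem_maximalAtlas hχ he).mdifferentiableAt (by simp)

theorem derivMap_symm_comp_chart {x : M} (hx : x ∈ χ.source) :
    (derivMap E E χ.symm (χ x)).comp (derivMap E E χ x) = ContinuousLinearMap.id ℝ E :=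
  derivMap_comp_eq_id rfl (mdifferentiableAt_chart_symm hχ (χ.map_source hx))
    (mdifferentiableAt_chart hχ hx) (by
      filter_upwards [χ.open_source.mem_nhds hx] with z hz using χ.left_inv hz)

theorem derivMap_chart_comp_symm {x : M} (hx : x ∈ χ.source) :
    (derivMap E E χ x).comp (derivMap E E χ.symm (χ x)) = ContinuousLinearMap.id ℝ E :=
  derivMap_comp_eq_id (χ.left_inv hx) (mdifferentiableAt_chart hχ hx)
    (mdifferentiableAt_chart_symm hχ (χ.map_source hx)) (by
      filter_upwards [χ.open_target.mem_nhds (χ.map_source hx)] with z hz using χ.right_inv hz)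

/-- The derivative of a chart as a linear equivalence. -/
def derivChart {x : M} (hx : x ∈ χ.source) : E ≃L[ℝ] E :=
  ContinuousLinearEquiv.equivOfInverse (derivMap E E χ x) (derivMap E E χ.symm (χ x))
    (fun v => congrArg (fun A : E →L[ℝ] E => A v) (derivMap_symm_comp_chart hχ hx))
    (fun v => congrArg (fun A : E →L[ℝ] E => A v) (derivMap_chart_comp_symm hχ hx))

end Chart

end Derivative

/-! ### Derivatives of orbit maps -/

section OrbitMaps

variable {EG : Type*} [NormedAddCommGroup EG] [NormedSpace ℝ EG]
  {G : Type*} [TopologicalSpace G] [ChartedSpace EG G] [Group G] [LieGroup 𝓘(ℝ, EG) ∞ G]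
  {E : Type*} [NormedAddCommGroup E] [NormedSpace ℝ E]
  {M : Type*} [TopologicalSpace M] [ChartedSpace E M]
  [MulAction G M] [ContMDiffSMul 𝓘(ℝ, EG) 𝓘(ℝ, E) ∞ G M]

theorem contMDiff_orbitMap (x : M) :
    ContMDiff 𝓘(ℝ, EG) 𝓘(ℝ, E) ∞ (fun k : G => k • x) :=
  contMDiff_id.smul contMDiff_const

theorem mdifferentiable_orbitMap (x : M) :
    MDifferentiable 𝓘(ℝ, EG) 𝓘(ℝ, E) (fun k : G => k • x) :=
  (contMDiff_orbitMap x).mdifferentiable (by simp)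

variable (EG) in
include EG in
theorem mdifferentiable_const_smul (g : G) :
    MDifferentiable 𝓘(ℝ, E) 𝓘(ℝ, E) (fun x : M => g • x) :=
  (ContMDiffSMul.contMDiff_const_smul (I := 𝓘(ℝ, EG)) (n := ∞) g).mdifferentiable (by simp)

theorem mdifferentiable_leftMul (g : G) :
    MDifferentiable 𝓘(ℝ, EG) 𝓘(ℝ, EG) (fun x : G => g * x) :=
  (contMDiff_mul_left (I := 𝓘(ℝ, EG)) (n := ∞) (a := g)).mdifferentiable (by simp)

theorem mdifferentiable_rightMul (g : G) :
    MDifferentiable 𝓘(ℝ, EG) 𝓘(ℝ, EG) (fun x : G => x * g) :=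
  (contMDiff_mul_right (I := 𝓘(ℝ, EG)) (n := ∞) (a := g)).mdifferentiable (by simp)

variable (EG E) in
/-- The derivative of the orbit map `k ↦ k • x` at `g`; at `g = 1` it is the infinitesimal
generator. -/
def orbitDeriv (x : M) (g : G) : EG →L[ℝ] E := derivMap EG E (fun k : G => k • x) g

variable (EG) in
include EG in
theorem injective_derivMap_smul (x : M) (g : G) :
    Function.Injective (derivMap E E (fun y : M => g • y) x) := by
  have h := derivMap_comp_eq_id (E := E) (E' := E) (f := fun y : M => g • y)
    (g := fun y => g⁻¹ • y) (x := x) rfl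
    (mdifferentiable_const_smul EG g⁻¹ _) (mdifferentiable_const_smul EG g x)
    (Eventually.of_forall fun z => inv_smul_smul g z)
  exact Function.LeftInverse.injective (g := derivMap E E (fun y : M => g⁻¹ • y) (g • x))
    fun v => congrArg (fun A : E →L[ℝ] E => A v) h

theorem orbitDeriv_eq_smul_comp (x : M) (g : G) :
    orbitDeriv EG E x g = ((derivMap E E (fun y : M => g • y) x).comp
      (orbitDeriv EG E x (1 : G))).comp (derivMap EG EG (fun k : G => g⁻¹ * k) g) := by
  rw [orbitDeriv, orbitDeriv, ← derivMap_comp (f := fun k : G => k • x) (one_smul G x)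
    (mdifferentiable_const_smul EG g x) (mdifferentiable_orbitMap x 1),
    ← derivMap_comp (g := fun k : G => g • k • x) (f := fun k : G => g⁻¹ * k) (inv_mul_cancel g)
    ((mdifferentiable_const_smul EG g _).comp 1 (mdifferentiable_orbitMap x 1))
    (mdifferentiable_leftMul g⁻¹ g)]
  congr 1
  ext k
  simp [mul_smul]

theorem orbitDeriv_comp_mul_left (x : M) (g : G) :
    (orbitDeriv EG E x g).comp (derivMap EG EG (fun k : G => g * k) 1) =
      (derivMap E E (fun y : M => g • y) x).comp (orbitDeriv EG E x (1 : G)) := by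
  rw [orbitDeriv, orbitDeriv, ← derivMap_comp (f := fun k : G => k • x) (one_smul G x)
    (mdifferentiable_const_smul EG g x) (mdifferentiable_orbitMap x 1),
    ← derivMap_comp (f := fun k : G => g * k) (mul_one g) (mdifferentiable_orbitMap x g)
      (mdifferentiable_leftMul g 1)]
  congr 1
  ext k
  simp [mul_smul]

theorem orbitDeriv_eq_comp_mul_right (x : M) (g : G) :
    orbitDeriv EG E x g = (orbitDeriv EG E (g • x) (1 : G)).comp
      (derivMap EG EG (fun k : G => k * g⁻¹) g) := by
  rw [orbitDeriv, orbitDeriv, ← derivMap_comp (f := fun k : G => k * g⁻¹) (mul_inv_cancel g)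
    (mdifferentiable_orbitMap (g • x) 1) (mdifferentiable_rightMul g⁻¹ g)]
  congr 1
  ext k
  simp [mul_smul]

theorem range_orbitDeriv_le (x : M) (g : G) :
    (orbitDeriv EG E x g).range ≤ (orbitDeriv EG E (g • x) (1 : G)).range := by
  rw [orbitDeriv_eq_comp_mul_right]
  rintro _ ⟨v, rfl⟩
  exact ⟨_, rfl⟩

/-- Orbit maps have constant rank. -/
theorem finrank_range_generator_smul [FiniteDimensional ℝ E] (x : M) (g : G) :
    Module.finrank ℝ (orbitDeriv EG E (g • x) (1 : G)).range =
      Module.finrank ℝ (orbitDeriv EG E x (1 : G)).range := by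
  have key : ∀ (x : M) (g : G), Module.finrank ℝ (orbitDeriv EG E x (1 : G)).range ≤
      Module.finrank ℝ (orbitDeriv EG E (g • x) (1 : G)).range := fun x g => by
    have h1 : (orbitDeriv EG E x (1 : G)).range.map
        (derivMap E E (fun y : M => g • y) x : E →ₗ[ℝ] E) ≤
          (orbitDeriv EG E (g • x) (1 : G)).range := by
      refine le_trans ?_ (range_orbitDeriv_le x g)
      rintro _ ⟨_, ⟨v, rfl⟩, rfl⟩
      exact ⟨_, congrArg (fun A : EG →L[ℝ] E => A v) (orbitDeriv_comp_mul_left x g)⟩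
    rw [(Submodule.equivMapOfInjective (derivMap E E (fun y : M => g • y) x : E →ₗ[ℝ] E)
      (injective_derivMap_smul EG x g) _).finrank_eq]
    exact Submodule.finrank_mono h1
  refine le_antisymm ?_ (key x g)
  have h := key (g • x) g⁻¹
  rwa [inv_smul_smul] at h

/-- If the vectors that the infinitesimal generators at `m` kill are killed at `s` too, the same
holds all along the two orbit maps. -/
theorem ker_orbitDeriv_le {m s : M}
    (h : (orbitDeriv EG E m (1 : G)).ker ≤ (orbitDeriv EG E s (1 : G)).ker) (g : G) :
    (orbitDeriv EG E m g).ker ≤ (orbitDeriv EG E s g).ker := by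
  intro v hv
  rw [LinearMap.mem_ker] at hv ⊢
  have hv' : orbitDeriv EG E m g v = 0 := hv
  change orbitDeriv EG E s g v = 0
  rw [orbitDeriv_eq_smul_comp] at hv' ⊢
  have h1 : derivMap EG EG (fun k : G => g⁻¹ * k) g v ∈ (orbitDeriv EG E m (1 : G)).ker :=
    injective_derivMap_smul EG m g (hv'.trans (map_zero _).symm)
  have h2 : orbitDeriv EG E s (1 : G) (derivMap EG EG (fun k : G => g⁻¹ * k) g v) = 0 := h h1
  simp [h2]

end OrbitMaps

/-! ### A coordinate system of the group at the identity -/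

section LocalSection

variable {EG : Type*} [NormedAddCommGroup EG] [NormedSpace ℝ EG]
  {G : Type*} [TopologicalSpace G] [ChartedSpace EG G] [Group G] [LieGroup 𝓘(ℝ, EG) ∞ G]

variable (EG G) in
/-- The inverse of the preferred chart at the identity, translated so that it sends `0` to `1`. It
plays the role of the exponential map. -/
def groupCoord (ζ : EG) : G := (chartAt EG (1 : G)).symm (chartAt EG (1 : G) 1 + ζ)

variable (EG G) in
/-- The open set of vectors on which `groupCoord` is a diffeomorphism onto its image. -/
def groupCoordDomain : Set EG := {ζ | chartAt EG (1 : G) 1 + ζ ∈ (chartAt EG (1 : G)).target}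

theorem isOpen_groupCoordDomain : IsOpen (groupCoordDomain EG G) :=
  (chartAt EG (1 : G)).open_target.preimage (by fun_prop)

theorem zero_mem_groupCoordDomain : (0 : EG) ∈ groupCoordDomain EG G := by
  simp [groupCoordDomain]

theorem groupCoord_zero : groupCoord EG G 0 = 1 := by simp [groupCoord]

theorem contMDiffOn_groupCoord :
    ContMDiffOn 𝓘(ℝ, EG) 𝓘(ℝ, EG) ∞ (groupCoord EG G) (groupCoordDomain EG G) := by
  have h : ContMDiff 𝓘(ℝ, EG) 𝓘(ℝ, EG) ∞ (fun ζ : EG => chartAt EG (1 : G) 1 + ζ) :=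
    (contDiff_const.add contDiff_id).contMDiff
  exact (contMDiffOn_chart_symm (I := 𝓘(ℝ, EG)) (n := ∞) (x := (1 : G))).comp
    h.contMDiffOn fun ζ hζ => hζ

theorem contMDiffAt_groupCoord {ζ : EG} (hζ : ζ ∈ groupCoordDomain EG G) :
    ContMDiffAt 𝓘(ℝ, EG) 𝓘(ℝ, EG) ∞ (groupCoord EG G) ζ :=
  contMDiffOn_groupCoord.contMDiffAt (isOpen_groupCoordDomain.mem_nhds hζ)

theorem mdifferentiableAt_groupCoord {ζ : EG} (hζ : ζ ∈ groupCoordDomain EG G) :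
    MDifferentiableAt 𝓘(ℝ, EG) 𝓘(ℝ, EG) (groupCoord EG G) ζ :=
  (contMDiffAt_groupCoord hζ).mdifferentiableAt (by simp)

/-- The canonical identification of the tangent space at the identity with the model space is
the derivative of the preferred chart there. -/
theorem derivMap_groupCoord_zero :
    derivMap EG EG (groupCoord EG G) 0 = ContinuousLinearMap.id ℝ EG := by
  have hκ := IsManifold.chart_mem_maximalAtlas (I := 𝓘(ℝ, EG)) (n := ∞) (1 : G)
  have h1 : derivMap EG EG (chartAt EG (1 : G)) 1 = ContinuousLinearMap.id ℝ EG :=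
    mfderiv_extChartAt_self (I := 𝓘(ℝ, EG)) (x := (1 : G))
  have h2 := derivMap_symm_comp_chart hκ (mem_chart_source EG (1 : G))
  rw [h1, ContinuousLinearMap.comp_id] at h2
  have h3 : derivMap EG EG (fun ζ : EG => chartAt EG (1 : G) 1 + ζ) 0 =
      ContinuousLinearMap.id ℝ EG := by
    rw [derivMap_eq_fderiv, fderiv_const_add]
    exact fderiv_id
  change derivMap EG EG (fun ζ => (chartAt EG (1 : G)).symm (chartAt EG (1 : G) 1 + ζ)) 0 = _
  rw [derivMap_comp (f := fun ζ : EG => chartAt EG (1 : G) 1 + ζ)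
    (y := chartAt EG (1 : G) 1) (add_zero _)
    (mdifferentiableAt_chart_symm hκ (mem_chart_target EG (1 : G)))
    (by
      rw [mdifferentiableAt_iff_differentiableAt]
      fun_prop), h2, h3, ContinuousLinearMap.comp_id]

/-- The images of the neighbourhoods of `0` under `groupCoord` are neighbourhoods of `1`. -/
theorem image_groupCoord_mem_nhds {s : Set EG} (hs : s ∈ 𝓝 (0 : EG)) :
    groupCoord EG G '' s ∈ 𝓝 (1 : G) := by
  have hcont : ContinuousAt (fun k : G => chartAt EG (1 : G) k - chartAt EG (1 : G) 1) 1 :=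
    ((chartAt EG (1 : G)).continuousAt (mem_chart_source EG 1)).sub continuousAt_const
  have h0 : ∀ᶠ k in 𝓝 (1 : G), chartAt EG (1 : G) k - chartAt EG (1 : G) 1 ∈ s :=
    hcont (by simpa using hs)
  filter_upwards [h0, chart_source_mem_nhds EG (1 : G)] with k hk hk'
  exact ⟨_, hk, by simp [groupCoord, (chartAt EG (1 : G)).left_inv hk']⟩

end LocalSection

/-! ### Linear projections -/

section LinearAlgebra

variable {E F : Type*} [NormedAddCommGroup E] [NormedSpace ℝ E] [FiniteDimensional ℝ E]
  [NormedAddCommGroup F] [NormedSpace ℝ F]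

theorem exists_projection (T : Submodule ℝ E) :
    ∃ p : E →L[ℝ] E, (∀ e, p (p e) = p e) ∧ p.range = T := by
  obtain ⟨f, hf⟩ := Submodule.exists_isCompl T
  have hT : ∀ e, T.projection f hf e ∈ T := fun e => by simp
  refine ⟨(T.projection f hf).toContinuousLinearMap, fun e => ?_, ?_⟩
  · exact Submodule.projection_apply_of_mem_left hf (hT e)
  · ext e
    constructor
    · rintro ⟨v, rfl⟩
      exact hT v
    · exact fun he => ⟨e, Submodule.projection_apply_of_mem_left hf he⟩

theorem apply_eq_of_mem_range {p : E →L[ℝ] E} (hp : ∀ e, p (p e) = p e) {e : E}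
    (he : e ∈ p.range) : p e = e := by
  obtain ⟨v, rfl⟩ := he
  exact hp v

/-- A projection onto the range of a linear map factors through that map. -/
theorem exists_factor_projection (A : F →L[ℝ] E) {p : E →L[ℝ] E} (hp : ∀ e, p (p e) = p e)
    (hpA : p.range = A.range) :
    ∃ j : E →L[ℝ] F, (∀ e, A (j e) = p e) ∧ ∀ e, j (p e) = j e := by
  obtain ⟨σ, hσ⟩ := (A : F →ₗ[ℝ] E).rangeRestrict.exists_rightInverse_of_surjective
    (LinearMap.range_rangeRestrict _)
  have hmem : ∀ e, (p : E →ₗ[ℝ] E) e ∈ (A : F →ₗ[ℝ] E).range := fun e => by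
    rw [← hpA]
    exact ⟨e, rfl⟩
  refine ⟨(σ.comp ((p : E →ₗ[ℝ] E).codRestrict _ hmem)).toContinuousLinearMap, fun e => ?_,
    fun e => ?_⟩
  · have := congrArg (fun B => ((B ⟨p e, hmem e⟩ : (A : F →ₗ[ℝ] E).range) : E)) hσ
    exact this
  · change σ ⟨p (p e), _⟩ = σ ⟨p e, _⟩
    simp only [hp]

end LinearAlgebra

/-! ### Tube charts along an orbit -/

section TubeChart

variable {EG : Type*} [NormedAddCommGroup EG] [NormedSpace ℝ EG]
  {G : Type*} [TopologicalSpace G] [ChartedSpace EG G] [Group G] [LieGroup 𝓘(ℝ, EG) ∞ G]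
  {E : Type*} [NormedAddCommGroup E] [NormedSpace ℝ E] [FiniteDimensional ℝ E]
  {M : Type*} [TopologicalSpace M] [ChartedSpace E M]
  [MulAction G M] [ContMDiffSMul 𝓘(ℝ, EG) 𝓘(ℝ, E) ∞ G M]

variable (EG G) in
/-- A chart `χ` centred at `m` that straightens the action along the orbit of `m`. Given a chart `ψ`
centred at `m` and a projection `p` onto the tangent space of the orbit, read in `ψ`, points are
represented as `c (j e) • ψ⁻¹ (e - p e)`, where `c` is `groupCoord`: a point of the slice
`ψ⁻¹ (ker p)` moved by a group element near `1`. -/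
structure IsTubeChart (m : M) (ψ : OpenPartialHomeomorph M E) (p : E →L[ℝ] E) (j : E →L[ℝ] EG)
    (χ : OpenPartialHomeomorph M E) : Prop where
  mem_atlas_slice : ψ ∈ IsManifold.maximalAtlas 𝓘(ℝ, E) ∞ M
  mem_slice : m ∈ ψ.source
  slice_apply : ψ m = 0
  proj_proj : ∀ e, p (p e) = p e
  range_proj : p.range = ((derivMap E E ψ m).comp (orbitDeriv EG E m (1 : G))).range
  factor_proj : ∀ e, j (p e) = j e
  mem_atlas : χ ∈ IsManifold.maximalAtlas 𝓘(ℝ, E) ∞ M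
  mem_source : m ∈ χ.source
  apply_eq : χ m = 0
  factor_mem : ∀ e ∈ χ.target, j e ∈ groupCoordDomain EG G
  slice_mem : ∀ e ∈ χ.target, e - p e ∈ ψ.target
  symm_eq : ∀ e ∈ χ.target, χ.symm e = groupCoord EG G (j e) • ψ.symm (e - p e)

/-- A tube chart is a local inverse of `e ↦ c (j e) • ψ⁻¹ (e - p e)`. Read in `ψ`, this map has the
identity as its derivative at `0`, since `j` is chosen as a lift of `p` to the Lie algebra. -/
theorem exists_isTubeChart {m : M} {ψ : OpenPartialHomeomorph M E}
    (hψ : ψ ∈ IsManifold.maximalAtlas 𝓘(ℝ, E) ∞ M) (hm : m ∈ ψ.source) (hψm : ψ m = 0)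
    {p : E →L[ℝ] E} (hp : ∀ e, p (p e) = p e)
    (hpr : p.range = ((derivMap E E ψ m).comp (orbitDeriv EG E m (1 : G))).range) :
    ∃ j χ, IsTubeChart EG G m ψ p j χ := by
  obtain ⟨j, hj, hjp⟩ := exists_factor_projection _ hp hpr
  have h0t : (0 : E) ∈ ψ.target := hψm ▸ ψ.map_source hm
  have hsymm0 : ψ.symm 0 = m := by rw [← hψm, ψ.left_inv hm]
  have hcs : ContinuousSMul G M := ContMDiffSMul.continuousSMul (I := 𝓘(ℝ, EG)) (I' := 𝓘(ℝ, E)) ∞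
  -- the action, with the group read in `groupCoord` and the manifold in the chart `ψ`
  let Θ : EG × E → M := fun z => groupCoord EG G z.1 • ψ.symm z.2
  have hΘ : ContMDiffOn 𝓘(ℝ, EG × E) 𝓘(ℝ, E) ∞ Θ (groupCoordDomain EG G ×ˢ ψ.target) := by
    have h1 : ContMDiffOn 𝓘(ℝ, EG × E) 𝓘(ℝ, EG) ∞ (fun z : EG × E => groupCoord EG G z.1)
        (groupCoordDomain EG G ×ˢ ψ.target) :=
      contMDiffOn_groupCoord.comp contDiff_fst.contMDiff.contMDiffOn fun z hz => hz.1
    have h2 : ContMDiffOn 𝓘(ℝ, EG × E) 𝓘(ℝ, E) ∞ (fun z : EG × E => ψ.symm z.2)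
        (groupCoordDomain EG G ×ˢ ψ.target) :=
      (contMDiffOn_symm_of_mem_maximalAtlas hψ).comp contDiff_snd.contMDiff.contMDiffOn
        fun z hz => hz.2
    exact h1.smul h2
  have hdom : IsOpen (groupCoordDomain EG G ×ˢ ψ.target) :=
    isOpen_groupCoordDomain.prod ψ.open_target
  let Q : Set (EG × E) := (groupCoordDomain EG G ×ˢ ψ.target) ∩ Θ ⁻¹' ψ.source
  have hQ : IsOpen Q := hΘ.continuousOn.isOpen_inter_preimage hdom ψ.open_source
  have hQ0 : (0, 0) ∈ Q := by
    refine ⟨⟨zero_mem_groupCoordDomain, h0t⟩, ?_⟩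
    simp only [Θ, mem_preimage, groupCoord_zero, one_smul, hsymm0]
    exact hm
  have hψΘ : ContDiffOn ℝ ∞ (fun z => ψ (Θ z)) Q :=
    ((contMDiffOn_of_mem_maximalAtlas hψ).comp (hΘ.mono inter_subset_left)
      fun z hz => hz.2).contDiffOn
  let ℓ : E →L[ℝ] EG × E := j.prod (ContinuousLinearMap.id ℝ E - p)
  have hℓ : ∀ e, ℓ e = (j e, e - p e) := fun e => rfl
  have hO : IsOpen (ℓ ⁻¹' Q) := hQ.preimage ℓ.continuous
  have hO0 : (0 : E) ∈ ℓ ⁻¹' Q := by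
    rw [mem_preimage, map_zero]
    exact hQ0
  have hf : ContDiffOn ℝ ∞ (fun e => ψ (Θ (ℓ e))) (ℓ ⁻¹' Q) :=
    hψΘ.comp ℓ.contDiff.contDiffOn fun e he => he
  have hder : HasFDerivAt (fun e => ψ (Θ (ℓ e)))
      ((ContinuousLinearEquiv.refl ℝ E : E ≃L[ℝ] E) : E →L[ℝ] E) 0 := by
    have hd : HasFDerivAt (fun z => ψ (Θ z)) (fderiv ℝ (fun z => ψ (Θ z)) (0, 0)) (ℓ 0) := by
      rw [map_zero]
      exact ((hψΘ.contDiffAt (hQ.mem_nhds hQ0)).differentiableAt (by simp)).hasFDerivAt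
    have hd0 : HasFDerivAt (fun z => ψ (Θ z)) (fderiv ℝ (fun z => ψ (Θ z)) (0, 0)) (0, 0) := by
      rw [map_zero] at hd
      exact hd
    have h1 : ∀ ζ : EG, fderiv ℝ (fun z => ψ (Θ z)) (0, 0) (ζ, 0) =
        derivMap E E ψ m (orbitDeriv EG E m (1 : G) ζ) := by
      have h2 : HasFDerivAt (fun ζ : EG => ψ (Θ (ζ, 0)))
          ((fderiv ℝ (fun z => ψ (Θ z)) (0, 0)).comp (ContinuousLinearMap.inl ℝ EG E)) 0 :=
        HasFDerivAt.comp (g := fun z => ψ (Θ z)) (0 : EG) hd0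
          (hasFDerivAt_prodMk_left (𝕜 := ℝ) (0 : EG) (0 : E))
      have h3 : derivMap EG E (fun ζ : EG => ψ (groupCoord EG G ζ • m)) 0 =
          (derivMap E E ψ m).comp (orbitDeriv EG E m (1 : G)) := by
        rw [derivMap_comp (g := ψ) (f := fun ζ : EG => groupCoord EG G ζ • m) (y := m)
          (by simp [groupCoord_zero]) (mdifferentiableAt_chart hψ hm)
          ((mdifferentiable_orbitMap m _).comp 0
            (mdifferentiableAt_groupCoord zero_mem_groupCoordDomain)),
          derivMap_comp (g := fun k : G => k • m) groupCoord_zero (mdifferentiable_orbitMap m 1)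
            (mdifferentiableAt_groupCoord zero_mem_groupCoordDomain),
          derivMap_groupCoord_zero, ContinuousLinearMap.comp_id]
        rfl
      have h4 : (fun ζ : EG => ψ (groupCoord EG G ζ • m)) = fun ζ : EG => ψ (Θ (ζ, 0)) := by
        simp only [Θ, hsymm0]
      rw [h4, derivMap_eq_fderiv, h2.fderiv] at h3
      intro ζ
      exact congrArg (fun A : EG →L[ℝ] E => A ζ) h3
    have h5 : ∀ v : E, fderiv ℝ (fun z => ψ (Θ z)) (0, 0) (0, v) = v := by
      have h2 : HasFDerivAt (fun v : E => ψ (Θ (0, v)))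
          ((fderiv ℝ (fun z => ψ (Θ z)) (0, 0)).comp (ContinuousLinearMap.inr ℝ EG E)) 0 :=
        HasFDerivAt.comp (g := fun z => ψ (Θ z)) (0 : E) hd0
          (hasFDerivAt_prodMk_right (𝕜 := ℝ) (0 : EG) (0 : E))
      have h3 : (fun v : E => ψ (Θ (0, v))) =ᶠ[𝓝 0] fun v => v := by
        filter_upwards [ψ.open_target.mem_nhds h0t] with v hv
        simp [Θ, groupCoord_zero, ψ.right_inv hv]
      have h4 := (hasFDerivAt_id (𝕜 := ℝ) (0 : E)).congr_of_eventuallyEq h3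
      intro v
      exact congrArg (fun A : E →L[ℝ] E => A v) (h2.unique h4)
    have h6 := HasFDerivAt.comp (g := fun z => ψ (Θ z)) (0 : E) hd ℓ.hasFDerivAt
    refine h6.congr_fderiv ?_
    ext e
    change fderiv ℝ (fun z => ψ (Θ z)) (0, 0) (j e, e - p e) = e
    have h7 : ((j e, e - p e) : EG × E) = (j e, 0) + (0, e - p e) := by simp
    rw [h7, map_add, h1, h5]
    have h8 : derivMap E E ψ m (orbitDeriv EG E m (1 : G) (j e)) = p e := hj e
    rw [h8, add_sub_cancel]
  obtain ⟨ε, hε, hε0, hεO, hεf⟩ := exists_mem_contDiffGroupoid_eq hO hf hO0 hder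
  have hm0 : ψ (Θ (ℓ 0)) = 0 := by
    rw [map_zero]
    simp only [Θ, Prod.fst_zero, Prod.snd_zero, groupCoord_zero, one_smul, hsymm0, hψm]
  have hε00 : ε 0 = 0 := by rw [hεf]; exact hm0
  have htarget : ∀ e ∈ (ψ.trans ε.symm).target, e ∈ ε.source := fun e he => by
    rw [OpenPartialHomeomorph.trans_target] at he
    exact he.1
  refine ⟨j, ψ.trans ε.symm, hψ, hm, hψm, hp, hpr, hjp,
    trans_mem_maximalAtlas hψ (StructureGroupoid.symm _ hε), ?_, ?_, ?_, ?_, ?_⟩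
  · rw [OpenPartialHomeomorph.trans_source]
    refine ⟨hm, ?_⟩
    rw [mem_preimage, hψm, OpenPartialHomeomorph.symm_source, ← hε00]
    exact ε.map_source hε0
  · rw [OpenPartialHomeomorph.trans_apply, hψm]
    conv_lhs => rw [← hε00]
    exact ε.left_inv hε0
  · exact fun e he => (hεO (htarget e he)).1.1
  · exact fun e he => (hεO (htarget e he)).1.2
  · intro e he
    have : (ψ.trans ε.symm).symm e = ψ.symm (ε e) := rfl
    rw [this, hεf]
    exact ψ.left_inv (hεO (htarget e he)).2

end TubeChart

/-! ### Isotropy groups near the identity -/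

section OrbitStructure

variable {EG : Type*} [NormedAddCommGroup EG] [NormedSpace ℝ EG]
  {G : Type*} [TopologicalSpace G] [ChartedSpace EG G] [Group G] [LieGroup 𝓘(ℝ, EG) ∞ G]
  {E : Type*} [NormedAddCommGroup E] [NormedSpace ℝ E] [FiniteDimensional ℝ E]
  {M : Type*} [TopologicalSpace M] [ChartedSpace E M]
  [MulAction G M] [ContMDiffSMul 𝓘(ℝ, EG) 𝓘(ℝ, E) ∞ G M]

theorem exists_centred_chart [IsManifold 𝓘(ℝ, E) ∞ M] (m : M) :
    ∃ ψ ∈ IsManifold.maximalAtlas 𝓘(ℝ, E) ∞ M, m ∈ ψ.source ∧ ψ m = 0 := by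
  obtain ⟨e, he, hes, -, hef⟩ := exists_mem_contDiffGroupoid_eq
    (f := fun v : E => v - chartAt E m m)
    isOpen_univ (by fun_prop) (mem_univ (chartAt E m m)) (f' := ContinuousLinearEquiv.refl ℝ E)
    ((hasFDerivAt_id (𝕜 := ℝ) (chartAt E m m)).sub_const (chartAt E m m))
  refine ⟨(chartAt E m).trans e, trans_mem_maximalAtlas (IsManifold.chart_mem_maximalAtlas m) he,
    ?_, ?_⟩
  · rw [OpenPartialHomeomorph.trans_source]
    exact ⟨mem_chart_source E m, hes⟩
  · rw [OpenPartialHomeomorph.trans_apply, hef]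
    simp

theorem finrank_range_comp_derivMap {χ : OpenPartialHomeomorph M E}
    (hχ : χ ∈ IsManifold.maximalAtlas 𝓘(ℝ, E) ∞ M) {y : M} (hy : y ∈ χ.source)
    (B : EG →L[ℝ] E) :
    Module.finrank ℝ ((derivMap E E χ y).comp B).range = Module.finrank ℝ B.range := by
  have h : ((derivMap E E χ y).comp B).range =
      B.range.map ((derivChart hχ hy).toLinearEquiv : E →ₗ[ℝ] E) := by
    ext v
    simp only [Submodule.mem_map, LinearMap.mem_range]
    constructor
    · rintro ⟨ξ, rfl⟩
      exact ⟨_, ⟨ξ, rfl⟩, rfl⟩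
    · rintro ⟨_, ⟨ξ, rfl⟩, rfl⟩
      exact ⟨ξ, rfl⟩
  rw [h]
  exact LinearEquiv.finrank_map_eq (derivChart hχ hy).toLinearEquiv _

namespace IsTubeChart

variable {m : M} {ψ χ : OpenPartialHomeomorph M E} {p : E →L[ℝ] E} {j : E →L[ℝ] EG}

theorem finrank_range_proj (h : IsTubeChart EG G m ψ p j χ) :
    Module.finrank ℝ p.range = Module.finrank ℝ (orbitDeriv EG E m (1 : G)).range := by
  rw [h.range_proj, finrank_range_comp_derivMap h.mem_atlas_slice h.mem_slice]

/-- The vectors in the range of `p` are the velocities of `c (j e) • s` under changes of `j e`, so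
they are tangent to the orbits. -/
theorem range_proj_le (h : IsTubeChart EG G m ψ p j χ) {y : M} (hy : y ∈ χ.source) :
    p.range ≤ ((derivMap E E χ y).comp (orbitDeriv EG E y (1 : G))).range := by
  have he : χ y ∈ χ.target := χ.map_source hy
  set e := χ y with he_def
  set s := ψ.symm (e - p e) with hs
  have hys : y = groupCoord EG G (j e) • s := by
    rw [hs, ← h.symm_eq e he, he_def, χ.left_inv hy]
  -- both sides describe the displacement of `χ⁻¹ e` along the range of `p`
  have h1 : (fun u : E => χ.symm (e + p u)) =ᶠ[𝓝 0] fun u => groupCoord EG G (j e + j u) • s := by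
    have hcont : ContinuousAt (fun u : E => e + p u) 0 := by fun_prop
    have : ∀ᶠ u in 𝓝 (0 : E), e + p u ∈ χ.target :=
      hcont (by simpa using χ.open_target.mem_nhds he)
    filter_upwards [this] with u hu
    rw [h.symm_eq _ hu, map_add, h.factor_proj, map_add, h.proj_proj, add_sub_add_right_eq_sub]
  have h2 : derivMap E E (fun u : E => χ.symm (e + p u)) 0 = (derivMap E E χ.symm e).comp p := by
    rw [derivMap_comp (g := χ.symm) (f := fun u : E => e + p u) (y := e) (by simp)
      (mdifferentiableAt_chart_symm h.mem_atlas he)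
      (by rw [mdifferentiableAt_iff_differentiableAt]; fun_prop), derivMap_eq_fderiv,
      fderiv_const_add, p.fderiv]
  have hdom := h.factor_mem e he
  have h3 : derivMap E E (fun u : E => groupCoord EG G (j e + j u) • s) 0 =
      ((orbitDeriv EG E s (groupCoord EG G (j e))).comp
        (derivMap EG EG (groupCoord EG G) (j e))).comp j := by
    have hj : MDifferentiableAt 𝓘(ℝ, E) 𝓘(ℝ, EG) (fun u : E => j e + j u) 0 := by
      rw [mdifferentiableAt_iff_differentiableAt]; fun_prop
    have hc : MDifferentiableAt 𝓘(ℝ, EG) 𝓘(ℝ, E) (fun ζ : EG => groupCoord EG G ζ • s) (j e) :=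
      (mdifferentiable_orbitMap s _).comp _ (mdifferentiableAt_groupCoord hdom)
    rw [derivMap_comp (g := fun ζ : EG => groupCoord EG G ζ • s) (f := fun u : E => j e + j u)
      (y := j e) (by simp) hc hj,
      derivMap_comp (g := fun k : G => k • s) (f := groupCoord EG G) rfl
        (mdifferentiable_orbitMap s _) (mdifferentiableAt_groupCoord hdom), derivMap_eq_fderiv
        (f := fun u : E => j e + j u), fderiv_const_add, j.fderiv]
    rfl
  rintro _ ⟨u, rfl⟩
  have h4 : derivMap E E χ.symm e (p u) ∈ (orbitDeriv EG E y (1 : G)).range := by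
    have h5 : derivMap E E χ.symm e (p u) = orbitDeriv EG E s (groupCoord EG G (j e))
        (derivMap EG EG (groupCoord EG G) (j e) (j u)) := by
      have := derivMap_congr (E := E) (E' := E) h1
      rw [h2, h3] at this
      exact congrArg (fun A : E →L[ℝ] E => A u) this
    rw [h5, hys]
    exact range_orbitDeriv_le s _ ⟨_, rfl⟩
  obtain ⟨ξ, hξ⟩ := h4
  refine ⟨ξ, ?_⟩
  change derivMap E E χ y (orbitDeriv EG E y (1 : G) ξ) = p u
  have hξ' : orbitDeriv EG E y (1 : G) ξ = derivMap E E χ.symm e (p u) := hξ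
  rw [hξ']
  exact congrArg (fun A : E →L[ℝ] E => A (p u)) (derivMap_chart_comp_symm h.mem_atlas hy)

/-- Where the orbits have no larger dimension than the orbit of `m`, the tangent spaces of the
orbits are constant in a tube chart. -/
theorem range_proj_eq (h : IsTubeChart EG G m ψ p j χ) {y : M} (hy : y ∈ χ.source)
    (hrank : Module.finrank ℝ (orbitDeriv EG E y (1 : G)).range ≤
      Module.finrank ℝ (orbitDeriv EG E m (1 : G)).range) :
    p.range = ((derivMap E E χ y).comp (orbitDeriv EG E y (1 : G))).range := by
  refine Submodule.eq_of_le_of_finrank_le (h.range_proj_le hy) ?_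
  rwa [finrank_range_comp_derivMap h.mem_atlas hy, h.finrank_range_proj]

/-- The orbit of `m` is, in a tube chart near `m`, contained in the range of `p`: its transversal
coordinate has derivative zero, because orbit maps have constant rank. -/
theorem exists_ball_orbit (h : IsTubeChart EG G m ψ p j χ) :
    ∃ r > 0, ∀ ζ ∈ Metric.ball (0 : EG) r, ζ ∈ groupCoordDomain EG G ∧
      groupCoord EG G ζ • m ∈ χ.source ∧
      p (χ (groupCoord EG G ζ • m)) = χ (groupCoord EG G ζ • m) := by
  have hcs : ContinuousSMul G M := ContMDiffSMul.continuousSMul (I := 𝓘(ℝ, EG)) (I' := 𝓘(ℝ, E)) ∞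
  have h0 : ∀ᶠ ζ in 𝓝 (0 : EG), ζ ∈ groupCoordDomain EG G ∧ groupCoord EG G ζ • m ∈ χ.source := by
    refine Filter.Eventually.and (isOpen_groupCoordDomain.mem_nhds zero_mem_groupCoordDomain) ?_
    have hc : ContinuousAt (fun ζ => groupCoord EG G ζ • m) 0 :=
      (contMDiffAt_groupCoord zero_mem_groupCoordDomain).continuousAt.smul continuousAt_const
    refine hc (χ.open_source.mem_nhds ?_)
    simpa [groupCoord_zero] using h.mem_source
  obtain ⟨r, hr, hball⟩ := Metric.eventually_nhds_iff_ball.1 h0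
  let f : EG → E := fun ζ => χ (groupCoord EG G ζ • m)
  have hmd : ∀ ζ ∈ Metric.ball (0 : EG) r, MDifferentiableAt 𝓘(ℝ, EG) 𝓘(ℝ, E) f ζ := fun ζ hζ =>
    (mdifferentiableAt_chart h.mem_atlas (hball ζ hζ).2).comp ζ
      ((mdifferentiable_orbitMap m _).comp ζ (mdifferentiableAt_groupCoord (hball ζ hζ).1))
  have hd : ∀ ζ ∈ Metric.ball (0 : EG) r, DifferentiableAt ℝ f ζ := fun ζ hζ =>
    (hmd ζ hζ).differentiableAt
  have hder : ∀ ζ ∈ Metric.ball (0 : EG) r, HasFDerivAt (fun ζ => f ζ - p (f ζ))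
      (0 : EG →L[ℝ] E) ζ := by
    intro ζ hζ
    refine ((hd ζ hζ).hasFDerivAt.sub (p.hasFDerivAt.comp ζ (hd ζ hζ).hasFDerivAt)).congr_fderiv ?_
    have h1 : fderiv ℝ f ζ = ((derivMap E E χ (groupCoord EG G ζ • m)).comp
        (orbitDeriv EG E m (groupCoord EG G ζ))).comp (derivMap EG EG (groupCoord EG G) ζ) := by
      rw [← derivMap_eq_fderiv, derivMap_comp (g := χ) (f := fun ζ => groupCoord EG G ζ • m) rfl
        (mdifferentiableAt_chart h.mem_atlas (hball ζ hζ).2)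
        ((mdifferentiable_orbitMap m _).comp ζ (mdifferentiableAt_groupCoord (hball ζ hζ).1)),
        derivMap_comp (g := fun k : G => k • m) rfl (mdifferentiable_orbitMap m _)
          (mdifferentiableAt_groupCoord (hball ζ hζ).1)]
      rfl
    ext v
    have h2 : fderiv ℝ f ζ v ∈ p.range := by
      rw [h.range_proj_eq (hball ζ hζ).2 (finrank_range_generator_smul m _).le, h1]
      obtain ⟨ξ, hξ⟩ := range_orbitDeriv_le (EG := EG) (E := E) m (groupCoord EG G ζ)
        ⟨derivMap EG EG (groupCoord EG G) ζ v, rfl⟩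
      exact ⟨ξ, congrArg (derivMap E E χ (groupCoord EG G ζ • m)) hξ⟩
    obtain ⟨w, hw⟩ := h2
    have hw' : p w = fderiv ℝ f ζ v := hw
    change fderiv ℝ f ζ v - p (fderiv ℝ f ζ v) = 0
    rw [← hw', h.proj_proj, sub_self]
  refine ⟨r, hr, fun ζ hζ => ⟨(hball ζ hζ).1, (hball ζ hζ).2, ?_⟩⟩
  have hconst := Metric.isOpen_ball.is_const_of_fderiv_eq_zero (𝕜 := ℝ)
    (f := fun ζ => f ζ - p (f ζ)) (Metric.isPreconnected_ball (x := (0 : EG)) (r := r))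
    (fun ζ hζ => (hder ζ hζ).differentiableAt.differentiableWithinAt)
    (fun ζ hζ => (hder ζ hζ).fderiv) hζ (Metric.mem_ball_self hr)
  have h00 : f 0 = 0 := by simp [f, groupCoord_zero, h.apply_eq]
  simp only [h00, map_zero, sub_zero] at hconst
  exact (sub_eq_zero.1 hconst).symm

/-- A point of the tube on the orbit of `m` is obtained from `m` by the group element that its
coordinates name. -/
theorem eq_smul (h : IsTubeChart EG G m ψ p j χ) {y : M} (hy : y ∈ χ.source)
    (hpy : p (χ y) = χ y) : y = groupCoord EG G (j (χ y)) • m := by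
  have h1 := h.symm_eq _ (χ.map_source hy)
  rw [χ.left_inv hy, hpy, sub_self, ← h.slice_apply, ψ.left_inv h.mem_slice] at h1
  exact h1

end IsTubeChart

variable [IsManifold 𝓘(ℝ, E) ∞ M]

/-- Near the identity, every group element differs by an element of the isotropy group of `m` from
an element `a ζ` of a fixed transversal of that group. -/
theorem exists_transversal (m : M) :
    ∃ r > 0, ∃ a : EG → G, a 0 = 1 ∧
      (∀ ζ ∈ Metric.ball (0 : EG) r, ζ ∈ groupCoordDomain EG G ∧
        ContMDiffAt 𝓘(ℝ, EG) 𝓘(ℝ, EG) ∞ a ζ ∧ groupCoord EG G ζ • m = a ζ • m ∧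
        (groupCoord EG G ζ • m = m → a ζ = 1)) ∧
      ∀ ξ, orbitDeriv EG E m (1 : G) ξ = 0 → derivMap EG EG a 0 ξ = 0 := by
  obtain ⟨ψ, hψ, hm, hψm⟩ := exists_centred_chart (E := E) m
  obtain ⟨p, hp, hpr⟩ :=
    exists_projection ((derivMap E E ψ m).comp (orbitDeriv EG E m (1 : G))).range
  obtain ⟨j, χ, h⟩ := exists_isTubeChart hψ hm hψm hp hpr
  obtain ⟨r, hr, hball⟩ := h.exists_ball_orbit
  have hcm : ∀ ζ ∈ Metric.ball (0 : EG) r, ContMDiffAt 𝓘(ℝ, EG) 𝓘(ℝ, E) ∞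
      (fun ζ => groupCoord EG G ζ • m) ζ := fun ζ hζ =>
    (contMDiff_orbitMap m).contMDiffAt.comp ζ (contMDiffAt_groupCoord (hball ζ hζ).1)
  have hjc : ∀ ζ ∈ Metric.ball (0 : EG) r, ContMDiffAt 𝓘(ℝ, EG) 𝓘(ℝ, EG) ∞
      (fun ζ => j (χ (groupCoord EG G ζ • m))) ζ := fun ζ hζ =>
    j.contMDiff.contMDiffAt.comp ζ
      ((contMDiffAt_of_mem_maximalAtlas h.mem_atlas (hball ζ hζ).2.1).comp ζ (hcm ζ hζ))
  have hdom : ∀ ζ ∈ Metric.ball (0 : EG) r,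
      j (χ (groupCoord EG G ζ • m)) ∈ groupCoordDomain EG G := fun ζ hζ =>
    h.factor_mem _ (χ.map_source (hball ζ hζ).2.1)
  have h0 := Metric.mem_ball_self (x := (0 : EG)) hr
  refine ⟨r, hr, fun ζ => groupCoord EG G (j (χ (groupCoord EG G ζ • m))), ?_, fun ζ hζ =>
    ⟨(hball ζ hζ).1, ?_, h.eq_smul (hball ζ hζ).2.1 (hball ζ hζ).2.2, fun hζm => ?_⟩,
    fun ξ hξ => ?_⟩
  · simp [groupCoord_zero, h.apply_eq]
  · exact ContMDiffAt.comp (g := groupCoord EG G) ζ (contMDiffAt_groupCoord (hdom ζ hζ)) (hjc ζ hζ)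
  · simp [hζm, groupCoord_zero, h.apply_eq]
  · have hmd := (hcm 0 h0).mdifferentiableAt (by simp)
    have hχm := mdifferentiableAt_chart h.mem_atlas h.mem_source
    have hjχ : MDifferentiableAt 𝓘(ℝ, E) 𝓘(ℝ, EG) (fun y => j (χ y)) m :=
      j.contMDiff.contMDiffAt.mdifferentiableAt (by simp : (∞ : ℕ∞ω) ≠ 0) |>.comp m hχm
    have h0d : (j (χ m)) ∈ groupCoordDomain EG G := by
      rw [h.apply_eq, map_zero]
      exact zero_mem_groupCoordDomain
    rw [derivMap_comp (g := fun y => groupCoord EG G (j (χ y)))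
      (f := fun ζ : EG => groupCoord EG G ζ • m) (y := m) (by simp [groupCoord_zero])
      (MDifferentiableAt.comp (g := groupCoord EG G) m (mdifferentiableAt_groupCoord h0d) hjχ) hmd,
      derivMap_comp (g := fun k : G => k • m) groupCoord_zero (mdifferentiable_orbitMap m 1)
        (mdifferentiableAt_groupCoord zero_mem_groupCoordDomain), derivMap_groupCoord_zero,
      ContinuousLinearMap.comp_id]
    change derivMap E EG (fun y => groupCoord EG G (j (χ y))) m (orbitDeriv EG E m (1 : G) ξ) = 0
    rw [hξ, map_zero]

/-- The kernel of the infinitesimal generators at `m` is the Lie algebra of the isotropy group of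
`m`, so it grows with that group. -/
theorem ker_orbitDeriv_one_le_of_stabilizer_le {m s : M}
    (hle : MulAction.stabilizer G m ≤ MulAction.stabilizer G s) :
    (orbitDeriv EG E m (1 : G)).ker ≤ (orbitDeriv EG E s (1 : G)).ker := by
  obtain ⟨r, hr, a, ha0, ha, hda⟩ := exists_transversal (EG := EG) (G := G) (E := E) m
  have h0 := Metric.mem_ball_self (x := (0 : EG)) hr
  intro ξ hξ
  have heq : (fun ζ => groupCoord EG G ζ • s) =ᶠ[𝓝 0] fun ζ => a ζ • s := by
    filter_upwards [Metric.ball_mem_nhds (0 : EG) hr] with ζ hζ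
    have h1 : (a ζ)⁻¹ * groupCoord EG G ζ ∈ MulAction.stabilizer G m := by
      rw [MulAction.mem_stabilizer_iff, mul_smul, (ha ζ hζ).2.2.1, inv_smul_smul]
    have h2 := hle h1
    rw [MulAction.mem_stabilizer_iff, mul_smul, inv_smul_eq_iff] at h2
    exact h2
  have h3 := derivMap_congr (E := EG) (E' := E) heq
  rw [derivMap_comp (g := fun k : G => k • s) groupCoord_zero (mdifferentiable_orbitMap s 1)
      (mdifferentiableAt_groupCoord zero_mem_groupCoordDomain), derivMap_groupCoord_zero,
      ContinuousLinearMap.comp_id, derivMap_comp (g := fun k : G => k • s) ha0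
      (mdifferentiable_orbitMap s 1) ((ha 0 h0).2.1.mdifferentiableAt (by simp))] at h3
  have h4 : orbitDeriv EG E s (1 : G) ξ = orbitDeriv EG E s (1 : G) (derivMap EG EG a 0 ξ) :=
    congrArg (fun A : EG →L[ℝ] E => A ξ) h3
  rw [hda ξ hξ, map_zero] at h4
  exact h4

/-- If the Lie algebra of the isotropy group of `m` acts trivially at `s`, then the elements of that
group near the identity fix `s`. -/
theorem exists_nhds_stabilizer_le {m s : M}
    (hker : (orbitDeriv EG E m (1 : G)).ker ≤ (orbitDeriv EG E s (1 : G)).ker) :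
    ∃ N ∈ 𝓝 (1 : G), ∀ k ∈ N, k ∈ MulAction.stabilizer G m → k ∈ MulAction.stabilizer G s := by
  have hcs : ContinuousSMul G M := ContMDiffSMul.continuousSMul (I := 𝓘(ℝ, EG)) (I' := 𝓘(ℝ, E)) ∞
  obtain ⟨r, hr, a, ha0, ha, -⟩ := exists_transversal (EG := EG) (G := G) (E := E) m
  -- the retraction onto the isotropy group of `m`
  let ρ : EG → G := fun ζ => (a ζ)⁻¹ * groupCoord EG G ζ
  have hρ0 : ρ 0 = 1 := by simp [ρ, ha0, groupCoord_zero]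
  have hρ : ∀ ζ ∈ Metric.ball (0 : EG) r, ContMDiffAt 𝓘(ℝ, EG) 𝓘(ℝ, EG) ∞ ρ ζ := fun ζ hζ =>
    (ha ζ hζ).2.1.inv.mul (contMDiffAt_groupCoord (ha ζ hζ).1)
  have hρm : ∀ ζ ∈ Metric.ball (0 : EG) r, ρ ζ • m = m := fun ζ hζ => by
    simp only [ρ]
    rw [mul_smul, (ha ζ hζ).2.2.1, inv_smul_smul]
  have hchart : ∀ᶠ ζ in 𝓝 (0 : EG), ρ ζ • s ∈ (chartAt E s).source := by
    have hc : ContinuousAt (fun ζ => ρ ζ • s) 0 :=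
      (hρ 0 (Metric.mem_ball_self hr)).continuousAt.smul continuousAt_const
    refine hc ((chartAt E s).open_source.mem_nhds ?_)
    simp [hρ0]
  obtain ⟨r', hr', hball⟩ := Metric.eventually_nhds_iff_ball.1
    (hchart.and (Metric.ball_mem_nhds (0 : EG) hr))
  have hχ := IsManifold.chart_mem_maximalAtlas (I := 𝓘(ℝ, E)) (n := ∞) s
  have hder : ∀ ζ ∈ Metric.ball (0 : EG) r', HasFDerivAt (fun ζ => chartAt E s (ρ ζ • s))
      (0 : EG →L[ℝ] E) ζ := by
    intro ζ hζ
    obtain ⟨hζs, hζr⟩ := hball ζ hζ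
    have hρd := (hρ ζ hζr).mdifferentiableAt (by simp)
    have hs : MDifferentiableAt 𝓘(ℝ, EG) 𝓘(ℝ, E) (fun ζ => ρ ζ • s) ζ :=
      (mdifferentiable_orbitMap s _).comp ζ hρd
    have hd : DifferentiableAt ℝ (fun ζ => chartAt E s (ρ ζ • s)) ζ :=
      ((mdifferentiableAt_chart hχ hζs).comp ζ hs).differentiableAt
    refine hd.hasFDerivAt.congr_fderiv ?_
    rw [← derivMap_eq_fderiv, derivMap_comp (f := fun ζ => ρ ζ • s) rfl
      (mdifferentiableAt_chart hχ hζs) hs,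
      derivMap_comp (g := fun k : G => k • s) rfl (mdifferentiable_orbitMap s _) hρd]
    have hm0 : (orbitDeriv EG E m (ρ ζ)).comp (derivMap EG EG ρ ζ) = 0 := by
      rw [orbitDeriv, ← derivMap_comp (g := fun k : G => k • m) rfl
        (mdifferentiable_orbitMap m _) hρd,
        derivMap_congr (g := fun _ => m), derivMap_const]
      filter_upwards [Metric.isOpen_ball.mem_nhds hζr] with ζ' hζ' using hρm ζ' hζ'
    ext v
    have h1 : derivMap EG EG ρ ζ v ∈ (orbitDeriv EG E m (ρ ζ)).ker :=
      congrArg (fun A : EG →L[ℝ] E => A v) hm0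
    have h2 : orbitDeriv EG E s (ρ ζ) (derivMap EG EG ρ ζ v) = 0 := ker_orbitDeriv_le hker _ h1
    change derivMap E E (chartAt E s) (ρ ζ • s) (orbitDeriv EG E s (ρ ζ) (derivMap EG EG ρ ζ v)) = 0
    rw [h2, map_zero]
  refine ⟨_, image_groupCoord_mem_nhds (Metric.ball_mem_nhds (0 : EG) hr'), ?_⟩
  rintro _ ⟨ζ, hζ, rfl⟩ hζm
  have hconst := Metric.isOpen_ball.is_const_of_fderiv_eq_zero (𝕜 := ℝ)
    (f := fun ζ => chartAt E s (ρ ζ • s)) (Metric.isPreconnected_ball (x := (0 : EG)) (r := r'))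
    (fun ζ hζ => (hder ζ hζ).differentiableAt.differentiableWithinAt)
    (fun ζ hζ => (hder ζ hζ).fderiv) hζ (Metric.mem_ball_self hr')
  have h1 := (chartAt E s).injOn (hball ζ hζ).1 (hball 0 (Metric.mem_ball_self hr')).1 hconst
  have h2 : ρ ζ = groupCoord EG G ζ := by
    simp only [ρ]
    rw [(ha ζ (hball ζ hζ).2).2.2.2 hζm, inv_one, one_mul]
  rw [MulAction.mem_stabilizer_iff, ← h2, h1, hρ0, one_smul]

variable (EG E) in
include EG E in
/-- Isotropy groups are locally connected at the identity. -/
theorem exists_isPreconnected_stabilizer (m : M) :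
    ∃ P : Set (MulAction.stabilizer G m), IsPreconnected P ∧ P ∈ 𝓝 1 := by
  obtain ⟨r, hr, a, ha0, ha, -⟩ := exists_transversal (EG := EG) (G := G) (E := E) m
  have hρ : ∀ ζ ∈ Metric.ball (0 : EG) r,
      (a ζ)⁻¹ * groupCoord EG G ζ ∈ MulAction.stabilizer G m := fun ζ hζ => by
    rw [MulAction.mem_stabilizer_iff, mul_smul, (ha ζ hζ).2.2.1, inv_smul_smul]
  let R : Set G := (fun ζ => (a ζ)⁻¹ * groupCoord EG G ζ) '' Metric.ball (0 : EG) r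
  have hR : IsPreconnected R := by
    refine Metric.isPreconnected_ball.image _ fun ζ hζ => ?_
    have h1 : ContMDiffAt 𝓘(ℝ, EG) 𝓘(ℝ, EG) ∞ (fun ζ => (a ζ)⁻¹ * groupCoord EG G ζ) ζ :=
      (ha ζ hζ).2.1.inv.mul (contMDiffAt_groupCoord (ha ζ hζ).1)
    exact h1.continuousAt.continuousWithinAt
  let i : MulAction.stabilizer G m → G := Subtype.val
  have hi : i '' (i ⁻¹' R) = R := image_preimage_eq_of_subset <| by
    rintro _ ⟨ζ, hζ, rfl⟩
    exact ⟨⟨_, hρ ζ hζ⟩, rfl⟩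
  refine ⟨i ⁻¹' R, ?_, ?_⟩
  · refine (Topology.IsInducing.isPreconnected_image (f := i) Topology.IsInducing.subtypeVal).1 ?_
    rw [hi]
    exact hR
  · have h1 : Subtype.val ⁻¹' (groupCoord EG G '' Metric.ball (0 : EG) r) ∈
        𝓝 (1 : MulAction.stabilizer G m) :=
      continuous_subtype_val.continuousAt (image_groupCoord_mem_nhds (Metric.ball_mem_nhds _ hr))
    filter_upwards [h1]
    rintro ⟨k, hk⟩ ⟨ζ, hζ, rfl⟩
    refine ⟨ζ, hζ, ?_⟩
    change (a ζ)⁻¹ * groupCoord EG G ζ = groupCoord EG G ζ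
    rw [(ha ζ hζ).2.2.2 hk, inv_one, one_mul]

end OrbitStructure

/-! ### Compact groups conjugate to a subgroup of themselves -/

section Components

/-- A compact space with open connected components is not homeomorphic to a proper clopen subset of
itself, as such a subset has fewer components. -/
theorem eq_univ_of_homeomorph_isClopen {X : Type*} [TopologicalSpace X] [CompactSpace X]
    (hX : ∀ x : X, connectedComponent x ∈ 𝓝 x) {K : Set X} (hK : IsClopen K) (e : X ≃ₜ K) :
    K = univ := by
  have hopen : ∀ x : X, IsOpen (connectedComponent x) := fun x =>
    isOpen_iff_mem_nhds.2 fun y hy => by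
      rw [connectedComponent_eq hy]
      exact hX y
  have hdisc : DiscreteTopology (ConnectedComponents X) := by
    rw [discreteTopology_iff_isOpen_singleton]
    intro c
    obtain ⟨x, rfl⟩ := ConnectedComponents.surjective_coe c
    rw [← ConnectedComponents.isQuotientMap_coe.isOpen_preimage,
      connectedComponents_preimage_singleton]
    exact hopen x
  have hfin : Finite (ConnectedComponents X) := finite_of_compact_of_discrete
  let f : ConnectedComponents K → ConnectedComponents X :=
    Continuous.connectedComponentsMap continuous_subtype_val
  have hf : Function.Injective f := by
    intro a b hab
    obtain ⟨x, rfl⟩ := ConnectedComponents.surjective_coe a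
    obtain ⟨y, rfl⟩ := ConnectedComponents.surjective_coe b
    have hxy : (x : X) ∈ connectedComponent (y : X) := ConnectedComponents.coe_eq_coe'.1 hab
    have hsub : connectedComponent (y : X) ⊆ K :=
      isPreconnected_connectedComponent.subset_isClopen hK ⟨y, mem_connectedComponent, y.2⟩
    refine ConnectedComponents.coe_eq_coe'.2 ?_
    have hpre : IsPreconnected ((↑) ⁻¹' connectedComponent (y : X) : Set K) := by
      rw [← Topology.IsInducing.subtypeVal.isPreconnected_image, image_preimage_eq_of_subset]
      · exact isPreconnected_connectedComponent
      · rw [Subtype.range_coe]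
        exact hsub
    exact hpre.subset_connectedComponent (x := y) mem_connectedComponent hxy
  let e' : ConnectedComponents X → ConnectedComponents K := e.continuous.connectedComponentsMap
  have he' : Function.Injective e' := by
    have h : Function.LeftInverse (e.symm.continuous.connectedComponentsMap) e' := by
      intro a
      obtain ⟨x, rfl⟩ := ConnectedComponents.surjective_coe a
      exact congrArg ((↑) : X → ConnectedComponents X) (e.symm_apply_apply x)
    exact h.injective
  have hsurj : Function.Surjective (f ∘ e') := Finite.surjective_of_injective (hf.comp he')
  refine eq_univ_of_forall fun x => ?_
  obtain ⟨a, ha⟩ := hsurj x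
  obtain ⟨y, hy⟩ := ConnectedComponents.surjective_coe (e' a)
  have hxy : (y : X) ∈ connectedComponent x := by
    refine ConnectedComponents.coe_eq_coe'.1 ?_
    rw [← ha, Function.comp_apply, ← hy]
    rfl
  exact isPreconnected_connectedComponent.subset_isClopen hK ⟨y, hxy, y.2⟩ mem_connectedComponent

theorem connectedComponent_mem_nhds_of_one {H : Type*} [TopologicalSpace H] [Group H]
    [IsTopologicalGroup H] {P : Set H} (hP : IsPreconnected P) (hP1 : P ∈ 𝓝 1) (h : H) :
    connectedComponent h ∈ 𝓝 h := by
  have h1 : (fun x => h * x) '' P ⊆ connectedComponent h :=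
    (hP.image _ (by fun_prop)).subset_connectedComponent ⟨1, mem_of_mem_nhds hP1, mul_one h⟩
  refine mem_of_superset ?_ h1
  have := (Homeomorph.mulLeft h).isOpenMap.image_mem_nhds hP1
  simpa using! this

end Components

section Conjugation

variable {EG : Type*} [NormedAddCommGroup EG] [NormedSpace ℝ EG] [FiniteDimensional ℝ EG]
  {G : Type*} [TopologicalSpace G] [ChartedSpace EG G] [Group G] [LieGroup 𝓘(ℝ, EG) ∞ G]
  {E : Type*} [NormedAddCommGroup E] [NormedSpace ℝ E] [FiniteDimensional ℝ E]
  {M : Type*} [TopologicalSpace M] [T2Space M]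
  [ChartedSpace E M] [IsManifold 𝓘(ℝ, E) ∞ M]
  [MulAction G M] [ContMDiffSMul 𝓘(ℝ, EG) 𝓘(ℝ, E) ∞ G M] [ProperSMul G M]

theorem isCompact_stabilizer {G M : Type*} [TopologicalSpace G] [Group G] [TopologicalSpace M]
    [T2Space M] [MulAction G M] [ProperSMul G M] (m : M) :
    IsCompact (MulAction.stabilizer G m : Set G) := by
  have h := (ProperSMul.isProperMap_smul_pair (G := G) (X := M)).isCompact_preimage
    (isCompact_singleton (x := (m, m)))
  have h2 := h.image continuous_fst
  convert h2 using 1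
  ext g
  simp

theorem finrank_ker_orbitDeriv_of_stabilizer_eq {s m : M} {g : G}
    (h : MulAction.stabilizer G s = MulAction.stabilizer G (g • m)) :
    Module.finrank ℝ (orbitDeriv EG E s (1 : G)).ker =
      Module.finrank ℝ (orbitDeriv EG E m (1 : G)).ker := by
  have h1 : (orbitDeriv EG E s (1 : G)).ker = (orbitDeriv EG E (g • m) (1 : G)).ker :=
    le_antisymm (ker_orbitDeriv_one_le_of_stabilizer_le h.le)
      (ker_orbitDeriv_one_le_of_stabilizer_le h.ge)
  have h2 := LinearMap.finrank_range_add_finrank_ker (orbitDeriv EG E (g • m) (1 : G) : EG →ₗ[ℝ] E)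
  have h3 := LinearMap.finrank_range_add_finrank_ker (orbitDeriv EG E m (1 : G) : EG →ₗ[ℝ] E)
  have h4 := finrank_range_generator_smul (EG := EG) (E := E) m g
  rw [h1]
  omega

variable (EG E) in
include EG E in
/-- A compact Lie group does not contain a proper closed subgroup conjugate to itself (in a larger
group): the subgroup would have the same Lie algebra, so be open, and have as many components. -/
theorem stabilizer_eq_of_le {s m : M}
    (hle : MulAction.stabilizer G s ≤ MulAction.stabilizer G m)
    (hconj : subgroupClass G (MulAction.stabilizer G s) =
      subgroupClass G (MulAction.stabilizer G m)) :
    MulAction.stabilizer G s = MulAction.stabilizer G m := by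
  have : IsTopologicalGroup G := topologicalGroup_of_lieGroup 𝓘(ℝ, EG) ∞
  obtain ⟨g, hg⟩ : ∃ g : G, (MulAction.stabilizer G m).map (MulAut.conj g).toMonoidHom =
    MulAction.stabilizer G s := Quotient.exact hconj.symm
  have hgm : MulAction.stabilizer G s = MulAction.stabilizer G (g • m) := by
    rw [← hg]
    exact (MulAction.stabilizer_smul_eq_stabilizer_map_conj g m).symm
  have hker : (orbitDeriv EG E m (1 : G)).ker = (orbitDeriv EG E s (1 : G)).ker :=
    (Submodule.eq_of_le_of_finrank_eq (ker_orbitDeriv_one_le_of_stabilizer_le hle)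
      (finrank_ker_orbitDeriv_of_stabilizer_eq hgm)).symm
  obtain ⟨N, hN, hNs⟩ := exists_nhds_stabilizer_le (EG := EG) (E := E) hker.le
  let K : Subgroup (MulAction.stabilizer G m) :=
    (MulAction.stabilizer G s).subgroupOf (MulAction.stabilizer G m)
  have hKo : IsOpen (K : Set (MulAction.stabilizer G m)) := by
    refine Subgroup.isOpen_of_mem_nhds K (g := 1) ?_
    have : Subtype.val ⁻¹' N ∈ 𝓝 (1 : MulAction.stabilizer G m) :=
      continuous_subtype_val.continuousAt hN
    filter_upwards [this] with k hk
    exact hNs _ hk k.2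
  have hKc : IsClosed (K : Set (MulAction.stabilizer G m)) := Subgroup.isClosed_of_isOpen K hKo
  have hmem : ∀ k : G, k ∈ MulAction.stabilizer G s ↔ g⁻¹ * k * g ∈ MulAction.stabilizer G m := by
    intro k
    rw [hgm, MulAction.mem_stabilizer_iff, MulAction.mem_stabilizer_iff, mul_smul, mul_smul,
      inv_smul_eq_iff]
  let e : MulAction.stabilizer G m ≃ₜ (K : Set (MulAction.stabilizer G m)) :=
    { toFun := fun h => ⟨⟨g * h * g⁻¹, hle <| (hmem _).2 <| by simp [mul_assoc]⟩,
        (hmem _).2 <| by simp [mul_assoc]⟩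
      invFun := fun k => ⟨g⁻¹ * (k : MulAction.stabilizer G m) * g, (hmem _).1 k.2⟩
      left_inv := fun h => Subtype.ext (by simp [mul_assoc])
      right_inv := fun k => Subtype.ext (Subtype.ext (by simp [mul_assoc]))
      continuous_toFun := by fun_prop
      continuous_invFun := by fun_prop }
  have : CompactSpace (MulAction.stabilizer G m) :=
    isCompact_iff_compactSpace.1 (isCompact_stabilizer m)
  obtain ⟨P, hP, hP1⟩ := exists_isPreconnected_stabilizer EG E (G := G) m
  have huniv := eq_univ_of_homeomorph_isClopen (connectedComponent_mem_nhds_of_one hP hP1)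
    ⟨hKc, hKo⟩ e
  refine le_antisymm hle fun k hk => ?_
  have : (⟨k, hk⟩ : MulAction.stabilizer G m) ∈ (K : Set (MulAction.stabilizer G m)) := by
    rw [huniv]
    trivial
  exact this

end Conjugation

/-! ### Averaging over isotropy groups -/

section HaarAverage

open MeasureTheory

variable {H : Type*} [TopologicalSpace H] [Group H] [IsTopologicalGroup H] [CompactSpace H]

/-- A compact group carries a left invariant probability measure on its Borel sets. -/
theorem exists_invariant_probability [MeasurableSpace H] [BorelSpace H] :
    ∃ μ : Measure H, IsProbabilityMeasure μ ∧ μ.IsMulLeftInvariant :=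
  ⟨Measure.haarMeasure ⊤, ⟨Measure.haarMeasure_self⟩, inferInstance⟩

/-- A subspace that is invariant under a representation of a compact group is the range of an
equivariant projection, the average of the conjugates of an arbitrary projection. -/
theorem exists_equivariant_projection {E : Type*} [NormedAddCommGroup E] [NormedSpace ℝ E]
    [FiniteDimensional ℝ E] {D : H → E →L[ℝ] E} (hD : Continuous D)
    (hmul : ∀ h k e, D (h * k) e = D h (D k e)) (hone : ∀ e, D 1 e = e)
    {T : Submodule ℝ E} (hT : ∀ h, ∀ e ∈ T, D h e ∈ T) :
    ∃ p : E →L[ℝ] E, (∀ e, p (p e) = p e) ∧ p.range = T ∧ ∀ h e, p (D h e) = D h (p e) := by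
  let _ : MeasurableSpace H := borel H
  have : BorelSpace H := ⟨rfl⟩
  obtain ⟨μ, hμ, hμi⟩ := exists_invariant_probability (H := H)
  obtain ⟨p₀, hp₀, hp₀T⟩ := exists_projection T
  have hfix : ∀ e ∈ T, p₀ e = e := fun e he => apply_eq_of_mem_range hp₀ (hp₀T.symm ▸ he)
  have hcont : Continuous fun h => (D h).comp (p₀.comp (D h⁻¹)) := by fun_prop
  have hint : Integrable (fun h => (D h).comp (p₀.comp (D h⁻¹))) μ :=
    hcont.integrable_of_hasCompactSupport (HasCompactSupport.of_compactSpace _)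
  let p : E →L[ℝ] E := ∫ h, (D h).comp (p₀.comp (D h⁻¹)) ∂μ
  have hpapply : ∀ e, p e = ∫ h, D h (p₀ (D h⁻¹ e)) ∂μ := fun e =>
    ContinuousLinearMap.integral_apply hint e
  have hinte : ∀ e, Integrable (fun h => D h (p₀ (D h⁻¹ e))) μ := fun e =>
    Continuous.integrable_of_hasCompactSupport (by fun_prop) (HasCompactSupport.of_compactSpace _)
  have hpT : ∀ e, p e ∈ T := by
    intro e
    have h1 : p₀ (p e) = p e := by
      rw [hpapply, ← ContinuousLinearMap.integral_comp_comm p₀ (hinte e)]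
      refine integral_congr_ae (Eventually.of_forall fun h => ?_)
      exact hfix _ (hT h _ (hp₀T ▸ ⟨_, rfl⟩))
    rw [← h1, ← hp₀T]
    exact ⟨_, rfl⟩
  have hpfix : ∀ e ∈ T, p e = e := by
    intro e he
    have h1 : ∀ h, D h (p₀ (D h⁻¹ e)) = e := fun h => by
      rw [hfix _ (hT _ _ he), ← hmul, mul_inv_cancel, hone]
    rw [hpapply]
    simp [h1]
  refine ⟨p, fun e => hpfix _ (hpT e), ?_, fun k e => ?_⟩
  · ext e
    constructor
    · rintro ⟨v, rfl⟩
      exact hpT v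
    · exact fun he => ⟨e, hpfix e he⟩
  · rw [hpapply, hpapply, ← ContinuousLinearMap.integral_comp_comm (D k) (hinte e),
      ← integral_mul_left_eq_self (fun h => D h (p₀ (D h⁻¹ (D k e)))) k]
    refine integral_congr_ae (Eventually.of_forall fun h => ?_)
    simp only
    rw [hmul, ← hmul (k * h)⁻¹, mul_inv_rev, inv_mul_cancel_right]

end HaarAverage

/-- The parameters for which a continuous family of points over a compact space runs in an open set
form an open set. -/
theorem isOpen_forall_mem {H X Y : Type*} [TopologicalSpace H] [CompactSpace H]
    [TopologicalSpace X] [TopologicalSpace Y] {f : H → X → Y} {s : Set X} (hs : IsOpen s)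
    (hf : ContinuousOn (fun z : H × X => f z.1 z.2) (univ ×ˢ s)) {V : Set Y} (hV : IsOpen V) :
    IsOpen {x | x ∈ s ∧ ∀ h, f h x ∈ V} := by
  rw [isOpen_iff_mem_nhds]
  rintro x ⟨hxs, hx⟩
  have h1 : ∀ᶠ y in 𝓝 x, ∀ h ∈ (univ : Set H), f h y ∈ V := by
    refine isCompact_univ.eventually_forall_of_forall_eventually fun h _ => ?_
    have h2 : (univ : Set H) ×ˢ s ∈ 𝓝 (h, x) := (isOpen_univ.prod hs).mem_nhds ⟨trivial, hxs⟩
    have h3 := (hf.continuousAt h2) (hV.mem_nhds (hx h))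
    have h4 : Tendsto (fun z : X × H => (z.2, z.1)) (𝓝 (x, h)) (𝓝 (h, x)) :=
      (continuous_snd.prodMk continuous_fst).tendsto _
    exact h4 h3
  filter_upwards [h1, hs.mem_nhds hxs] with y hy hys using ⟨hys, fun h => hy h trivial⟩

section EquivariantChart

open MeasureTheory

variable {EG : Type*} [NormedAddCommGroup EG] [NormedSpace ℝ EG]
  {G : Type*} [TopologicalSpace G] [ChartedSpace EG G] [Group G] [LieGroup 𝓘(ℝ, EG) ∞ G]
  {E : Type*} [NormedAddCommGroup E] [NormedSpace ℝ E] [FiniteDimensional ℝ E]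
  {M : Type*} [TopologicalSpace M] [T2Space M] [ChartedSpace E M] [IsManifold 𝓘(ℝ, E) ∞ M]
  [MulAction G M] [ContMDiffSMul 𝓘(ℝ, EG) 𝓘(ℝ, E) ∞ G M] [ProperSMul G M]

variable (EG) in
include EG in
/-- Near `m` the isotropy group of `m` acts linearly in a suitable chart (Bochner's linearization
theorem), obtained by averaging `D h (φ (h⁻¹ • x))`, where `φ` is any chart centred at `m` and `D`
the isotropy representation read in `φ`. -/
theorem exists_equivariant_chart (m : M) :
    ∃ ψ ∈ IsManifold.maximalAtlas 𝓘(ℝ, E) ∞ M, m ∈ ψ.source ∧ ψ m = 0 ∧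
      ∃ D : MulAction.stabilizer G m → E →L[ℝ] E, Continuous D ∧
        (∀ h k e, D (h * k) e = D h (D k e)) ∧ (∀ e, D 1 e = e) ∧
        ∀ h, ∀ x ∈ ψ.source, h • x ∈ ψ.source ∧ ψ (h • x) = D h (ψ x) := by
  have : IsTopologicalGroup G := topologicalGroup_of_lieGroup 𝓘(ℝ, EG) ∞
  have hcs : ContinuousSMul G M := ContMDiffSMul.continuousSMul (I := 𝓘(ℝ, EG)) (I' := 𝓘(ℝ, E)) ∞
  have : CompactSpace (MulAction.stabilizer G m) :=
    isCompact_iff_compactSpace.1 (isCompact_stabilizer m)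
  let _ : MeasurableSpace (MulAction.stabilizer G m) := borel _
  have : BorelSpace (MulAction.stabilizer G m) := ⟨rfl⟩
  obtain ⟨μ, hμ, hμi⟩ := exists_invariant_probability (H := MulAction.stabilizer G m)
  obtain ⟨φ, hφ, hm, hφm⟩ := exists_centred_chart (E := E) m
  have h0t : (0 : E) ∈ φ.target := hφm ▸ φ.map_source hm
  have hsymm0 : φ.symm 0 = m := by rw [← hφm, φ.left_inv hm]
  -- the action read in the chart `φ`
  let b : G → E → E := fun g e => φ (g • φ.symm e)
  have hact : ContMDiffOn (𝓘(ℝ, EG).prod 𝓘(ℝ, E)) 𝓘(ℝ, E) ∞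
      (fun z : G × E => z.1 • φ.symm z.2) (univ ×ˢ φ.target) :=
    contMDiffOn_fst.smul ((contMDiffOn_symm_of_mem_maximalAtlas hφ).comp contMDiffOn_snd
      fun z hz => hz.2)
  let Q : Set (G × E) := (univ ×ˢ φ.target) ∩ (fun z : G × E => z.1 • φ.symm z.2) ⁻¹' φ.source
  have hQ : IsOpen Q :=
    hact.continuousOn.isOpen_inter_preimage (isOpen_univ.prod φ.open_target) φ.open_source
  have hb : ContMDiffOn (𝓘(ℝ, EG).prod 𝓘(ℝ, E)) 𝓘(ℝ, E) ∞ (Function.uncurry b) Q :=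
    (contMDiffOn_of_mem_maximalAtlas hφ).comp (hact.mono inter_subset_left) fun z hz => hz.2
  have hHQ : ∀ h : MulAction.stabilizer G m, ((h : G), (0 : E)) ∈ Q := fun h => by
    refine ⟨⟨trivial, h0t⟩, ?_⟩
    rw [mem_preimage]
    simp only
    rw [hsymm0, show (h : G) • m = m from h.2]
    exact hm
  have hb0 : ∀ h : MulAction.stabilizer G m, b h 0 = 0 := fun h => by
    simp only [b]
    rw [hsymm0, show (h : G) • m = m from h.2, hφm]
  have hbd : ∀ h : MulAction.stabilizer G m, DifferentiableAt ℝ (b h) 0 := fun h => by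
    have h1 : ContMDiffAt (𝓘(ℝ, EG).prod 𝓘(ℝ, E)) 𝓘(ℝ, E) ∞ (Function.uncurry b) (↑h, 0) :=
      hb.contMDiffAt (hQ.mem_nhds (hHQ h))
    have h2 : ContMDiffAt 𝓘(ℝ, E) 𝓘(ℝ, E) ∞ (b h) 0 :=
      ContMDiffAt.comp (g := Function.uncurry b) (f := fun y => ((h : G), y)) (0 : E) h1
        (contMDiffAt_const.prodMk contMDiffAt_id)
    exact h2.contDiffAt.differentiableAt (by simp)
  -- the isotropy representation
  let A : G → E →L[ℝ] E := fun g => fderiv ℝ (b g) 0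
  let Q' : Set (G × E) := {z | (z.1, (0 : E)) ∈ Q ∧ (z.1⁻¹, z.2) ∈ Q}
  have hQ' : IsOpen Q' :=
    (hQ.preimage (by fun_prop : Continuous fun z : G × E => (z.1, (0 : E)))).inter
      (hQ.preimage (by fun_prop : Continuous fun z : G × E => (z.1⁻¹, z.2)))
  have hA : ContMDiffOn (𝓘(ℝ, EG).prod 𝓘(ℝ, E)) 𝓘(ℝ, E →L[ℝ] E) ∞ (fun z : G × E => A z.1) Q' :=
    (contMDiffOn_fderiv_snd hQ hb).comp (f := fun z : G × E => (z.1, (0 : E)))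
      (contMDiffOn_fst.prodMk contMDiffOn_const) fun z hz => hz.1
  have hAmul : ∀ (h k : MulAction.stabilizer G m) (e : E),
      A (↑(h * k)) e = A h (A k e) := by
    intro h k e
    have h1 : (fun e => b (↑(h * k)) e) =ᶠ[𝓝 0] fun e => b h (b k e) := by
      have h2 : ∀ᶠ e in 𝓝 (0 : E), ((k : G), e) ∈ Q :=
        (Continuous.prodMk_right (k : G)).continuousAt (hQ.mem_nhds (hHQ k))
      filter_upwards [h2] with e he
      simp only [b]
      rw [φ.left_inv he.2, ← mul_smul]
      rfl
    have h3 : HasFDerivAt (fun e => b h (b k e)) ((A h).comp (A k)) 0 := by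
      refine HasFDerivAt.comp (g := b h) 0 ?_ (hbd k).hasFDerivAt
      rw [hb0]
      exact (hbd h).hasFDerivAt
    have h4 : A (↑(h * k)) = (A h).comp (A k) := by
      simp only [A]
      rw [h1.fderiv_eq, h3.fderiv]
    exact congrArg (fun B : E →L[ℝ] E => B e) h4
  have hAone : ∀ e, A ((1 : MulAction.stabilizer G m) : G) e = e := by
    intro e
    have h1 : b ((1 : MulAction.stabilizer G m) : G) =ᶠ[𝓝 0] fun e => e := by
      filter_upwards [φ.open_target.mem_nhds h0t] with e he
      simp [b, φ.right_inv he]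
    simp only [A]
    rw [h1.fderiv_eq, fderiv_fun_id]
    rfl
  have hAcont : Continuous fun h : MulAction.stabilizer G m => A h :=
    hA.continuousOn.comp_continuous (f := fun h : MulAction.stabilizer G m => ((h : G), (0 : E)))
      (by fun_prop) fun h => ⟨hHQ h, by simpa using hHQ h⁻¹⟩
  let f : G → E → E := fun g e => A g (b g⁻¹ e)
  have hf : ContMDiffOn (𝓘(ℝ, EG).prod 𝓘(ℝ, E)) 𝓘(ℝ, E) ∞ (Function.uncurry f) Q' := by
    have h1 : ContMDiffOn (𝓘(ℝ, EG).prod 𝓘(ℝ, E)) 𝓘(ℝ, E) ∞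
        (fun z : G × E => b z.1⁻¹ z.2) Q' :=
      hb.comp (f := fun z : G × E => (z.1⁻¹, z.2)) (contMDiffOn_fst.inv.prodMk contMDiffOn_snd)
        fun z hz => hz.2
    exact hA.clm_apply h1
  let O : Set E :=
    {e | e ∈ φ.target ∧ ∀ h : MulAction.stabilizer G m, (h : G) • φ.symm e ∈ φ.source}
  have hO : IsOpen O := by
    refine isOpen_forall_mem (f := fun (h : MulAction.stabilizer G m) e => (h : G) • φ.symm e)
      φ.open_target ?_ φ.open_source
    refine ContinuousOn.smul (by fun_prop) ?_
    exact φ.symm.continuousOn.comp continuousOn_snd fun z hz => hz.2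
  have hO0 : (0 : E) ∈ O := ⟨h0t, fun h => (hHQ h).2⟩
  have hOQ : ∀ e ∈ O, ∀ h : MulAction.stabilizer G m, ((h : G), e) ∈ Q' := fun e he h =>
    ⟨hHQ h, ⟨trivial, he.1⟩, by simpa using he.2 h⁻¹⟩
  let F : E → E := fun e => ∫ h : MulAction.stabilizer G m, f h e ∂μ
  have hF : ContDiffOn ℝ ∞ F O := contDiffOn_integral μ continuous_subtype_val hQ' hf hO hOQ
  have hF0 : F 0 = 0 := by
    have : ∀ h : MulAction.stabilizer G m, f h 0 = 0 := fun h => by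
      have h1 := hb0 h⁻¹
      rw [Subgroup.coe_inv] at h1
      simp only [f]
      rw [h1, map_zero]
    simp [F, this]
  have hF' : HasFDerivAt F ((ContinuousLinearEquiv.refl ℝ E : E ≃L[ℝ] E) : E →L[ℝ] E) 0 := by
    refine (hasFDerivAt_integral_of_contMDiffOn μ continuous_subtype_val hQ' hf hO hOQ
      hO0).congr_fderiv ?_
    have h1 : ∀ h : MulAction.stabilizer G m,
        fderiv ℝ (f h) 0 = ContinuousLinearMap.id ℝ E := fun h => by
      have h2 : HasFDerivAt (f h) ((A h).comp (A (↑h⁻¹))) 0 :=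
        (A h).hasFDerivAt.comp (0 : E) (hbd h⁻¹).hasFDerivAt
      rw [h2.fderiv]
      ext e
      change A h (A (↑h⁻¹) e) = e
      rw [← hAmul, mul_inv_cancel, hAone]
    simp only [h1, integral_const, probReal_univ, one_smul]
    rfl
  obtain ⟨ε, hε, hε0, hεO, hεF⟩ := exists_mem_contDiffGroupoid_eq hO hF hO0 hF'
  let ψ₀ := φ.trans ε
  have hψ₀m : m ∈ ψ₀.source := by
    rw [OpenPartialHomeomorph.trans_source]
    exact ⟨hm, by rw [mem_preimage, hφm]; exact hε0⟩
  have hψ₀ : ∀ x, ψ₀ x = F (φ x) := fun x => by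
    rw [OpenPartialHomeomorph.trans_apply, hεF]
  let U : Set M := {x | x ∈ (univ : Set M) ∧ ∀ h : MulAction.stabilizer G m, h • x ∈ ψ₀.source}
  have hU : IsOpen U := by
    refine isOpen_forall_mem (f := fun (h : MulAction.stabilizer G m) (x : M) => h • x)
      isOpen_univ ?_ ψ₀.open_source
    exact (((continuous_subtype_val.comp continuous_fst).smul continuous_snd :
      Continuous fun z : MulAction.stabilizer G m × M => (z.1 : G) • z.2)).continuousOn
  have hUm : m ∈ U := ⟨trivial, fun h => by rw [show h • m = m from h.2]; exact hψ₀m⟩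
  refine ⟨ψ₀.restr U, restr_isOpen_mem_maximalAtlas (trans_mem_maximalAtlas hφ hε) hU,
    ?_, ?_, fun h => A h, hAcont, hAmul, hAone, fun k x hx => ?_⟩
  · rw [OpenPartialHomeomorph.restr_source, hU.interior_eq]
    exact ⟨hψ₀m, hUm⟩
  · rw [OpenPartialHomeomorph.restr_apply, hψ₀, hφm, hF0]
  · rw [OpenPartialHomeomorph.restr_source, hU.interior_eq] at hx ⊢
    refine ⟨⟨hx.2.2 k, trivial, fun h => ?_⟩, ?_⟩
    · rw [smul_smul]
      exact hx.2.2 (h * k)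
    · have hkx : k • x ∈ φ.source := by
        have := hx.2.2 k
        rw [OpenPartialHomeomorph.trans_source] at this
        exact this.1
      have hxs : x ∈ φ.source := by
        have := hx.1
        rw [OpenPartialHomeomorph.trans_source] at this
        exact this.1
      have hxO : φ x ∈ O := by
        have := hx.1
        rw [OpenPartialHomeomorph.trans_source] at this
        exact hεO this.2
      rw [OpenPartialHomeomorph.restr_apply, hψ₀, hψ₀]
      have hint : Integrable (fun h : MulAction.stabilizer G m => f h (φ x)) μ := by
        refine Continuous.integrable_of_hasCompactSupport ?_ (HasCompactSupport.of_compactSpace _)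
        exact hf.continuousOn.comp_continuous (continuous_subtype_val.prodMk continuous_const)
          fun h => hOQ _ hxO h
      simp only [F]
      rw [← ContinuousLinearMap.integral_comp_comm (A k) hint,
        ← integral_mul_left_eq_self (fun h : MulAction.stabilizer G m => f h (φ (k • x))) k]
      refine integral_congr_ae (Eventually.of_forall fun h => ?_)
      simp only [f, b]
      have hcancel : (↑(k * h) : G)⁻¹ • k • x = (h : G)⁻¹ • x := by
        change ((k : G) * (h : G))⁻¹ • (k : G) • x = _
        rw [smul_smul, mul_inv_rev, inv_mul_cancel_right]
      rw [hAmul, φ.left_inv hkx, φ.left_inv hxs, hcancel]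

end EquivariantChart

/-! ### The slice theorem and the local structure of orbit types -/

section Slice

variable {EG : Type*} [NormedAddCommGroup EG] [NormedSpace ℝ EG]
  {G : Type*} [TopologicalSpace G] [ChartedSpace EG G] [Group G] [LieGroup 𝓘(ℝ, EG) ∞ G]
  {E : Type*} [NormedAddCommGroup E] [NormedSpace ℝ E] [FiniteDimensional ℝ E]
  {M : Type*} [TopologicalSpace M] [T2Space M] [ChartedSpace E M] [IsManifold 𝓘(ℝ, E) ∞ M]
  [MulAction G M] [ContMDiffSMul 𝓘(ℝ, EG) 𝓘(ℝ, E) ∞ G M] [ProperSMul G M]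

/-- For a proper action, a group element that moves a point near `m` only slightly is close to the
isotropy group of `m`. -/
theorem exists_isOpen_of_stabilizer_subset {G M : Type*} [TopologicalSpace G] [Group G]
    [TopologicalSpace M] [MulAction G M] [ProperSMul G M] {m : M} {Ω : Set G} (hΩ : IsOpen Ω)
    (hm : ∀ g ∈ MulAction.stabilizer G m, g ∈ Ω) :
    ∃ O : Set M, IsOpen O ∧ m ∈ O ∧ ∀ s ∈ O, ∀ g : G, g • s ∈ O → g ∈ Ω := by
  have hclosed := (ProperSMul.isProperMap_smul_pair (G := G) (X := M)).isClosedMap _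
    (hΩ.isClosed_compl.preimage continuous_fst : IsClosed ((Prod.fst : G × M → G) ⁻¹' Ωᶜ))
  have hmem : (m, m) ∈ ((fun gx : G × M => (gx.1 • gx.2, gx.2)) ''
      ((Prod.fst : G × M → G) ⁻¹' Ωᶜ))ᶜ := by
    rintro ⟨⟨g, x⟩, hg, hgx⟩
    obtain ⟨h1, rfl⟩ := Prod.mk.inj hgx
    exact hg (hm g h1)
  obtain ⟨U, V, hU, hV, hmU, hmV, hUV⟩ := isOpen_prod_iff.1 hclosed.isOpen_compl m m hmem
  refine ⟨U ∩ V, hU.inter hV, ⟨hmU, hmV⟩, fun s hs g hg => ?_⟩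
  by_contra hgΩ
  exact hUV (mk_mem_prod hg.1 hs.2) ⟨(g, s), hgΩ, rfl⟩

/-- The tangent space of the orbit of `m`, read in an equivariant chart, is invariant under the
isotropy representation. -/
theorem isotropy_mem_range {m : M} {ψ : OpenPartialHomeomorph M E}
    (hψ : ψ ∈ IsManifold.maximalAtlas 𝓘(ℝ, E) ∞ M) (hm : m ∈ ψ.source)
    {h : G} (hh : h • m = m) {A : E →L[ℝ] E}
    (hA : ∀ x ∈ ψ.source, ψ (h • x) = A (ψ x)) {e : E}
    (he : e ∈ ((derivMap E E ψ m).comp (orbitDeriv EG E m (1 : G))).range) :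
    A e ∈ ((derivMap E E ψ m).comp (orbitDeriv EG E m (1 : G))).range := by
  have hcs : ContinuousSMul G M := ContMDiffSMul.continuousSMul (I := 𝓘(ℝ, EG)) (I' := 𝓘(ℝ, E)) ∞
  have h1 : (fun x : M => ψ (h • x)) =ᶠ[𝓝 m] fun x => A (ψ x) := by
    filter_upwards [ψ.open_source.mem_nhds hm] with x hx using hA x hx
  have h2 := derivMap_congr (E := E) (E' := E) h1
  have hψm := mdifferentiableAt_chart hψ hm
  rw [derivMap_comp (f := fun x : M => h • x) hh hψm (mdifferentiable_const_smul EG h m),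
    derivMap_comp (g := A) (f := ψ) rfl
      (mdifferentiableAt_iff_differentiableAt.2 A.differentiableAt) hψm, derivMap_eq_fderiv,
    A.fderiv] at h2
  obtain ⟨ξ, rfl⟩ := he
  have h3 : A (derivMap E E ψ m (orbitDeriv EG E m (1 : G) ξ)) = derivMap E E ψ m
      (derivMap E E (fun x : M => h • x) m (orbitDeriv EG E m (1 : G) ξ)) :=
    congrArg (fun B : E →L[ℝ] E => B (orbitDeriv EG E m (1 : G) ξ)) h2.symm
  have h4 : derivMap E E (fun x : M => h • x) m (orbitDeriv EG E m (1 : G) ξ) =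
      orbitDeriv EG E m h (derivMap EG EG (fun k : G => h * k) 1 ξ) :=
    congrArg (fun B : EG →L[ℝ] E => B ξ) (orbitDeriv_comp_mul_left m h).symm
  have h5 : orbitDeriv EG E m h (derivMap EG EG (fun k : G => h * k) 1 ξ) ∈
      (orbitDeriv EG E m (1 : G)).range := by
    have h6 := range_orbitDeriv_le (EG := EG) (E := E) m h
      ⟨derivMap EG EG (fun k : G => h * k) 1 ξ, rfl⟩
    rwa [hh] at h6
  obtain ⟨η, hη⟩ := h5
  refine ⟨η, ?_⟩
  refine (congrArg (derivMap E E ψ m) hη).trans ?_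
  refine (congrArg (derivMap E E ψ m) h4.symm).trans h3.symm

/-- The slice theorem: near `m`, group elements that move a point of the slice `ψ⁻¹ (ker p)` to a
point of the slice fix `m`. -/
theorem IsTubeChart.exists_isOpen_slice {m : M} {ψ χ : OpenPartialHomeomorph M E} {p : E →L[ℝ] E}
    {j : E →L[ℝ] EG} (hχ : IsTubeChart EG G m ψ p j χ)
    {D : MulAction.stabilizer G m → E →L[ℝ] E} (hD : Continuous D)
    (hone : ∀ e, D 1 e = e)
    (hψD : ∀ h, ∀ x ∈ ψ.source, h • x ∈ ψ.source ∧ ψ (h • x) = D h (ψ x))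
    (hp : ∀ h e, p (D h e) = D h (p e)) :
    ∃ O : Set M, IsOpen O ∧ m ∈ O ∧ O ⊆ ψ.source ∧ ∀ s ∈ O, ∀ g : G, g • s ∈ O →
      p (ψ s) = 0 → p (ψ (g • s)) = 0 → g ∈ MulAction.stabilizer G m := by
  have : IsTopologicalGroup G := topologicalGroup_of_lieGroup 𝓘(ℝ, EG) ∞
  have hcs : ContinuousSMul G M := ContMDiffSMul.continuousSMul (I := 𝓘(ℝ, EG)) (I' := 𝓘(ℝ, E)) ∞
  have : CompactSpace (MulAction.stabilizer G m) :=
    isCompact_iff_compactSpace.1 (isCompact_stabilizer m)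
  obtain ⟨r, hr, hball⟩ := hχ.exists_ball_orbit
  have h0t : (0 : E) ∈ χ.target := hχ.apply_eq ▸ χ.map_source hχ.mem_source
  obtain ⟨δ, hδ, hδt⟩ := Metric.isOpen_iff.1 χ.open_target 0 h0t
  -- the group elements near `1` displace `m` by less than `δ / 2`
  have hN : {ζ : EG | ζ ∈ Metric.ball (0 : EG) r ∧ ‖χ (groupCoord EG G ζ • m)‖ < δ / 2} ∈
      𝓝 (0 : EG) := by
    refine Filter.inter_mem (Metric.ball_mem_nhds _ hr) ?_
    have hc : ContinuousAt (fun ζ : EG => ‖χ (groupCoord EG G ζ • m)‖) 0 := by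
      refine ContinuousAt.norm ?_
      have h1 : ContinuousAt (fun ζ : EG => groupCoord EG G ζ • m) 0 :=
        (contMDiffAt_groupCoord zero_mem_groupCoordDomain).continuousAt.smul continuousAt_const
      refine ContinuousAt.comp (g := χ) ?_ h1
      rw [groupCoord_zero, one_smul]
      exact χ.continuousAt hχ.mem_source
    refine hc.preimage_mem_nhds (Iio_mem_nhds ?_)
    rw [groupCoord_zero, one_smul, hχ.apply_eq, norm_zero]
    positivity
  have hN1 := image_groupCoord_mem_nhds (G := G) hN
  set N := groupCoord EG G ''
    {ζ : EG | ζ ∈ Metric.ball (0 : EG) r ∧ ‖χ (groupCoord EG G ζ • m)‖ < δ / 2} with hN_def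
  let Ω : Set G := ⋃ h : MulAction.stabilizer G m, (fun g => g * (h : G)⁻¹) ⁻¹' interior N
  have hΩ : IsOpen Ω := isOpen_iUnion fun h => isOpen_interior.preimage (by fun_prop)
  have hHΩ : ∀ g ∈ MulAction.stabilizer G m, g ∈ Ω := fun g hg => mem_iUnion.2 ⟨⟨g, hg⟩, by
    simpa using mem_interior_iff_mem_nhds.2 hN1⟩
  obtain ⟨O₁, hO₁, hmO₁, hO₁Ω⟩ := exists_isOpen_of_stabilizer_subset hΩ hHΩ
  let O₂ : Set M := {x | x ∈ ψ.source ∧ ∀ h : MulAction.stabilizer G m,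
    D h (ψ x) ∈ Metric.ball (0 : E) (δ / 2)}
  have hO₂ : IsOpen O₂ := by
    refine isOpen_forall_mem ψ.open_source ?_ Metric.isOpen_ball
    exact (hD.comp continuous_fst).continuousOn.clm_apply
      (ψ.continuousOn.comp continuousOn_snd fun z hz => hz.2)
  have hmO₂ : m ∈ O₂ := ⟨hχ.mem_slice, fun h => by
    rw [hχ.slice_apply, map_zero]
    exact Metric.mem_ball_self (by positivity)⟩
  refine ⟨O₁ ∩ O₂, hO₁.inter hO₂, ⟨hmO₁, hmO₂⟩, fun x hx => hx.2.1,
    fun s hs g hgs hps hpgs => ?_⟩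
  obtain ⟨h, hgh⟩ := mem_iUnion.1 (hO₁Ω s hs.1 g hgs.1)
  obtain ⟨ζ, ⟨hζr, hζδ⟩, hζg⟩ := interior_subset hgh
  set t := χ (groupCoord EG G ζ • m) with ht
  have hpt : p t = t := (hball ζ hζr).2.2
  have hct : groupCoord EG G ζ • m = groupCoord EG G (j t) • m :=
    hχ.eq_smul (hball ζ hζr).2.1 hpt
  -- `g` is a small displacement along the orbit of `m` after an element of the isotropy group
  let k : G := (groupCoord EG G (j t))⁻¹ * (groupCoord EG G ζ * h)
  have hk : k ∈ MulAction.stabilizer G m := by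
    rw [MulAction.mem_stabilizer_iff, mul_smul, mul_smul, show (h : G) • m = m from h.2, hct,
      inv_smul_smul]
  have hgk : g = groupCoord EG G (j t) * k := by
    have h1 : groupCoord EG G ζ * (h : G) = g := by
      rw [hζg]
      simp
    simp only [k]
    rw [mul_inv_cancel_left, h1]
  let k' : MulAction.stabilizer G m := ⟨k, hk⟩
  obtain ⟨hks, hψk⟩ := hψD k' s hs.2.1
  set v := D k' (ψ s) with hv
  have hpv : p v = 0 := by rw [hv, hp, hps, map_zero]
  have hjv : ∀ w, p w = 0 → j w = 0 := fun w hw => by rw [← hχ.factor_proj, hw, map_zero]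
  have hvδ : ‖v‖ < δ / 2 := by simpa using hs.2.2 k'
  have htv : t + v ∈ χ.target := hδt <| by
    rw [mem_ball_zero_iff]
    linarith [norm_add_le t v]
  have hv' : ψ (g • s) ∈ χ.target := hδt <| by
    have h1 := hgs.2.2 1
    rw [hone, mem_ball_zero_iff] at h1
    rw [mem_ball_zero_iff]
    linarith
  have h1 : χ.symm (t + v) = g • s := by
    rw [hχ.symm_eq _ htv, map_add, map_add, hjv v hpv, hpt, hpv, add_zero, add_zero,
      add_sub_cancel_left, ← hψk, ψ.left_inv hks, hgk, mul_smul]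
    rfl
  have h2 : χ.symm (ψ (g • s)) = g • s := by
    rw [hχ.symm_eq _ hv', hjv _ hpgs, hpgs, sub_zero, groupCoord_zero, one_smul,
      ψ.left_inv hgs.2.1]
  have h3 : t + v = ψ (g • s) := χ.symm.injOn htv hv' (h1.trans h2.symm)
  have h4 : t = 0 := by
    have h5 := congrArg p h3
    rwa [map_add, hpt, hpv, add_zero, hpgs] at h5
  rw [hgk, h4, map_zero, groupCoord_zero, one_mul]
  exact hk

variable [FiniteDimensional ℝ EG]

variable (EG) in
/-- The local structure of the orbit types: around each `m` there is a chart in which the orbit type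
of `m` is a linear subspace and in which, along that orbit type, the tangent spaces of the orbits
are a constant linear subspace. -/
theorem exists_orbitType_chart (m : M) :
    ∃ χ ∈ IsManifold.maximalAtlas 𝓘(ℝ, E) ∞ M, m ∈ χ.source ∧ ∃ A W : Submodule ℝ E, A ≤ W ∧
      (∀ y ∈ χ.source,
        y ∈ orbitType M (subgroupClass G (MulAction.stabilizer G m)) ↔ χ y ∈ W) ∧
      ∀ y ∈ χ.source, χ y ∈ W →
        ((derivMap E E χ y).comp (orbitDeriv EG E y (1 : G))).range = A := by
  have : CompactSpace (MulAction.stabilizer G m) :=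
    isCompact_iff_compactSpace.1 (isCompact_stabilizer m)
  have : IsTopologicalGroup G := topologicalGroup_of_lieGroup 𝓘(ℝ, EG) ∞
  obtain ⟨ψ, hψ, hm, hψm, D, hD, hmul, hone, hψD⟩ := exists_equivariant_chart EG (G := G) (E := E) m
  obtain ⟨p, hp, hpr, hpD⟩ := exists_equivariant_projection hD hmul hone
    (T := ((derivMap E E ψ m).comp (orbitDeriv EG E m (1 : G))).range)
    fun h e he => isotropy_mem_range hψ hm h.2 (fun x hx => (hψD h x hx).2) he
  obtain ⟨j, χ, hχ⟩ := exists_isTubeChart hψ hm hψm hp hpr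
  obtain ⟨O, hO, hmO, hOψ, hslice⟩ := hχ.exists_isOpen_slice hD hone hψD hpD
  -- the point of the slice on the orbit of `y`
  let σ : M → M := fun y => ψ.symm (χ y - p (χ y))
  have hσ : ContinuousOn σ χ.source := by
    refine ψ.symm.continuousOn.comp (χ.continuousOn.sub (p.continuous.comp_continuousOn
      χ.continuousOn)) fun y hy => hχ.slice_mem _ (χ.map_source hy)
  let U : Set M := χ.source ∩ σ ⁻¹' O
  have hU : IsOpen U := hσ.isOpen_inter_preimage χ.open_source hO
  have hmU : m ∈ U := ⟨hχ.mem_source, by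
    simp only [mem_preimage, σ]
    rw [hχ.apply_eq, map_zero, sub_zero, ← hψm, ψ.left_inv hm]
    exact hmO⟩
  let W : Submodule ℝ E :=
    ⨅ h : MulAction.stabilizer G m,
      LinearMap.eqLocus ((D h).comp (ContinuousLinearMap.id ℝ E - p) : E →ₗ[ℝ] E)
        (ContinuousLinearMap.id ℝ E - p : E →L[ℝ] E)
  have hW : ∀ e, e ∈ W ↔ ∀ h, D h (e - p e) = e - p e := fun e => by
    simp only [W, Submodule.mem_iInf]
    rfl
  have hrestr : (χ.restr U).source = U := by
    rw [OpenPartialHomeomorph.restr_source, hU.interior_eq]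
    exact inter_eq_right.2 inter_subset_left
  have hyσ : ∀ y ∈ U, y = groupCoord EG G (j (χ y)) • σ y := fun y hy => by
    have h1 := hχ.symm_eq _ (χ.map_source hy.1)
    rwa [χ.left_inv hy.1] at h1
  have hψσ : ∀ y ∈ U, ψ (σ y) = χ y - p (χ y) := fun y hy =>
    ψ.right_inv (hχ.slice_mem _ (χ.map_source hy.1))
  have hpσ : ∀ y ∈ U, p (ψ (σ y)) = 0 := fun y hy => by
    rw [hψσ y hy, map_sub, hp, sub_self]
  have hstab : ∀ y ∈ U, MulAction.stabilizer G (σ y) ≤ MulAction.stabilizer G m := by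
    intro y hy g hg
    have hgσ : g • σ y = σ y := hg
    refine hslice _ hy.2 g ?_ (hpσ y hy) ?_
    · rw [hgσ]
      exact hy.2
    · rw [hgσ]
      exact hpσ y hy
  have hfix : ∀ y ∈ U, χ y ∈ W → MulAction.stabilizer G m ≤ MulAction.stabilizer G (σ y) := by
    intro y hy hyW h hh
    obtain ⟨h1, h2⟩ := hψD ⟨h, hh⟩ (σ y) (hOψ hy.2)
    refine ψ.injOn h1 (hOψ hy.2) (h2.trans ?_)
    rw [hψσ y hy]
    exact (hW _).1 hyW _
  refine ⟨χ.restr U, restr_isOpen_mem_maximalAtlas hχ.mem_atlas hU, by rwa [hrestr], p.range, W,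
    ?_, ?_, ?_⟩
  · rintro _ ⟨e, rfl⟩
    refine (hW _).2 fun h => ?_
    change D h (p e - p (p e)) = p e - p (p e)
    rw [hp, sub_self, map_zero]
  · intro y hy
    rw [hrestr] at hy
    have h1 : y ∈ orbitType M (subgroupClass G (MulAction.stabilizer G m)) ↔
        σ y ∈ orbitType M (subgroupClass G (MulAction.stabilizer G m)) := by
      have h2 := hyσ y hy
      constructor
      · intro h3
        have h4 := smul_mem_orbitType h3 (groupCoord EG G (j (χ y)))⁻¹
        rwa [inv_smul_eq_iff.2 h2] at h4
      · intro h3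
        rw [h2]
        exact smul_mem_orbitType h3 _
    rw [h1]
    constructor
    · intro h2
      have h3 := stabilizer_eq_of_le EG E (hstab y hy) h2
      refine (hW _).2 fun h => ?_
      obtain ⟨-, h4⟩ := hψD h (σ y) (hOψ hy.2)
      have h5 : (h : G) ∈ MulAction.stabilizer G (σ y) := h3.ge h.2
      have h6 : h • σ y = σ y := h5
      have h7 := hψσ y hy
      rw [h6, h7] at h4
      exact h4.symm
    · intro h2
      have h3 := le_antisymm (hstab y hy) (hfix y hy h2)
      exact congrArg (subgroupClass G) h3
  · intro y hy hyW
    rw [hrestr] at hy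
    refine (hχ.range_proj_eq hy.1 ?_).symm
    have h1 := finrank_range_generator_smul (EG := EG) (E := E) (σ y) (groupCoord EG G (j (χ y)))
    rw [← hyσ y hy] at h1
    rw [h1]
    have h2 := Submodule.finrank_mono
      (ker_orbitDeriv_one_le_of_stabilizer_le (EG := EG) (E := E) (hfix y hy hyW))
    have h3 := LinearMap.finrank_range_add_finrank_ker (orbitDeriv EG E (σ y) (1 : G) : EG →ₗ[ℝ] E)
    have h4 := LinearMap.finrank_range_add_finrank_ker (orbitDeriv EG E m (1 : G) : EG →ₗ[ℝ] E)
    omega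

end Slice

/-! ### Subsets with adapted charts -/

section AdaptedChart

variable {E : Type*} [NormedAddCommGroup E] [NormedSpace ℝ E] [FiniteDimensional ℝ E]
  {M : Type*} [TopologicalSpace M] [ChartedSpace E M]

/-- The chart `χ` straightens the subset `S` of `M` to the linear subspace `W`. -/
structure IsAdaptedChart (S : Set M) (χ : OpenPartialHomeomorph M E) (W : Submodule ℝ E) :
    Prop where
  mem_atlas : χ ∈ IsManifold.maximalAtlas 𝓘(ℝ, E) ∞ M
  mem_iff : ∀ y ∈ χ.source, y ∈ S ↔ χ y ∈ W

namespace IsAdaptedChart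

variable {S : Set M} {χ : OpenPartialHomeomorph M E} {W : Submodule ℝ E}

theorem mem_tangentSpaceOf_iff (h : IsAdaptedChart S χ W) {y : M} (hy : y ∈ χ.source)
    (hyS : y ∈ S) (v : E) :
    (v : TangentSpace 𝓘(ℝ, E) y) ∈ tangentSpaceOf E S y ↔ derivMap E E χ y v ∈ W := by
  constructor
  · intro hv
    have hle : tangentSpaceOf E S y ≤ W.comap (derivMap E E χ y : E →ₗ[ℝ] E) := by
      refine Submodule.span_le.2 ?_
      rintro v ⟨γ, hγ0, hγ, hγS, rfl⟩
      obtain ⟨p, hp, hpW⟩ := exists_projection W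
      have hγd : MDifferentiableAt 𝓘(ℝ, ℝ) 𝓘(ℝ, E) γ 0 := hγ.mdifferentiableAt (by simp)
      have hχd := mdifferentiableAt_chart h.mem_atlas hy
      have hχγ : MDifferentiableAt 𝓘(ℝ, ℝ) 𝓘(ℝ, E) (fun t => χ (γ t)) 0 :=
        MDifferentiableAt.comp (g := χ) 0 (hγ0.symm ▸ hχd) hγd
      have hev : (fun t => p (χ (γ t))) =ᶠ[𝓝 0] fun t => χ (γ t) := by
        have hsrc : ∀ᶠ t in 𝓝 (0 : ℝ), γ t ∈ χ.source :=
          hγ.continuousAt (χ.open_source.mem_nhds (hγ0.symm ▸ hy))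
        filter_upwards [hγS, hsrc] with t htS ht
        exact apply_eq_of_mem_range hp (hpW.symm ▸ (h.mem_iff _ ht).1 htS)
      have h1 := derivMap_congr (E := ℝ) (E' := E) hev
      rw [derivMap_comp (g := p) (f := fun t => χ (γ t)) rfl
        (mdifferentiableAt_iff_differentiableAt.2 p.differentiableAt) hχγ,
        derivMap_eq_fderiv (f := p), p.fderiv, derivMap_comp (g := χ) hγ0 hχd hγd] at h1
      have h2 : p (derivMap E E χ y (derivMap ℝ E γ 0 1)) =
          derivMap E E χ y (derivMap ℝ E γ 0 1) := congrArg (fun A : ℝ →L[ℝ] E => A 1) h1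
      change derivMap E E χ y (derivMap ℝ E γ 0 1) ∈ W
      rw [← h2, ← hpW]
      exact ⟨_, rfl⟩
    exact hle hv
  · intro hv
    set w := derivMap E E χ y v with hw
    have hyt := χ.map_source hy
    let l : ℝ → E := fun t => χ y + t • w
    have hl0 : l 0 = χ y := by simp [l]
    have hld : HasFDerivAt l ((1 : ℝ →L[ℝ] ℝ).smulRight w) 0 :=
      ((1 : ℝ →L[ℝ] ℝ).smulRight w).hasFDerivAt.const_add (χ y)
    have hlc : ContDiff ℝ ∞ l := by fun_prop
    refine Submodule.subset_span ⟨fun t => χ.symm (l t), ?_, ?_, ?_, ?_⟩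
    · change χ.symm (l 0) = y
      rw [hl0, χ.left_inv hy]
    · refine ContMDiffAt.comp (g := χ.symm) 0 ?_ hlc.contMDiff.contMDiffAt
      rw [hl0]
      exact contMDiffAt_symm_of_mem_maximalAtlas h.mem_atlas hyt
    · have hev : ∀ᶠ t in 𝓝 (0 : ℝ), l t ∈ χ.target :=
        hlc.continuous.continuousAt (χ.open_target.mem_nhds (hl0.symm ▸ hyt))
      filter_upwards [hev] with t ht
      rw [h.mem_iff _ (χ.map_target ht), χ.right_inv ht]
      exact W.add_mem ((h.mem_iff y hy).1 hyS) (W.smul_mem t hv)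
    · have h1 : derivMap ℝ E (fun t => χ.symm (l t)) 0 =
          (derivMap E E χ.symm (χ y)).comp ((1 : ℝ →L[ℝ] ℝ).smulRight w) := by
        rw [derivMap_comp (g := χ.symm) (f := l) hl0 (mdifferentiableAt_chart_symm h.mem_atlas hyt)
          hld.differentiableAt.mdifferentiableAt, derivMap_eq_fderiv (f := l), hld.fderiv]
      have h2 : derivMap ℝ E (fun t => χ.symm (l t)) 0 1 = v := by
        rw [h1]
        change derivMap E E χ.symm (χ y) ((1 : ℝ) • w) = v
        rw [one_smul]
        exact congrArg (fun A : E →L[ℝ] E => A v) (derivMap_symm_comp_chart h.mem_atlas hy)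
      exact h2.symm

theorem finrank_tangentSpaceOf (h : IsAdaptedChart S χ W) {y : M} (hy : y ∈ χ.source)
    (hyS : y ∈ S) : Module.finrank ℝ (tangentSpaceOf E S y) = Module.finrank ℝ W := by
  have h1 : W.comap ((derivChart h.mem_atlas hy).toLinearEquiv : E →ₗ[ℝ] E) =
      (tangentSpaceOf E S y : Submodule ℝ E) := by
    ext v
    exact (h.mem_tangentSpaceOf_iff hy hyS v).symm
  have h2 : Module.finrank ℝ (tangentSpaceOf E S y) =
      Module.finrank ℝ (W.comap ((derivChart h.mem_atlas hy).toLinearEquiv : E →ₗ[ℝ] E)) := by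
    rw [h1]
    rfl
  rw [h2, Submodule.comap_equiv_eq_map_symm]
  exact LinearEquiv.finrank_map_eq _ _

/-- Every point of `S` in the domain of an adapted chart has a neighbourhood that meets `S` in a
connected set. -/
theorem exists_isOpen_subset_component (h : IsAdaptedChart S χ W) {y : M} (hy : y ∈ χ.source)
    (hyS : y ∈ S) :
    ∃ U : Set M, IsOpen U ∧ y ∈ U ∧ U ⊆ χ.source ∧ S ∩ U ⊆ connectedComponentIn S y := by
  obtain ⟨ε, hε, hball⟩ := Metric.isOpen_iff.1 χ.open_target (χ y) (χ.map_source hy)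
  have hyU : y ∈ χ.source ∩ χ ⁻¹' Metric.ball (χ y) ε := ⟨hy, Metric.mem_ball_self hε⟩
  refine ⟨_, χ.isOpen_inter_preimage Metric.isOpen_ball, hyU, inter_subset_left, ?_⟩
  have h1 : S ∩ (χ.source ∩ χ ⁻¹' Metric.ball (χ y) ε) =
      χ.symm '' ((W : Set E) ∩ Metric.ball (χ y) ε) := by
    ext z
    constructor
    · rintro ⟨hzS, hz, hzb⟩
      exact ⟨χ z, ⟨(h.mem_iff z hz).1 hzS, hzb⟩, χ.left_inv hz⟩
    · rintro ⟨e, ⟨heW, heb⟩, rfl⟩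
      have he := hball heb
      refine ⟨(h.mem_iff _ (χ.map_target he)).2 ?_, χ.map_target he, ?_⟩
      · rw [χ.right_inv he]
        exact heW
      · rw [mem_preimage, χ.right_inv he]
        exact heb
  have h2 : IsPreconnected (S ∩ (χ.source ∩ χ ⁻¹' Metric.ball (χ y) ε)) := by
    rw [h1]
    refine (W.convex.inter (convex_ball _ _)).isPreconnected.image _ ?_
    exact χ.symm.continuousOn.mono fun e he => hball he.2
  exact h2.subset_connectedComponentIn ⟨hyS, hyU⟩ inter_subset_left

end IsAdaptedChart

/-- A function that is locally constant on `S` is constant on the connected components of `S`. -/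
theorem eq_of_mem_connectedComponentIn {X Y : Type*} [TopologicalSpace X] {S : Set X} {f : X → Y}
    (hf : ∀ y ∈ S, ∃ U : Set X, IsOpen U ∧ y ∈ U ∧ ∀ z ∈ S, z ∈ U → f z = f y) {x y : X}
    (hx : x ∈ S) (hy : y ∈ connectedComponentIn S x) : f y = f x := by
  let _ : TopologicalSpace Y := ⊥
  have : DiscreteTopology Y := ⟨rfl⟩
  refine isPreconnected_connectedComponentIn.constant (f := f) ?_ hy (mem_connectedComponentIn hx)
  intro z hz
  obtain ⟨U, hU, hzU, hfU⟩ := hf z (connectedComponentIn_subset S x hz)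
  refine ContinuousWithinAt.congr_of_eventuallyEq (f := fun _ => f z) continuousWithinAt_const ?_
    rfl
  filter_upwards [mem_nhdsWithin_of_mem_nhds (hU.mem_nhds hzU), self_mem_nhdsWithin] with w hw hwC
  exact hfU w (connectedComponentIn_subset S x hwC) hw

/-- A subset with adapted charts around its points is a `Σ`-submanifold. -/
theorem isSigmaSubmanifold_of_adaptedCharts [SecondCountableTopology M] {S : Set M}
    (hS : ∀ y ∈ S, ∃ χ W, IsAdaptedChart (E := E) S χ W ∧ y ∈ χ.source) :
    IsSigmaSubmanifold E S := by
  have hopen : ∀ x : S, IsOpen (connectedComponent x) := by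
    refine fun x => isOpen_iff_mem_nhds.2 fun y hy => ?_
    obtain ⟨χ, W, h, hyχ⟩ := hS y y.2
    obtain ⟨U, hU, hyU, -, hUS⟩ := h.exists_isOpen_subset_component hyχ y.2
    rw [connectedComponent_eq hy]
    refine mem_of_superset ((hU.preimage continuous_subtype_val).mem_nhds hyU) fun z hz => ?_
    have h1 := hUS ⟨z.2, hz⟩
    rw [connectedComponentIn_eq_image y.2] at h1
    obtain ⟨z', hz', hzz'⟩ := h1
    rwa [Subtype.ext hzz'] at hz'
  refine ⟨?_, hopen, ?_, fun x hx => ?_⟩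
  · refine ((isLocallyClosed_tfae S).out 0 2).2 fun y hy => ?_
    obtain ⟨χ, W, h, hyχ⟩ := hS y hy
    refine ⟨χ.source, χ.open_source.mem_nhds hyχ, ?_⟩
    have h1 : ((↑) ⁻¹' S : Set χ.source) = (fun z : χ.source => χ z) ⁻¹' (W : Set E) := by
      ext z
      exact h.mem_iff z z.2
    rw [h1]
    exact W.closed_of_finiteDimensional.preimage 
      (continuousOn_iff_continuous_domRestrict.1 χ.continuousOn)
  · have hdisc : DiscreteTopology (ConnectedComponents S) := by
      rw [discreteTopology_iff_isOpen_singleton]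
      intro c
      obtain ⟨x, rfl⟩ := ConnectedComponents.surjective_coe c
      rw [← ConnectedComponents.isQuotientMap_coe.isOpen_preimage,
        connectedComponents_preimage_singleton]
      exact hopen x
    have hsep : TopologicalSpace.SeparableSpace (ConnectedComponents S) :=
      ConnectedComponents.surjective_coe.denseRange.separableSpace
        ConnectedComponents.continuous_coe
    exact TopologicalSpace.separableSpace_iff_countable.1 hsep
  · refine ⟨Module.finrank ℝ (tangentSpaceOf E S x), fun y hy => ?_⟩
    have hyS := connectedComponentIn_subset S x hy
    obtain ⟨χ, W, h, hyχ⟩ := hS y hyS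
    obtain ⟨U, hU, hyU, hUχ, hUS⟩ := h.exists_isOpen_subset_component hyχ hyS
    have hrank : Module.finrank ℝ (tangentSpaceOf E S y) =
        Module.finrank ℝ (tangentSpaceOf E S x) := by
      refine eq_of_mem_connectedComponentIn
        (f := fun y => Module.finrank ℝ (tangentSpaceOf E S y)) (fun z hz => ?_) hx hy
      obtain ⟨χ', W', h', hzχ⟩ := hS z hz
      exact ⟨χ'.source, χ'.open_source, hzχ, fun w hw hwχ => by
        rw [h'.finrank_tangentSpaceOf hwχ hw, h'.finrank_tangentSpaceOf hzχ hz]⟩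
    have hsrc : (χ.restr U).source = U := by
      rw [OpenPartialHomeomorph.restr_source, hU.interior_eq]
      exact inter_eq_right.2 hUχ
    refine ⟨χ.restr U, restr_isOpen_mem_maximalAtlas h.mem_atlas hU, hsrc.symm ▸ hyU, W, ?_,
      fun z hz => ?_⟩
    · rw [← hrank, h.finrank_tangentSpaceOf hyχ hyS]
    · rw [hsrc] at hz
      rw [OpenPartialHomeomorph.restr_apply, ← h.mem_iff z (hUχ hz)]
      constructor
      · exact fun hzC => connectedComponentIn_subset S x hzC
      · intro hzS
        rw [connectedComponentIn_eq hy]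
        exact hUS ⟨hzS, hz⟩

end AdaptedChart

/-! ### Smooth 1-forms and vector fields in a chart -/

section OneForms

variable {E : Type*} [NormedAddCommGroup E] [NormedSpace ℝ E]
  {M : Type*} [TopologicalSpace M] [ChartedSpace E M] [IsManifold 𝓘(ℝ, E) ∞ M]

/-- A 1-form with smooth coefficients in a chart is smooth. -/
theorem isSmoothOneFormOn_of_coefficients {χ : OpenPartialHomeomorph M E}
    (hχ : χ ∈ IsManifold.maximalAtlas 𝓘(ℝ, E) ∞ M) {a : M → E →L[ℝ] ℝ}
    (ha : ContMDiffOn 𝓘(ℝ, E) 𝓘(ℝ, E →L[ℝ] ℝ) ∞ a χ.source) :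
    IsSmoothOneFormOn E (fun y => ((a y).comp (derivMap E E χ y) : E →L[ℝ] ℝ)) χ.source := by
  intro y hy
  refine ContMDiffAt.contMDiffWithinAt ?_
  rw [contMDiffAt_hom_bundle]
  refine ⟨contMDiffAt_id, ?_⟩
  have h1 := ContMDiffAt.mfderiv_const (m := ∞) (contMDiffAt_of_mem_maximalAtlas hχ hy) le_rfl
  have h2 := ((ha y hy).contMDiffAt (χ.open_source.mem_nhds hy)).clm_comp h1
  refine h2.congr_of_eventuallyEq (Eventually.of_forall fun z => ?_)
  ext v
  simp [inTangentCoordinates, ContinuousLinearMap.inCoordinates]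
  rfl

/-- The coordinate vector fields of a chart are smooth. -/
theorem contMDiffOn_coordinateField {χ : OpenPartialHomeomorph M E}
    (hχ : χ ∈ IsManifold.maximalAtlas 𝓘(ℝ, E) ∞ M) (u : E) :
    ContMDiffOn 𝓘(ℝ, E) (𝓘(ℝ, E).prod 𝓘(ℝ, E)) ∞
      (fun e => (⟨χ.symm e, (derivMap E E χ.symm e u : E)⟩ : TangentBundle 𝓘(ℝ, E) M))
      χ.target := by
  intro e he
  refine ContMDiffAt.contMDiffWithinAt ?_
  have h1 := ContMDiffAt.mfderiv_const (m := ∞) (contMDiffAt_symm_of_mem_maximalAtlas hχ he) le_rfl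
  have h2 : ContMDiffAt 𝓘(ℝ, E) (𝓘(ℝ, E).prod 𝓘(ℝ, E)) ∞
      (fun e : E => (⟨e, u⟩ : TangentBundle 𝓘(ℝ, E) E)) e :=
    contMDiffAt_vectorSpace_iff_contDiffAt.2 contDiffAt_const
  exact ContMDiffAt.clm_apply_of_inCoordinates h1 h2
    (contMDiffAt_symm_of_mem_maximalAtlas hχ he)

end OneForms

/-! ### Frames of constant rank -/

section Frames

variable {E : Type*} [NormedAddCommGroup E] [NormedSpace ℝ E] [FiniteDimensional ℝ E]
  {M : Type*} [TopologicalSpace M] [ChartedSpace E M] [IsManifold 𝓘(ℝ, E) ∞ M]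

/-- The covector at `z` with coefficients `β` in the chart `χ`. -/
def chartCovector (χ : OpenPartialHomeomorph M E) (z : M) :
    (E →L[ℝ] ℝ) →ₗ[ℝ] CotangentSpace E z :=
  ((ContinuousLinearMap.compL ℝ E E ℝ).flip (derivMap E E χ z) : (E →L[ℝ] ℝ) →ₗ[ℝ] (E →L[ℝ] ℝ))

/-- Covectors of the form `β ∘ dχ`, with `β` in a fixed subspace `Y` of the dual of the model space,
twisted by endomorphisms `Λ` that vary smoothly, and mapped by `R` injectively onto the fibres of
`F`: a basis of `Y` gives smooth frames. -/
theorem exists_rank_frame {S : Set M} {V : S → Type*} [∀ z, AddCommGroup (V z)]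
    [∀ z, Module ℝ (V z)] (R : ∀ z : S, CotangentSpace E (z : M) →ₗ[ℝ] V z)
    (F : ∀ z, Submodule ℝ (V z))
    (H : ∀ y ∈ S, ∃ χ ∈ IsManifold.maximalAtlas 𝓘(ℝ, E) ∞ M, y ∈ χ.source ∧
      ∃ (Y : Submodule ℝ (E →L[ℝ] ℝ)) (Λ : M → (E →L[ℝ] ℝ) →L[ℝ] (E →L[ℝ] ℝ)),
        ContMDiffOn 𝓘(ℝ, E) 𝓘(ℝ, (E →L[ℝ] ℝ) →L[ℝ] (E →L[ℝ] ℝ)) ∞ Λ χ.source ∧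
        ∀ z : S, (z : M) ∈ χ.source →
          (∀ β ∈ Y, R z (chartCovector χ z (Λ z β)) = 0 → β = 0) ∧
          ∀ v, v ∈ F z ↔ ∃ β ∈ Y, R z (chartCovector χ z (Λ z β)) = v) :
    ∀ x ∈ S, ∃ r : ℕ, ∀ y ∈ connectedComponentIn S x, ∃ U : Set M, IsOpen U ∧ y ∈ U ∧
      ∃ σ : Fin r → ∀ m : M, CotangentSpace E m, (∀ i, IsSmoothOneFormOn E (σ i) U) ∧
        ∀ m : S, (m : M) ∈ U → (m : M) ∈ connectedComponentIn S x →
          LinearIndependent ℝ (fun i => R m (σ i m)) ∧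
          Submodule.span ℝ (range fun i => R m (σ i m)) = F m := by
  intro x hx
  have : Nonempty (OpenPartialHomeomorph M E) := let ⟨χ, _⟩ := H x hx; ⟨χ⟩
  classical
  choose! χ hχ hyχ Y Λ hΛ hF using H
  let T : ∀ (y : M) (z : S), Y y →ₗ[ℝ] V z := fun y z =>
    (R z).comp ((chartCovector (χ y) z).comp ((Λ y z : (E →L[ℝ] ℝ) →ₗ[ℝ] (E →L[ℝ] ℝ)).comp
      (Y y).subtype))
  have hT : ∀ y ∈ S, ∀ z : S, (z : M) ∈ (χ y).source → Function.Injective (T y z) := by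
    intro y hy z hz
    rw [← LinearMap.ker_eq_bot, LinearMap.ker_eq_bot']
    exact fun β hβ => Subtype.ext ((hF y hy z hz).1 β β.2 hβ)
  have hTF : ∀ y ∈ S, ∀ z : S, (z : M) ∈ (χ y).source → LinearMap.range (T y z) = F z := by
    intro y hy z hz
    ext v
    rw [(hF y hy z hz).2]
    exact ⟨fun ⟨β, hβ⟩ => ⟨β, β.2, hβ⟩, fun ⟨β, hβ, h⟩ => ⟨⟨β, hβ⟩, h⟩⟩
  -- the ranks, with an arbitrary value off `S`
  let f : M → ℕ := fun y => if h : y ∈ S then Module.finrank ℝ (F ⟨y, h⟩) else 0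
  have hf : ∀ y ∈ S, ∀ z ∈ S, z ∈ (χ y).source → f z = Module.finrank ℝ (Y y) := by
    intro y hy z hz hzy
    simp only [f, dif_pos hz]
    rw [← hTF y hy ⟨z, hz⟩ hzy, LinearMap.finrank_range_of_inj (hT y hy ⟨z, hz⟩ hzy)]
  refine ⟨f x, fun y hy => ?_⟩
  have hyS := connectedComponentIn_subset S x hy
  have hr : Module.finrank ℝ (Y y) = f x := by
    rw [← hf y hyS y hyS (hyχ y hyS)]
    refine eq_of_mem_connectedComponentIn (fun z hz => ?_) hx hy
    exact ⟨(χ z).source, (χ z).open_source, hyχ z hz, fun w hw hwz => by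
      rw [hf z hz w hw hwz, hf z hz z hz (hyχ z hz)]⟩
  let b := Module.finBasisOfFinrankEq ℝ (Y y) hr
  refine ⟨(χ y).source, (χ y).open_source, hyχ y hyS,
    fun i m => ((Λ y m (b i)).comp (derivMap E E (χ y) m) : E →L[ℝ] ℝ), fun i => ?_,
    fun z hz _ => ⟨?_, ?_⟩⟩
  · exact isSmoothOneFormOn_of_coefficients (hχ y hyS)
      ((hΛ y hyS).clm_apply (contMDiffOn_const (c := (b i : E →L[ℝ] ℝ))))
  · exact b.linearIndependent.map' (T y z) (LinearMap.ker_eq_bot.2 (hT y hyS z hz))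
  · change Submodule.span ℝ (range (T y z ∘ b)) = F z
    rw [range_comp, ← Submodule.map_span, b.span_eq, Submodule.map_top, hTF y hyS z hz]

end Frames

/-! ### Orthogonal extension of linear forms -/

section MetricExtension

variable {E : Type*} [NormedAddCommGroup E] [NormedSpace ℝ E] [FiniteDimensional ℝ E]

/-- Restriction of linear forms to the subspace `W`. -/
def restrictForm (W : Submodule ℝ E) : (E →L[ℝ] ℝ) →L[ℝ] (W →L[ℝ] ℝ) :=
  (ContinuousLinearMap.compL ℝ W E ℝ).flip W.subtypeL

/-- The linear form that agrees with `β` on `W` and vanishes on the complement of `W` orthogonal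
for the scalar product `Γ`: it is `Γ w` for the `w ∈ W` that represents the restriction of `β`. -/
def orthogonalExtension (Γ : E →L[ℝ] E →L[ℝ] ℝ) (W : Submodule ℝ E) :
    (E →L[ℝ] ℝ) →L[ℝ] (E →L[ℝ] ℝ) :=
  (Γ.comp W.subtypeL).comp
    ((((restrictForm W).comp (Γ.comp W.subtypeL)).inverse).comp (restrictForm W))

variable {Γ : E →L[ℝ] E →L[ℝ] ℝ} {W : Submodule ℝ E}

theorem isInvertible_restrictForm_comp (hΓ : ∀ v, v ≠ 0 → 0 < Γ v v) :
    ((restrictForm W).comp (Γ.comp W.subtypeL)).IsInvertible := by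
  set Θ := (restrictForm W).comp (Γ.comp W.subtypeL) with hΘ
  have hinj : Function.Injective (Θ : W →ₗ[ℝ] (W →L[ℝ] ℝ)) := by
    rw [← LinearMap.ker_eq_bot, LinearMap.ker_eq_bot']
    intro w hw
    by_contra h0
    have h1 : Γ (w : E) (w : E) = 0 := congrArg (fun φ : W →L[ℝ] ℝ => φ w) hw
    exact (hΓ w fun h => h0 (Subtype.ext h)).ne' h1
  have hdim : Module.finrank ℝ W = Module.finrank ℝ (W →L[ℝ] ℝ) := by
    rw [← (LinearMap.toContinuousLinearMap : (W →ₗ[ℝ] ℝ) ≃ₗ[ℝ] (W →L[ℝ] ℝ)).finrank_eq]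
    exact (Subspace.dual_finrank_eq (K := ℝ) (V := W)).symm
  exact ⟨(LinearEquiv.ofInjectiveOfFinrankEq (Θ : W →ₗ[ℝ] (W →L[ℝ] ℝ)) hinj
    hdim).toContinuousLinearEquiv, by ext; rfl⟩

theorem orthogonalExtension_apply (hΓ : ∀ v, v ≠ 0 → 0 < Γ v v) (β : E →L[ℝ] ℝ) {w : E}
    (hw : w ∈ W) : orthogonalExtension Γ W β w = β w := by
  obtain ⟨e, he⟩ := isInvertible_restrictForm_comp (W := W) hΓ
  have h1 : ((restrictForm W).comp (Γ.comp W.subtypeL))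
      (((restrictForm W).comp (Γ.comp W.subtypeL)).inverse (restrictForm W β)) =
        restrictForm W β := by
    rw [← he, ContinuousLinearMap.inverse_equiv]
    exact e.apply_symm_apply _
  exact congrArg (fun φ : W →L[ℝ] ℝ => φ ⟨w, hw⟩) h1

theorem orthogonalExtension_apply_eq_zero (β : E →L[ℝ] ℝ) {v : E} (hv : ∀ w ∈ W, Γ w v = 0) :
    orthogonalExtension Γ W β v = 0 :=
  hv _ (Subtype.mem _)

theorem contDiffOn_orthogonalExtension {X : Type*} [NormedAddCommGroup X] [NormedSpace ℝ X]
    {s : Set X} {Γ : X → E →L[ℝ] E →L[ℝ] ℝ} (W : Submodule ℝ E) (hs : ContDiffOn ℝ ∞ Γ s)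
    (hΓ : ∀ x ∈ s, ∀ v, v ≠ 0 → 0 < Γ x v v) :
    ContDiffOn ℝ ∞ (fun x => orthogonalExtension (Γ x) W) s := by
  have h1 : ContDiffOn ℝ ∞ (fun x => (Γ x).comp W.subtypeL) s := hs.clm_comp contDiffOn_const
  have h2 : ContDiffOn ℝ ∞
      (fun x => ((restrictForm W).comp ((Γ x).comp W.subtypeL)).inverse) s := fun x hx =>
    ContDiffAt.comp_contDiffWithinAt (g := ContinuousLinearMap.inverse) x
      (isInvertible_restrictForm_comp (hΓ x hx)).contDiffAt_map_inverse
      ((contDiffOn_const (c := restrictForm W)).clm_comp h1 x hx)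
  exact h1.clm_comp (h2.clm_comp (contDiffOn_const (c := restrictForm W)))

end MetricExtension

section ChartMetric

variable {E : Type*} [NormedAddCommGroup E] [NormedSpace ℝ E] [FiniteDimensional ℝ E]
  {M : Type*} [TopologicalSpace M] [ChartedSpace E M] [IsManifold 𝓘(ℝ, E) ∞ M]

/-- The metric in the coordinates of the chart `χ`. -/
def chartMetric (g : SmoothMetric E M) (χ : OpenPartialHomeomorph M E) (e : E) :
    E →L[ℝ] E →L[ℝ] ℝ :=
  let B : E →L[ℝ] E →L[ℝ] ℝ := g.inner (χ.symm e)
  B.bilinearComp (derivMap E E χ.symm e) (derivMap E E χ.symm e)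

variable {χ : OpenPartialHomeomorph M E} (hχ : χ ∈ IsManifold.maximalAtlas 𝓘(ℝ, E) ∞ M)
  (g : SmoothMetric E M)
include hχ

theorem contDiffOn_chartMetric : ContDiffOn ℝ ∞ (chartMetric g χ) χ.target := by
  rw [contDiffOn_clm_apply]
  intro u
  rw [contDiffOn_clm_apply]
  intro v
  rw [← contMDiffOn_iff_contDiffOn]
  intro e he
  have hu := contMDiffOn_coordinateField hχ u e he
  have hv := contMDiffOn_coordinateField hχ v e he
  have hg := g.contMDiff.contMDiffAt.comp_contMDiffWithinAt e
    ((contMDiffAt_symm_of_mem_maximalAtlas hχ he).contMDiffWithinAt (s := χ.target))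
  have h := ContMDiffWithinAt.clm_bundle_apply₂ (F₁ := E) (F₂ := E) (F₃ := ℝ)
    (E₃ := Bundle.Trivial M ℝ) (b := χ.symm)
    (ψ := fun e => g.inner (χ.symm e)) hg hu hv
  rw [contMDiffWithinAt_totalSpace] at h
  exact h.2

theorem chartMetric_pos {e : E} (he : e ∈ χ.target) (v : E) (hv : v ≠ 0) :
    0 < chartMetric g χ e v v := by
  refine g.pos (χ.symm e) (derivMap E E χ.symm e v : E) fun h => hv ?_
  have h1 := derivMap_chart_comp_symm hχ (χ.map_target he)
  rw [χ.right_inv he] at h1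
  have h2 : derivMap E E χ (χ.symm e) (derivMap E E χ.symm e v) = v :=
    congrArg (fun A : E →L[ℝ] E => A v) h1
  rw [← h2]
  exact (congrArg _ h).trans (map_zero _)

end ChartMetric

/-! ### Extension of covectors and the Whitney sum -/

section Covectors

variable {E : Type*} [NormedAddCommGroup E] [NormedSpace ℝ E] [FiniteDimensional ℝ E]
  {M : Type*} [TopologicalSpace M] [ChartedSpace E M] [IsManifold 𝓘(ℝ, E) ∞ M]

theorem restrictCovector_extendCovector (g : SmoothMetric E M) (S : Set M) (m : M)
    (α : CotangentSpaceOf E S m) : restrictCovector E S m (extendCovector g S m α) = α := by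
  ext v
  exact congrArg α (Submodule.projectionOnto_apply_left (isCompl_normalSpace g S m) v)

/-- A covector that vanishes on the normal space is the extension of its restriction. -/
theorem extendCovector_eq (g : SmoothMetric E M) {S : Set M} {m : M} {p : CotangentSpace E m}
    (hp : ∀ v ∈ normalSpace g S m, p v = 0) :
    extendCovector g S m (restrictCovector E S m p) = p := by
  ext v
  have h1 : p (v - (Submodule.projectionOnto _ _ (isCompl_normalSpace g S m) v :
      tangentSpaceOf E S m)) = 0 := by
    refine hp _ ?_
    rw [← Submodule.projectionOnto_apply_eq_zero_iff (isCompl_normalSpace g S m), map_sub,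
      Submodule.projectionOnto_apply_left, sub_self]
  rw [map_sub, sub_eq_zero] at h1
  exact h1.symm

theorem exists_restrictCovector_eq (S : Set M) (m : M) (α : CotangentSpaceOf E S m) :
    ∃ p : CotangentSpace E m, restrictCovector E S m p = α := by
  have : FiniteDimensional ℝ (TangentSpace 𝓘(ℝ, E) m) := inferInstanceAs (FiniteDimensional ℝ E)
  have : T2Space (TangentSpace 𝓘(ℝ, E) m) := inferInstanceAs (T2Space E)
  obtain ⟨q, hq⟩ := LinearMap.exists_extend (α : tangentSpaceOf E S m →ₗ[ℝ] ℝ)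
  refine ⟨q.toContinuousLinearMap, ?_⟩
  ext v
  exact congrArg (fun l : tangentSpaceOf E S m →ₗ[ℝ] ℝ => l v) hq

end Covectors

section Fibres

variable {EG : Type*} [NormedAddCommGroup EG] [NormedSpace ℝ EG]
  {G : Type*} [TopologicalSpace G] [ChartedSpace EG G] [Group G] [LieGroup 𝓘(ℝ, EG) ∞ G]
  {E : Type*} [NormedAddCommGroup E] [NormedSpace ℝ E] [FiniteDimensional ℝ E]
  {M : Type*} [TopologicalSpace M] [ChartedSpace E M] [IsManifold 𝓘(ℝ, E) ∞ M]
  [MulAction G M] [ContMDiffSMul 𝓘(ℝ, EG) 𝓘(ℝ, E) ∞ G M]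

/-- The Whitney sum is the annihilator of the tangent spaces of the orbits. -/
theorem mem_range_whitneySumFibreMap (g : SmoothMetric E M) (c : SubgroupClass G)
    (m : orbitType M c) (p : CotangentSpace E (m : M)) :
    p ∈ LinearMap.range (whitneySumFibreMap EG g c m) ↔ p.comp (generator EG E G (m : M)) = 0 := by
  constructor
  · rintro ⟨⟨⟨α, hα⟩, ⟨ν, hν⟩⟩, rfl⟩
    ext ξ
    have h1 : extendCovector g (orbitType M c) m α (generator EG E G (m : M) ξ) = 0 :=
      (congrArg (fun φ : CotangentSpaceOf E (orbitType M c) (m : M) =>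
        φ (orbitTypeGenerator EG E c m ξ)) (restrictCovector_extendCovector g _ _ α)).trans
        (congrArg (fun φ : GroupLieAlgebra 𝓘(ℝ, EG) G →L[ℝ] ℝ => φ ξ) hα)
    have h2 : ν (generator EG E G (m : M) ξ) = 0 :=
      congrArg (fun φ : CotangentSpaceOf E (orbitType M c) (m : M) =>
        φ (orbitTypeGenerator EG E c m ξ)) hν
    exact (congrArg₂ (· + ·) h1 h2).trans (add_zero _)
  · intro hp
    refine ⟨⟨⟨restrictCovector E (orbitType M c) m p, ?_⟩,
      ⟨p - extendCovector g (orbitType M c) m (restrictCovector E (orbitType M c) m p), ?_⟩⟩, ?_⟩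
    · exact hp
    · change restrictCovector E (orbitType M c) m _ = 0
      rw [map_sub, restrictCovector_extendCovector, sub_self]
    · exact add_sub_cancel _ _

theorem injective_whitneySumFibreMap (g : SmoothMetric E M) (c : SubgroupClass G)
    (m : orbitType M c) : Function.Injective (whitneySumFibreMap EG g c m) := by
  rw [← LinearMap.ker_eq_bot, LinearMap.ker_eq_bot']
  rintro ⟨⟨α, hα⟩, ⟨ν, hν⟩⟩ h
  have h0 : extendCovector g (orbitType M c) m α + ν = 0 := h
  have h1 := congrArg (restrictCovector E (orbitType M c) m) h0
  rw [map_add, restrictCovector_extendCovector, LinearMap.mem_ker.1 hν, add_zero, map_zero] at h1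
  subst h1
  rw [map_zero, zero_add] at h0
  subst h0
  rfl

theorem injective_whitneySumMap (g : SmoothMetric E M) (c : SubgroupClass G) :
    Function.Injective (whitneySumMap (EG := EG) (M := M) g c) := by
  rintro ⟨⟨m, hm⟩, x⟩ ⟨⟨m', hm'⟩, x'⟩ h
  obtain rfl : m = m' := congrArg TotalSpace.proj h
  have h1 : whitneySumFibreMap EG g c ⟨m, hm⟩ x = whitneySumFibreMap EG g c ⟨m, hm⟩ x' := by
    simpa [whitneySumMap] using h
  rw [injective_whitneySumFibreMap g c _ h1]

end Fibres

/-! ### Covectors in orbit type charts -/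

section Coordinates

variable {E : Type*} [NormedAddCommGroup E] [NormedSpace ℝ E] [FiniteDimensional ℝ E]
  {M : Type*} [TopologicalSpace M] [ChartedSpace E M]

theorem mem_ker_restrictForm {W : Submodule ℝ E} {β : E →L[ℝ] ℝ} :
    β ∈ (restrictForm W).ker ↔ ∀ w ∈ W, β w = 0 := by
  rw [LinearMap.mem_ker]
  constructor
  · exact fun h w hw => congrArg (fun φ : W →L[ℝ] ℝ => φ ⟨w, hw⟩) h
  · intro h
    ext w
    exact h w w.2

variable {χ : OpenPartialHomeomorph M E} (hχ : χ ∈ IsManifold.maximalAtlas 𝓘(ℝ, E) ∞ M)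
include hχ

theorem exists_derivMap_chart_eq {z : M} (hz : z ∈ χ.source) (w : E) :
    ∃ v : E, derivMap E E χ z v = w :=
  (derivChart hχ hz).surjective w

theorem exists_chartCovector_eq {z : M} (hz : z ∈ χ.source) (p : CotangentSpace E z) :
    ∃ β, chartCovector χ z β = p :=
  ⟨(p : E →L[ℝ] ℝ).comp ((derivChart hχ hz).symm : E →L[ℝ] E), by
    ext v
    exact congrArg p ((derivChart hχ hz).symm_apply_apply v)⟩

theorem eq_zero_of_chartCovector_eq_zero {z : M} (hz : z ∈ χ.source) {β : E →L[ℝ] ℝ}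
    (h : chartCovector χ z β = 0) : β = 0 := by
  ext w
  obtain ⟨v, rfl⟩ := exists_derivMap_chart_eq hχ hz w
  exact congrArg (fun p : E →L[ℝ] ℝ => p v) h

end Coordinates

section AdaptedCovectors

variable {E : Type*} [NormedAddCommGroup E] [NormedSpace ℝ E] [FiniteDimensional ℝ E]
  {M : Type*} [TopologicalSpace M] [ChartedSpace E M] [IsManifold 𝓘(ℝ, E) ∞ M]
  {S : Set M} {χ : OpenPartialHomeomorph M E} {W : Submodule ℝ E}

namespace IsAdaptedChart

theorem restrictCovector_eq_zero_iff (h : IsAdaptedChart S χ W) {z : M} (hz : z ∈ χ.source)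
    (hzS : z ∈ S) (β : E →L[ℝ] ℝ) :
    restrictCovector E S z (chartCovector χ z β) = 0 ↔ ∀ w ∈ W, β w = 0 := by
  constructor
  · intro h0 w hw
    obtain ⟨v, rfl⟩ := exists_derivMap_chart_eq h.mem_atlas hz w
    exact congrArg
      (fun φ : CotangentSpaceOf E S z => φ ⟨v, (h.mem_tangentSpaceOf_iff hz hzS v).2 hw⟩) h0
  · intro h0
    ext v
    exact h0 _ ((h.mem_tangentSpaceOf_iff hz hzS (v : TangentSpace 𝓘(ℝ, E) z)).1 v.2)

/-- In coordinates, extending a covector by zero on the normal space is the extension orthogonal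
for the coordinate expression of the metric. -/
theorem extendCovector_restrictCovector (h : IsAdaptedChart S χ W) (g : SmoothMetric E M) {z : M}
    (hz : z ∈ χ.source) (hzS : z ∈ S) (β : E →L[ℝ] ℝ) :
    extendCovector g S z (restrictCovector E S z (chartCovector χ z β)) =
      chartCovector χ z (orthogonalExtension (chartMetric g χ (χ z)) W β) := by
  have hpos := chartMetric_pos h.mem_atlas g (χ.map_source hz)
  have h1 : restrictCovector E S z (chartCovector χ z β) = restrictCovector E S z
      (chartCovector χ z (orthogonalExtension (chartMetric g χ (χ z)) W β)) := by
    ext v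
    exact (orthogonalExtension_apply hpos β
      ((h.mem_tangentSpaceOf_iff hz hzS (v : TangentSpace 𝓘(ℝ, E) z)).1 v.2)).symm
  rw [h1]
  refine extendCovector_eq g fun v hv => ?_
  change orthogonalExtension (chartMetric g χ (χ z)) W β (derivMap E E χ z v) = 0
  refine orthogonalExtension_apply_eq_zero β fun w hw => ?_
  obtain ⟨u, rfl⟩ := exists_derivMap_chart_eq h.mem_atlas hz w
  have hinv : ∀ u : E, derivMap E E χ.symm (χ z) (derivMap E E χ z u) = u :=
    fun u => congrArg (fun A : E →L[ℝ] E => A u) (derivMap_symm_comp_chart h.mem_atlas hz)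
  have key : ∀ y, y = z → ∀ u' v' : E, u' = u → v' = v →
      (g.inner y : E →L[ℝ] E →L[ℝ] ℝ) u' v' = 0 := by
    rintro _ rfl _ _ rfl rfl
    exact hv _ ((h.mem_tangentSpaceOf_iff hz hzS _).2 hw)
  exact key _ (χ.left_inv hz) _ _ (hinv u) (hinv v)

end IsAdaptedChart

end AdaptedCovectors

section OrbitTypeCharts

variable {EG : Type*} [NormedAddCommGroup EG] [NormedSpace ℝ EG]
  {G : Type*} [TopologicalSpace G] [ChartedSpace EG G] [Group G] [LieGroup 𝓘(ℝ, EG) ∞ G]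
  {E : Type*} [NormedAddCommGroup E] [NormedSpace ℝ E] [FiniteDimensional ℝ E]
  {M : Type*} [TopologicalSpace M] [ChartedSpace E M] [IsManifold 𝓘(ℝ, E) ∞ M]
  [MulAction G M] [ContMDiffSMul 𝓘(ℝ, EG) 𝓘(ℝ, E) ∞ G M]

variable (EG) in
/-- The chart `χ` straightens the orbit type `c` to the subspace `W` and, along it, the tangent
spaces of the orbits to one subspace `A` of `W`. -/
structure IsOrbitTypeChart (c : SubgroupClass G) (χ : OpenPartialHomeomorph M E)
    (A W : Submodule ℝ E) : Prop extends IsAdaptedChart (orbitType M c) χ W where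
  le : A ≤ W
  range_generator : ∀ z ∈ χ.source, z ∈ orbitType M c →
    ((derivMap E E χ z).comp (orbitDeriv EG E z (1 : G))).range = A

variable (EG) in
theorem exists_isOrbitTypeChart [FiniteDimensional ℝ EG] [T2Space M] [ProperSMul G M]
    {c : SubgroupClass G} {y : M} (hy : y ∈ orbitType M c) :
    ∃ (χ : OpenPartialHomeomorph M E) (A W : Submodule ℝ E),
      IsOrbitTypeChart EG c χ A W ∧ y ∈ χ.source := by
  obtain ⟨χ, hχ, hyχ, A, W, hAW, hW, hA⟩ := exists_orbitType_chart (G := G) (E := E) EG y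
  obtain rfl : subgroupClass G (MulAction.stabilizer G y) = c := hy
  exact ⟨χ, A, W, ⟨⟨hχ, hW⟩, hAW, fun z hz hzc => hA z hz ((hW z hz).1 hzc)⟩, hyχ⟩

namespace IsOrbitTypeChart

variable {c : SubgroupClass G} {χ : OpenPartialHomeomorph M E} {A W : Submodule ℝ E}

theorem comp_generator_eq_zero_iff (h : IsOrbitTypeChart EG c χ A W) {z : M} (hz : z ∈ χ.source)
    (hzc : z ∈ orbitType M c) (β : E →L[ℝ] ℝ) :
    (chartCovector χ z β).comp (generator EG E G z) = 0 ↔ ∀ a ∈ A, β a = 0 := by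
  rw [← h.range_generator z hz hzc]
  constructor
  · rintro h0 _ ⟨ξ, rfl⟩
    exact congrArg (fun φ : EG →L[ℝ] ℝ => φ ξ) h0
  · intro h0
    ext ξ
    exact h0 _ ⟨ξ, rfl⟩

/-- With a projection `q` onto `W`, the forms `β = β ∘ q` that vanish on `A` represent the
fibre of the zero level of the momentum map of the orbit type. -/
theorem mem_orbitTypeZeroFibre_iff (h : IsOrbitTypeChart EG c χ A W) {q : E →L[ℝ] E}
    (hq : ∀ e, q (q e) = q e) (hqW : q.range = W) {z : orbitType M c} (hz : (z : M) ∈ χ.source)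
    (α : CotangentSpaceOf E (orbitType M c) (z : M)) :
    α ∈ orbitTypeZeroFibre EG E c z ↔ ∃ β : E →L[ℝ] ℝ, ((∀ a ∈ A, β a = 0) ∧ β.comp q = β) ∧
      restrictCovector E (orbitType M c) z (chartCovector χ z β) = α := by
  have hmem : ∀ p : CotangentSpace E (z : M),
      restrictCovector E (orbitType M c) z p ∈ orbitTypeZeroFibre EG E c z ↔
        p.comp (generator EG E G (z : M)) = 0 := fun p => Iff.rfl
  have hfix : ∀ w ∈ W, q w = w := fun w hw => apply_eq_of_mem_range hq (hqW.symm ▸ hw)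
  constructor
  · intro hα
    obtain ⟨p, rfl⟩ := exists_restrictCovector_eq _ _ α
    obtain ⟨β, rfl⟩ := exists_chartCovector_eq h.mem_atlas hz p
    rw [hmem, h.comp_generator_eq_zero_iff hz z.2] at hα
    refine ⟨β.comp q, ⟨fun a ha => ?_, ?_⟩, ?_⟩
    · rw [ContinuousLinearMap.comp_apply, hfix a (h.le ha), hα a ha]
    · ext v
      simp [hq]
    · rw [← sub_eq_zero, ← map_sub, ← map_sub, h.restrictCovector_eq_zero_iff hz z.2]
      intro w hw
      simp [hfix w hw]
  · rintro ⟨β, ⟨hβ, -⟩, rfl⟩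
    rw [hmem, h.comp_generator_eq_zero_iff hz z.2]
    exact hβ

theorem eq_zero_of_restrictCovector_eq_zero (h : IsOrbitTypeChart EG c χ A W) {q : E →L[ℝ] E}
    (hqW : q.range = W) {z : orbitType M c} (hz : (z : M) ∈ χ.source) {β : E →L[ℝ] ℝ}
    (hβ : β.comp q = β) (h0 : restrictCovector E (orbitType M c) z (chartCovector χ z β) = 0) :
    β = 0 := by
  rw [h.restrictCovector_eq_zero_iff hz z.2] at h0
  rw [← hβ]
  ext v
  exact h0 _ (hqW ▸ ⟨v, rfl⟩)

end IsOrbitTypeChart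

/-- The linear forms that vanish on `A` and factor through the endomorphism `q`. -/
def formsThrough (A : Submodule ℝ E) (q : E →L[ℝ] E) : Submodule ℝ (E →L[ℝ] ℝ) where
  carrier := {β | (∀ a ∈ A, β a = 0) ∧ β.comp q = β}
  zero_mem' := ⟨fun _ _ => rfl, ContinuousLinearMap.zero_comp q⟩
  add_mem' := fun {β γ} hβ hγ => ⟨fun a ha => by
    rw [add_apply, hβ.1 a ha, hγ.1 a ha, add_zero], by
    rw [ContinuousLinearMap.add_comp, hβ.2, hγ.2]⟩
  smul_mem' := fun r β hβ => ⟨fun a ha => by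
    rw [smul_apply, hβ.1 a ha, smul_zero], by
    rw [ContinuousLinearMap.smul_comp, hβ.2]⟩

variable [FiniteDimensional ℝ EG] [T2Space M] [ProperSMul G M] (c : SubgroupClass G)

variable (EG) in
include EG in
theorem isSigmaSubmanifold_orbitType [SecondCountableTopology M] :
    IsSigmaSubmanifold E (orbitType M c) :=
  isSigmaSubmanifold_of_adaptedCharts fun _ hy =>
    let ⟨χ, _, W, h, hyχ⟩ := exists_isOrbitTypeChart (E := E) EG hy
    ⟨χ, W, h.toIsAdaptedChart, hyχ⟩

variable (EG) in
include EG in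
theorem isSigmaSubbundle_conormalSpace :
    IsSigmaSubbundle E (orbitType M c) (fun m => conormalSpace E (orbitType M c) (m : M)) := by
  refine exists_rank_frame (fun _ => LinearMap.id) _ fun y hy => ?_
  obtain ⟨χ, A, W, h, hyχ⟩ := exists_isOrbitTypeChart (E := E) EG hy
  refine ⟨χ, h.mem_atlas, hyχ, (restrictForm W).ker, fun _ => ContinuousLinearMap.id ℝ _,
    contMDiffOn_const, fun z hz =>
      ⟨fun β _ h0 => eq_zero_of_chartCovector_eq_zero h.mem_atlas hz h0, fun p => ?_⟩⟩
  constructor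
  · intro hp
    obtain ⟨β, rfl⟩ := exists_chartCovector_eq h.mem_atlas hz p
    exact ⟨β, mem_ker_restrictForm.2 ((h.restrictCovector_eq_zero_iff hz z.2 β).1 hp), rfl⟩
  · rintro ⟨β, hβ, rfl⟩
    exact (h.restrictCovector_eq_zero_iff hz z.2 β).2 (mem_ker_restrictForm.1 hβ)

theorem isSigmaSubbundle_range_whitneySumFibreMap (g : SmoothMetric E M) :
    IsSigmaSubbundle E (orbitType M c)
      (fun m => LinearMap.range (whitneySumFibreMap EG g c m)) := by
  refine exists_rank_frame (fun _ => LinearMap.id) _ fun y hy => ?_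
  obtain ⟨χ, A, W, h, hyχ⟩ := exists_isOrbitTypeChart (E := E) EG hy
  refine ⟨χ, h.mem_atlas, hyχ, (restrictForm A).ker, fun _ => ContinuousLinearMap.id ℝ _,
    contMDiffOn_const, fun z hz =>
      ⟨fun β _ h0 => eq_zero_of_chartCovector_eq_zero h.mem_atlas hz h0, fun p => ?_⟩⟩
  rw [mem_range_whitneySumFibreMap]
  constructor
  · intro hp
    obtain ⟨β, rfl⟩ := exists_chartCovector_eq h.mem_atlas hz p
    exact ⟨β, mem_ker_restrictForm.2 ((h.comp_generator_eq_zero_iff hz z.2 β).1 hp), rfl⟩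
  · rintro ⟨β, hβ, rfl⟩
    exact (h.comp_generator_eq_zero_iff hz z.2 β).2 (mem_ker_restrictForm.1 hβ)

theorem isSigmaSubbundleOf_orbitTypeZeroFibre :
    IsSigmaSubbundleOf E (orbitType M c) (orbitTypeZeroFibre EG E c) := by
  refine exists_rank_frame
    (V := fun z : orbitType M c => CotangentSpaceOf E (orbitType M c) (z : M))
    (fun z => restrictCovector E (orbitType M c) (z : M)) (orbitTypeZeroFibre EG E c)
    fun y hy => ?_
  obtain ⟨χ, A, W, h, hyχ⟩ := exists_isOrbitTypeChart (E := E) EG hy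
  obtain ⟨q, hq, hqW⟩ := exists_projection W
  exact ⟨χ, h.mem_atlas, hyχ, formsThrough A q, fun _ => ContinuousLinearMap.id ℝ _,
    contMDiffOn_const, fun z hz =>
      ⟨fun β hβ h0 => h.eq_zero_of_restrictCovector_eq_zero hqW hz hβ.2 h0,
        h.mem_orbitTypeZeroFibre_iff hq hqW hz⟩⟩

theorem isSigmaSubbundle_zeroFibreInCotangent (g : SmoothMetric E M) :
    IsSigmaSubbundle E (orbitType M c) (zeroFibreInCotangent EG g c) := by
  refine exists_rank_frame (fun _ => LinearMap.id) _ fun y hy => ?_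
  obtain ⟨χ, A, W, h, hyχ⟩ := exists_isOrbitTypeChart (E := E) EG hy
  obtain ⟨q, hq, hqW⟩ := exists_projection W
  refine ⟨χ, h.mem_atlas, hyχ, formsThrough A q,
    fun z => orthogonalExtension (chartMetric g χ (χ z)) W, ?_, fun z hz => ⟨fun β hβ h0 => ?_,
      fun p => ?_⟩⟩
  · exact (contDiffOn_orthogonalExtension W (contDiffOn_chartMetric h.mem_atlas g)
      fun e he => chartMetric_pos h.mem_atlas g he).contMDiffOn.comp
        (contMDiffOn_of_mem_maximalAtlas h.mem_atlas) χ.mapsTo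
  · refine h.eq_zero_of_restrictCovector_eq_zero hqW hz hβ.2 ?_
    rw [← restrictCovector_extendCovector g _ _ (restrictCovector E _ _ _),
      h.extendCovector_restrictCovector g hz z.2]
    exact (congrArg _ h0).trans (map_zero _)
  · constructor
    · rintro ⟨α, hα, rfl⟩
      obtain ⟨β, hβ, rfl⟩ := (h.mem_orbitTypeZeroFibre_iff hq hqW hz α).1 hα
      exact ⟨β, hβ, (h.extendCovector_restrictCovector g hz z.2 β).symm⟩
    · rintro ⟨β, hβ, rfl⟩
      exact ⟨_, (h.mem_orbitTypeZeroFibre_iff hq hqW hz _).2 ⟨β, hβ, rfl⟩,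
        h.extendCovector_restrictCovector g hz z.2 β⟩

end OrbitTypeCharts

end CotangentOrbitTypes

end

open CotangentOrbitTypes in
theorem mainTheorem2
    {EG : Type*} [NormedAddCommGroup EG] [NormedSpace ℝ EG] [FiniteDimensional ℝ EG]
    {G : Type*} [TopologicalSpace G] [ChartedSpace EG G] [Group G] [LieGroup 𝓘(ℝ, EG) ∞ G]
    {E : Type*} [NormedAddCommGroup E] [NormedSpace ℝ E] [FiniteDimensional ℝ E]
    {M : Type*} [TopologicalSpace M] [T2Space M] [SecondCountableTopology M]
    [ChartedSpace E M] [IsManifold 𝓘(ℝ, E) ∞ M]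
    [MulAction G M] [ContMDiffSMul 𝓘(ℝ, EG) 𝓘(ℝ, E) ∞ G M] [ProperSMul G M] :
    (∀ c ∈ isotropyLattice G M,
      IsSigmaSubmanifold E (orbitType M c) ∧
      IsSigmaSubbundleOf E (orbitType M c) (orbitTypeZeroFibre EG E c) ∧
      IsSigmaSubbundle E (orbitType M c) (fun m => conormalSpace E (orbitType M c) (m : M))) ∧
    ∀ g : SmoothMetric E M,
      (∀ c ∈ isotropyLattice G M,
        IsSigmaSubbundle E (orbitType M c) (zeroFibreInCotangent EG g c) ∧
        IsSigmaSubbundle E (orbitType M c) (fun m => LinearMap.range (whitneySumFibreMap EG g c m)) ∧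
        Function.Injective (whitneySumMap EG g c)) ∧
      (isotropyLattice G M).PairwiseDisjoint (fun c => Set.range (whitneySumMap EG g c)) ∧
      momentumMap EG E G M ⁻¹' {0} =
        ⋃ c ∈ isotropyLattice G M, Set.range (whitneySumMap EG g c) := by
  refine ⟨fun c _ => ⟨isSigmaSubmanifold_orbitType EG c, isSigmaSubbundleOf_orbitTypeZeroFibre c,
    isSigmaSubbundle_conormalSpace EG c⟩, fun g => ⟨fun c _ =>
      ⟨isSigmaSubbundle_zeroFibreInCotangent c g, isSigmaSubbundle_range_whitneySumFibreMap c g,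
        injective_whitneySumMap g c⟩, ?_, ?_⟩⟩
  · intro c _ c' _ hcc'
    refine Set.disjoint_left.2 ?_
    rintro _ ⟨x, rfl⟩ ⟨x', hx'⟩
    have h1 : (x'.1 : M) = x.1 := congrArg TotalSpace.proj hx'
    have h2 : subgroupClass G (MulAction.stabilizer G (x.1 : M)) = c := x.1.2
    have h3 : subgroupClass G (MulAction.stabilizer G (x'.1 : M)) = c' := x'.1.2
    exact hcc' (by rw [← h2, ← h3, h1])
  · ext ⟨m, p⟩
    rw [Set.mem_iUnion₂]
    constructor
    · intro hp
      obtain ⟨x, hx⟩ := (mem_range_whitneySumFibreMap (EG := EG) g _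
        (⟨m, rfl⟩ : orbitType M (subgroupClass G (MulAction.stabilizer G m))) p).2 hp
      exact ⟨_, ⟨m, rfl⟩, ⟨⟨m, rfl⟩, x⟩, congrArg (TotalSpace.mk m) hx⟩
    · rintro ⟨c, -, ⟨m, x⟩, h⟩
      rw [← h]
      exact (mem_range_whitneySumFibreMap g c m _).1 ⟨x, rfl⟩
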